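/- Assume that all non-trivial zeros $\rho$ of the Riemann zeta function (those with $0<\mathrm{Re}\,\rho<1$) are simple. Let $\tilde\phi,\tilde\psi:(0,\infty)\to\mathbb C$ be reciprocal functions in the cosine kernel, that is, for all $x>0$, $$\tilde\psi(x)=\frac{2}{\sqrt\pi}\int_0^\infty\tilde\phi(u)\cos(2ux)\,du,\qquad \tilde\phi(x)=\frac{2}{\sqrt\pi}\int_0^\infty\tilde\psi(u)\cos(2ux)\,du,$$ where the integrals converge at least as improper integrals $\lim_{\varepsilon\to0^+,\,R\to\infty}\int_\varepsilon^R$ (all integrals over $(0,\infty)$ below are understood in this sense). Suppose that there are $c\in(0,2)$, $\delta>0$ and a function $F$, holomorphic in $-1<\mathrm{Re}\,w<2$ except for an at most simple pole at $w=0$, such that $F(\sigma+it)=O(|t|^{-1-\delta})$ as $t\to\pm\infty$, uniformly for $\sigma$ in each closed subinterval of $(-1,2)$, and $$\tilde\phi(x)=\frac1{2\pi i}\int_{c-i\infty}^{c+i\infty}F(w)x^{-w}\,dw\qquad(x>0).$$ Put $$Z_1(s)=\frac1{\Gamma(s)}\int_0^\infty x^{s-1}\tilde\phi(x)\,dx,\qquad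 Z_2(s)=\frac1{\Gamma(s)}\int_0^\infty x^{s-1}\tilde\psi(x)\,dx .$$ Then both integrals converge for $0<\mathrm{Re}\,s<1$. Moreover, for all $\alpha,\beta>0$ with $\alpha\beta=\pi$, the two series over $n$ below converge (with partial sums taken over $n\le N$), and there is a sequence of real numbers $T_n\to\infty$ such that the two limits below exist and $$\sqrt\alpha\sum_{n=1}^\infty\frac{\mu(n)}n\tilde\phi\Big(\frac\alpha n\Big)-\sqrt\beta\sum_{n=1}^\infty\frac{\mu(n)}n\tilde\psi\Big(\frac\beta n\Big)=\frac1{\sqrt\alpha}\lim_{n\to\infty}\sum_{|\mathrm{Im}\,\rho|<T_n}\frac{\Gamma(1-\rho)Z_1(1-\rho)\alpha^\rho}{\zeta'(\rho)}=-\frac1{\sqrt\beta}\lim_{n\to\infty}\sum_{|\mathrm{Im}\,\rho|<T_n}\frac{\Gamma(1-\rho)Z_2(1-\rho)\beta^\rho}{\zeta'(\rho)},$$ where $\rho$ runs over the non-trivial zeros of $\zeta$ and $\mu$ is the Möbius function. -/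

import Mathlib

open Filter Topology MeasureTheory

/-- The (possibly only conditionally convergent) integral of `f` over `(0, ∞)` converges to `I`:
`f` is locally integrable on `(0, ∞)`, and the integral of `f` over `[ε, R]` tends to `I` as
`ε → 0+` and `R → ∞`. For a function that is integrable on `(0, ∞)`, this says that `I` is its
Lebesgue integral. -/
def HasImproperIntegral (f : ℝ → ℂ) (I : ℂ) : Prop :=
  LocallyIntegrableOn f (Set.Ioi 0) ∧
    Tendsto (fun p : ℝ × ℝ => ∫ x in p.1..p.2, f x) (𝓝[>] 0 ×ˢ atTop) (𝓝 I)

/-- The value of the improper integral of `f` over `(0, ∞)` (meaningful where it converges). -/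
noncomputable def improperIntegral (f : ℝ → ℂ) : ℂ :=
  limUnder (𝓝[>] (0 : ℝ) ×ˢ (atTop : Filter ℝ)) (fun p : ℝ × ℝ => ∫ x in p.1..p.2, f x)

/-- A convergent improper integral has the value it converges to. -/
theorem HasImproperIntegral.improperIntegral_eq {f : ℝ → ℂ} {I : ℂ}
    (h : HasImproperIntegral f I) : improperIntegral f = I :=
  h.2.limUnder_eq

/-- `g` is the cosine transform of `f`: for all `x > 0`, the integral on the right of
`g x = (2 / √π) ∫_0^∞ f u cos (2 u x) du` converges and the equation holds. -/
def IsCosineTransform (f g : ℝ → ℂ) : Prop :=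
  ∀ x : ℝ, 0 < x → ∃ I : ℂ,
    HasImproperIntegral (fun u : ℝ => f u * (Real.cos (2 * u * x) : ℂ)) I ∧
      g x = ((2 / Real.sqrt Real.pi : ℝ) : ℂ) * I

/-- `f` and `g` are a pair of reciprocal functions in the cosine kernel. -/
def CosineReciprocal (f g : ℝ → ℂ) : Prop :=
  IsCosineTransform f g ∧ IsCosineTransform g f

/-- The integrand `x ^ (s - 1) * f x` of the Mellin transform of `f` at `s`. -/
noncomputable def mellinIntegrand (f : ℝ → ℂ) (s : ℂ) (x : ℝ) : ℂ :=
  (x : ℂ) ^ (s - 1) * f x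

/-- The normalized Mellin transform `Z(s) = (1 / Γ(s)) ∫_0^∞ x ^ (s - 1) f x dx`. -/
noncomputable def normalizedMellin (f : ℝ → ℂ) (s : ℂ) : ℂ :=
  1 / Complex.Gamma s * improperIntegral (mellinIntegrand f s)

/-- The class of test functions `f` on `(0, ∞)`: `f` is the inverse Mellin transform, along a line
`Re w = c` with `0 < c < 2`, of a function `F` which is holomorphic in the strip `-1 < Re w < 2`
except for an at most simple pole at `w = 0`, and which is `O(|t| ^ (-1 - δ))` as `t = Im w → ±∞`
for some `δ > 0`, uniformly in each closed substrip.

For `φ x = (√α / x) * f (α / x)` this says that `φ` is the inverse Mellin transform of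
`Φ s = α ^ (s - 1 / 2) * F (1 - s)`, which decays in the same way and is holomorphic in
`-1 < Re s < 2` (in particular at `s = 0`) except for an at most simple pole at `s = 1`. -/
def MellinAdmissible (f : ℝ → ℂ) : Prop :=
  ∃ F : ℂ → ℂ,
    DifferentiableOn ℂ F {w : ℂ | -1 < w.re ∧ w.re < 2 ∧ w ≠ 0} ∧
    (∃ r : ℂ, Tendsto (fun w : ℂ => w * F w) (𝓝[≠] 0) (𝓝 r)) ∧
    (∃ δ : ℝ, 0 < δ ∧ ∀ a b : ℝ, -1 < a → b < 2 → ∃ C : ℝ, ∀ σ t : ℝ, a ≤ σ → σ ≤ b → 1 ≤ |t| →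
      ‖F ((σ : ℂ) + (t : ℂ) * Complex.I)‖ ≤ C * |t| ^ (-1 - δ)) ∧
    (∃ c : ℝ, 0 < c ∧ c < 2 ∧ ∀ x : ℝ, 0 < x → f x = mellinInv c F x)

/-- `ρ` is a non-trivial zero of the Riemann zeta function. -/
def IsNontrivialZetaZero (ρ : ℂ) : Prop :=
  riemannZeta ρ = 0 ∧ 0 < ρ.re ∧ ρ.re < 1

/-- There are finitely many non-trivial zeros of bounded height. -/
theorem finite_nontrivialZetaZeros (T : ℝ) :
    {ρ : ℂ | IsNontrivialZetaZero ρ ∧ |ρ.im| < T}.Finite := by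
  have hK : IsCompact (Set.Icc (0 : ℝ) 1 ×ℂ Set.Icc (-T) T) := isCompact_Icc.reProdIm isCompact_Icc
  refine hK.inter_riemannZetaZeros_finite.subset ?_
  rintro ρ ⟨⟨h0, h1, h2⟩, h3⟩
  have h4 := abs_lt.mp h3
  exact ⟨⟨⟨h1.le, h2.le⟩, ⟨h4.1.le, h4.2.le⟩⟩, h0⟩

/-- The non-trivial zeros `ρ` of the zeta function with `|Im ρ| < T`. -/
noncomputable def zetaZerosBelow (T : ℝ) : Finset ℂ :=
  (finite_nontrivialZetaZeros T).toFinset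

/-- The partial sum `∑_{n = 1}^N (μ(n) / n) f(a / n)`. -/
noncomputable def moebiusPartialSum (f : ℝ → ℂ) (a : ℝ) (N : ℕ) : ℂ :=
  ∑ n ∈ Finset.Icc 1 N, ((ArithmeticFunction.moebius n : ℤ) : ℂ) / (n : ℂ) * f (a / n)

/-- The sum `∑ Γ(1 - ρ) Z(1 - ρ) a ^ ρ / ζ'(ρ)` over the non-trivial zeros `ρ` with `|Im ρ| < T`,
where `Z` is the normalized Mellin transform of `f`. -/
noncomputable def zetaZeroSum (f : ℝ → ℂ) (a T : ℝ) : ℂ :=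
  ∑ ρ ∈ zetaZerosBelow T,
    Complex.Gamma (1 - ρ) * normalizedMellin f (1 - ρ) * (a : ℂ) ^ ρ / deriv riemannZeta ρ

/-!
Let `F` be the Mellin transform of `φ` and `r` its residue at `0`. The identity is the residue theorem
for `H(s) = α ^ (s - 1) F(1 - s) / ζ(s)` on the rectangles `[-1/2, 3/2] × [-T, T]`.

* The line `Re s = 3/2`. Moving the line of integration in the definition of `φ` past the pole at `0`
  gives `φ - r` as an inverse Mellin transform along `Re w = -1/2`. There `1 / ζ(1 - w)` is the
  absolutely convergent series `∑ μ(n) n ^ (w - 1)`, so the Möbius sum of `φ - r` is the integral of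
  `H` over `Re s = 3/2`. The constant `r` contributes `r ∑ μ(n) / n = 0`, which is the prime number
  theorem (`tendsto_sum_moebius_div`); it follows from a Tauberian theorem of Ingham's type
  (`tendsto_zero_of_laplace_continuousOn`) and the non-vanishing of `ζ` on `Re s = 1`.
* The line `Re s = -1/2`. The Mellin transform of `ψ` is
  `G(s) = (2 / √π) 2 ^ (-s) Γ(s) cos (π s / 2) F(1 - s)`, conditionally convergent for `0 < Re s < 1`
  (`IsMellinPair.hasImproperIntegral_cosineTransform`) and, once `ψ(0+)` is subtracted, absolutely
  convergent for `-1 < Re s < 0` (`IsMellinPair.hasMellin_cosineTransform_sub`). Since `G` contains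
  the factor of the functional equation, `H` is on this line a multiple of
  `β ^ (-s) G(s) / ζ(1 - s)` (`contourIntegrand_left_eq`), whose integral is the Möbius sum of `ψ`.
* The horizontal sides. As `F` is only `O(|t| ^ (-1 - δ))`, heights `T` are needed at which `1 / ζ`
  is at most `T ^ θ` with `θ ≤ 1`, uniformly in `-1/2 ≤ Re s ≤ 3/2`. They are supplied, with
  `θ = 0.95` and without the Riemann hypothesis, by `exists_height_norm_inv_riemannZeta_le`. The
  ratio `ξ(s + 2) / ξ(s)` is controlled by the zeros near `s` (`norm_riemannXi_shift_two`, by the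
  Borel-Carathéodory inequality and the symmetry of `ξ` about the critical line). At `Re s = 10` this
  bounds a sum of positive weights over the zeros by `log T + O(1)`; averaging over windows of bounded
  length gives a height at which the weights that matter for `-1/2 ≤ Re s ≤ 3/2` add up to at most
  `1.95 log T`.

The residue at a zero `ρ` is `α ^ (ρ - 1) F(1 - ρ) / ζ'(ρ)`, and `F(1 - ρ) = Γ(1 - ρ) Z₁(1 - ρ)`. The
second sum over zeros agrees with the first before the limit is taken, term by term under
`ρ ↦ 1 - ρ` (`zetaZeroSum_reciprocal`), by the derivative of the functional equation at a zero.
-/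

open Metric


/-! ### The residue theorem for rectangles -/

/-- The integral of `f` over the boundary of the rectangle `[a, b] × [c, d]`, counterclockwise. -/
noncomputable def rectIntegral (f : ℂ → ℂ) (a b c d : ℝ) : ℂ :=
  (∫ x in a..b, f (x + c * Complex.I)) - (∫ x in a..b, f (x + d * Complex.I)) +
    Complex.I * (∫ y in c..d, f (b + y * Complex.I)) -
    Complex.I * (∫ y in c..d, f (a + y * Complex.I))

lemma integral_inv_sub_horizontal {p : ℂ} {a b y : ℝ} (hy : y ≠ p.im) :
    ∫ x in a..b, ((x : ℂ) + y * Complex.I - p)⁻¹ =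
      Complex.log (b + y * Complex.I - p) - Complex.log (a + y * Complex.I - p) := by
  have hne : ∀ x : ℝ, (x : ℂ) + y * Complex.I - p ∈ Complex.slitPlane := fun x => by
    right; simpa using sub_ne_zero.mpr hy
  have hd : ∀ x : ℝ, HasDerivAt (fun x : ℝ => Complex.log ((x : ℂ) + y * Complex.I - p))
      ((x : ℂ) + y * Complex.I - p)⁻¹ x := fun x => by
    have h1 : HasDerivAt (fun x : ℝ => (x : ℂ) + y * Complex.I - p) 1 x :=
      ((Complex.ofRealCLM.hasDerivAt (x := x)).add_const _).sub_const _
    simpa using h1.clog_real (hne x)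
  refine intervalIntegral.integral_eq_sub_of_hasDerivAt (fun x _ => hd x) ?_
  refine Continuous.intervalIntegrable ?_ _ _
  exact Continuous.inv₀ (by fun_prop) fun x => Complex.slitPlane_ne_zero (hne x)

lemma integral_inv_sub_vertical_right {p : ℂ} {b c d : ℝ} (hb : p.re < b) :
    Complex.I * ∫ y in c..d, ((b : ℂ) + y * Complex.I - p)⁻¹ =
      Complex.log (b + d * Complex.I - p) - Complex.log (b + c * Complex.I - p) := by
  have hne : ∀ x : ℝ, (b : ℂ) + x * Complex.I - p ∈ Complex.slitPlane := fun x => by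
    left; simpa using hb
  have hd : ∀ x : ℝ, HasDerivAt (fun x : ℝ => Complex.log ((b : ℂ) + x * Complex.I - p))
      (Complex.I * ((b : ℂ) + x * Complex.I - p)⁻¹) x := fun x => by
    have h1 : HasDerivAt (fun x : ℝ => (b : ℂ) + x * Complex.I - p) Complex.I x := by
      simpa using (((Complex.ofRealCLM.hasDerivAt (x := x)).mul_const Complex.I).const_add
        (b : ℂ)).sub_const p
    simpa [div_eq_mul_inv] using h1.clog_real (hne x)
  rw [← intervalIntegral.integral_const_mul]
  refine intervalIntegral.integral_eq_sub_of_hasDerivAt (fun x _ => hd x) ?_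
  refine Continuous.intervalIntegrable ?_ _ _
  exact continuous_const.mul
    (Continuous.inv₀ (by fun_prop) fun x => Complex.slitPlane_ne_zero (hne x))

lemma integral_inv_sub_vertical_left {p : ℂ} {a c d : ℝ} (ha : a < p.re) :
    Complex.I * ∫ y in c..d, ((a : ℂ) + y * Complex.I - p)⁻¹ =
      Complex.log (-(a + d * Complex.I - p)) - Complex.log (-(a + c * Complex.I - p)) := by
  have h := integral_inv_sub_vertical_right (p := -p) (b := -a) (c := -c) (d := -d)
    (by simpa using ha)
  have e : ∀ y : ℝ, (((-a : ℝ) : ℂ) + (y : ℂ) * Complex.I - -p)⁻¹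
      = -((a : ℂ) + ((-y : ℝ) : ℂ) * Complex.I - p)⁻¹ := fun y => by
    rw [← inv_neg]; congr 1; push_cast; ring
  simp_rw [e] at h
  rw [intervalIntegral.integral_neg,
    intervalIntegral.integral_comp_neg (fun y : ℝ => ((a : ℂ) + (y : ℂ) * Complex.I - p)⁻¹),
    neg_neg, neg_neg, intervalIntegral.integral_symm, neg_neg] at h
  rw [h]
  congr 2 <;> push_cast <;> ring

lemma log_neg_of_im_pos {z : ℂ} (hz : 0 < z.im) :
    Complex.log (-z) = Complex.log z - Real.pi * Complex.I := by
  apply Complex.ext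
  · simp [Complex.log_re]
  · simp [Complex.log_im, Complex.arg_neg_eq_arg_sub_pi_of_im_pos hz]

lemma log_neg_of_im_neg {z : ℂ} (hz : z.im < 0) :
    Complex.log (-z) = Complex.log z + Real.pi * Complex.I := by
  apply Complex.ext
  · simp [Complex.log_re]
  · simp [Complex.log_im, Complex.arg_neg_eq_arg_add_pi_of_im_neg hz]

lemma rectIntegral_inv_sub {p : ℂ} {a b c d : ℝ} (ha : a < p.re) (hb : p.re < b)
    (hc : c < p.im) (hd : p.im < d) :
    rectIntegral (fun s => (s - p)⁻¹) a b c d = 2 * Real.pi * Complex.I := by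
  rw [rectIntegral, integral_inv_sub_horizontal hc.ne, integral_inv_sub_horizontal hd.ne',
    integral_inv_sub_vertical_right hb, integral_inv_sub_vertical_left ha,
    log_neg_of_im_pos (by simpa using hd), log_neg_of_im_neg (by simpa using hc)]
  ring

lemma rectIntegral_eq_zero {f : ℂ → ℂ} {a b c d : ℝ} (hab : a ≤ b) (hcd : c ≤ d)
    (hf : ∀ s : ℂ, a ≤ s.re → s.re ≤ b → c ≤ s.im → s.im ≤ d → DifferentiableAt ℂ f s) :
    rectIntegral f a b c d = 0 := by
  have h := Complex.integral_boundary_rect_eq_zero_of_differentiableOn f ⟨a, c⟩ ⟨b, d⟩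
    (fun s hs => by
      rw [Set.uIcc_of_le hab, Set.uIcc_of_le hcd, Complex.mem_reProdIm] at hs
      exact (hf s hs.1.1 hs.1.2 hs.2.1 hs.2.2).differentiableWithinAt)
  simpa [rectIntegral] using h

/-- The rectangle integral only sees the values on the boundary, where an integrable sum splits. -/
lemma rectIntegral_add_of_eq {f g h : ℂ → ℂ} {a b c d : ℝ} (hab : a ≤ b) (hcd : c ≤ d)
    (hfgh : ∀ s : ℂ, s.re = a ∨ s.re = b ∨ s.im = c ∨ s.im = d → f s = g s + h s)
    (hg : ∀ s : ℂ, a ≤ s.re → s.re ≤ b → c ≤ s.im → s.im ≤ d →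
      s.re = a ∨ s.re = b ∨ s.im = c ∨ s.im = d → ContinuousAt g s)
    (hh : ∀ s : ℂ, a ≤ s.re → s.re ≤ b → c ≤ s.im → s.im ≤ d →
      s.re = a ∨ s.re = b ∨ s.im = c ∨ s.im = d → ContinuousAt h s) :
    rectIntegral f a b c d = rectIntegral g a b c d + rectIntegral h a b c d := by
  have key1 : ∀ y : ℝ, (y = c ∨ y = d) → ∀ k : ℂ → ℂ,
      (∀ s : ℂ, a ≤ s.re → s.re ≤ b → c ≤ s.im → s.im ≤ d →
      s.re = a ∨ s.re = b ∨ s.im = c ∨ s.im = d → ContinuousAt k s) →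
      IntervalIntegrable (fun x : ℝ => k (x + y * Complex.I)) volume a b := by
    intro y hy k hk
    refine ContinuousOn.intervalIntegrable fun x hx => ?_
    rw [Set.uIcc_of_le hab] at hx
    refine ContinuousAt.continuousWithinAt (ContinuousAt.comp (g := k)
      (f := fun x : ℝ => (x : ℂ) + y * Complex.I) ?_ (by fun_prop))
    rcases hy with rfl | rfl
    · exact hk _ (by simpa using hx.1) (by simpa using hx.2) (by simp) (by simpa using hcd)
        (by simp)
    · exact hk _ (by simpa using hx.1) (by simpa using hx.2) (by simpa using hcd) (by simp)
        (by simp)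
  have key2 : ∀ x : ℝ, (x = a ∨ x = b) → ∀ k : ℂ → ℂ,
      (∀ s : ℂ, a ≤ s.re → s.re ≤ b → c ≤ s.im → s.im ≤ d →
      s.re = a ∨ s.re = b ∨ s.im = c ∨ s.im = d → ContinuousAt k s) →
      IntervalIntegrable (fun y : ℝ => k (x + y * Complex.I)) volume c d := by
    intro x hx k hk
    refine ContinuousOn.intervalIntegrable fun y hy => ?_
    rw [Set.uIcc_of_le hcd] at hy
    refine ContinuousAt.continuousWithinAt (ContinuousAt.comp (g := k)
      (f := fun y : ℝ => (x : ℂ) + y * Complex.I) ?_ (by fun_prop))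
    rcases hx with rfl | rfl
    · exact hk _ (by simp) (by simpa using hab) (by simpa using hy.1) (by simpa using hy.2)
        (by simp)
    · exact hk _ (by simpa using hab) (by simp) (by simpa using hy.1) (by simpa using hy.2)
        (by simp)
  have e1 : ∀ x : ℝ, f (x + c * Complex.I) = g (x + c * Complex.I) + h (x + c * Complex.I) :=
    fun x => hfgh _ (by simp)
  have e2 : ∀ x : ℝ, f (x + d * Complex.I) = g (x + d * Complex.I) + h (x + d * Complex.I) :=
    fun x => hfgh _ (by simp)
  have e3 : ∀ y : ℝ, f (a + y * Complex.I) = g (a + y * Complex.I) + h (a + y * Complex.I) :=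
    fun x => hfgh _ (by simp)
  have e4 : ∀ y : ℝ, f (b + y * Complex.I) = g (b + y * Complex.I) + h (b + y * Complex.I) :=
    fun x => hfgh _ (by simp)
  simp only [rectIntegral, e1, e2, e3, e4]
  rw [intervalIntegral.integral_add (key1 c (.inl rfl) g hg) (key1 c (.inl rfl) h hh),
    intervalIntegral.integral_add (key1 d (.inr rfl) g hg) (key1 d (.inr rfl) h hh),
    intervalIntegral.integral_add (key2 a (.inl rfl) g hg) (key2 a (.inl rfl) h hh),
    intervalIntegral.integral_add (key2 b (.inr rfl) g hg) (key2 b (.inr rfl) h hh)]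
  ring

/-- The residue theorem for a rectangle and a function with at most simple poles. -/
theorem rectIntegral_eq_sum_residues {a b c d : ℝ} (hab : a ≤ b) (hcd : c ≤ d) (r : ℂ → ℂ)
    (S : Finset ℂ) : ∀ h : ℂ → ℂ,
    (∀ s : ℂ, a ≤ s.re → s.re ≤ b → c ≤ s.im → s.im ≤ d → s ∉ S → DifferentiableAt ℂ h s) →
    (∀ p ∈ S, a < p.re ∧ p.re < b ∧ c < p.im ∧ p.im < d ∧
      Tendsto (fun s => (s - p) * h s) (𝓝[≠] p) (𝓝 (r p))) →
    rectIntegral h a b c d = 2 * Real.pi * Complex.I * ∑ p ∈ S, r p := by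
  classical
  induction S using Finset.induction_on with
  | empty =>
    intro h hd _
    simpa using rectIntegral_eq_zero hab hcd fun s h1 h2 h3 h4 => hd s h1 h2 h3 h4 (by simp)
  | insert p S hp ih =>
    intro h hd hres
    obtain ⟨hpa, hpb, hpc, hpd, hlim⟩ := hres p (Finset.mem_insert_self _ _)
    set h1 : ℂ → ℂ := fun s => h s - r p * (s - p)⁻¹ with h1def
    set h2 : ℂ → ℂ := Function.update h1 p (limUnder (𝓝[≠] p) h1) with h2def
    have hoff : ∀ s, s ≠ p → h2 =ᶠ[𝓝 s] h1 := fun s hs => by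
      filter_upwards [isOpen_compl_singleton.mem_nhds hs] with z hz
      exact Function.update_of_ne hz _ _
    have hd1 : ∀ s, s ≠ p → DifferentiableAt ℂ (fun s => r p * (s - p)⁻¹) s := fun s hs =>
      ((differentiableAt_id.sub_const p).inv (sub_ne_zero.mpr hs)).const_mul _
    -- near `p` the only possible pole is `p` itself
    have hnear : ∀ᶠ s in 𝓝 p, s ≠ p → DifferentiableAt ℂ h s := by
      have hS : ∀ᶠ s in 𝓝 p, s ∉ S :=
        (S.finite_toSet.isClosed.isOpen_compl).mem_nhds (by simpa using hp)
      have c1 := Complex.continuous_re.continuousAt (x := p)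
      have c2 := Complex.continuous_im.continuousAt (x := p)
      filter_upwards [hS, c1.eventually (lt_mem_nhds hpa), c1.eventually (gt_mem_nhds hpb),
        c2.eventually (lt_mem_nhds hpc), c2.eventually (gt_mem_nhds hpd)] with s k1 k2 k3 k4 k5 k6
      exact hd s k2.le k3.le k4.le k5.le (by simp [k6, k1])
    have hdp : DifferentiableAt ℂ h2 p := by
      refine DifferentiableOn.differentiableAt
        (Complex.differentiableOn_update_limUnder_of_isLittleO hnear ?_ ?_) hnear
      · rintro s ⟨hs, hsp⟩
        exact ((hs hsp).sub (hd1 s hsp)).differentiableWithinAt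
      · rw [Asymptotics.isLittleO_iff_tendsto']
        · have : Tendsto (fun s => (s - p) * h s - r p - (s - p) * h1 p) (𝓝[≠] p)
              (𝓝 (r p - r p - 0)) := by
            refine (hlim.sub_const _).sub ?_
            have : Tendsto (fun s : ℂ => (s - p) * h1 p) (𝓝 p) (𝓝 ((p - p) * h1 p)) :=
              (by fun_prop : Continuous fun s : ℂ => (s - p) * h1 p).tendsto p
            rw [sub_self, zero_mul] at this
            exact this.mono_left nhdsWithin_le_nhds
          rw [sub_self, sub_self] at this
          refine this.congr' ?_
          filter_upwards [self_mem_nhdsWithin] with s hs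
          have : s - p ≠ 0 := sub_ne_zero.mpr hs
          simp only [h1def]
          field_simp
        · filter_upwards [self_mem_nhdsWithin] with s hs h0
          exact absurd h0 (inv_ne_zero (sub_ne_zero.mpr hs))
    have hI := ih h2 (fun s k1 k2 k3 k4 k5 => by
        by_cases hs : s = p
        · rw [hs]; exact hdp
        · refine DifferentiableAt.congr_of_eventuallyEq ?_ (hoff s hs)
          exact (hd s k1 k2 k3 k4 (by simp [hs, k5])).sub (hd1 s hs))
      (fun q hq => by
        obtain ⟨k1, k2, k3, k4, k5⟩ := hres q (Finset.mem_insert_of_mem hq)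
        have hqp : q ≠ p := fun e => hp (e ▸ hq)
        refine ⟨k1, k2, k3, k4, ?_⟩
        have : Tendsto (fun s => (s - q) * h s - (s - q) * (r p * (s - p)⁻¹)) (𝓝[≠] q)
            (𝓝 (r q - (q - q) * (r p * (q - p)⁻¹))) := by
          refine k5.sub (Tendsto.mono_left ?_ nhdsWithin_le_nhds)
          exact ((continuousAt_id.sub continuousAt_const).mul (hd1 q hqp).continuousAt).tendsto
        rw [sub_self, zero_mul, sub_zero] at this
        refine this.congr' ?_
        filter_upwards [(hoff q hqp).filter_mono nhdsWithin_le_nhds] with s hs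
        rw [hs, h1def]; ring)
    have hne : ∀ s : ℂ, s.re = a ∨ s.re = b ∨ s.im = c ∨ s.im = d → s ≠ p := by
      rintro s hs rfl
      rcases hs with h | h | h | h <;> linarith
    have hne' : ∀ s : ℂ, s.re = a ∨ s.re = b ∨ s.im = c ∨ s.im = d → s ∉ S := by
      intro s hs hsS
      obtain ⟨k1, k2, k3, k4, -⟩ := hres s (Finset.mem_insert_of_mem hsS)
      rcases hs with h | h | h | h <;> linarith
    have hadd := rectIntegral_add_of_eq (f := h) (g := h2) (h := fun s => r p * (s - p)⁻¹) hab hcd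
      (fun s hs => by
        rw [h2def, Function.update_of_ne (hne s hs)]; simp [h1def])
      (fun s k1 k2 k3 k4 k5 =>
        (((hd s k1 k2 k3 k4 (by simp [hne s k5, hne' s k5])).sub
          (hd1 s (hne s k5))).congr_of_eventuallyEq (hoff s (hne s k5))).continuousAt)
      (fun s k1 k2 k3 k4 k5 => (hd1 s (hne s k5)).continuousAt)
    have hmul : rectIntegral (fun s => r p * (s - p)⁻¹) a b c d
        = r p * rectIntegral (fun s => (s - p)⁻¹) a b c d := by
      simp only [rectIntegral, intervalIntegral.integral_const_mul]; ring
    rw [hadd, hI, hmul, rectIntegral_inv_sub hpa hpb hpc hpd, Finset.sum_insert hp]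
    ring

/-! ### A Tauberian theorem -/

open scoped FourierTransform in
/-- If the Laplace transform of a bounded `b` extends continuously to `Re s ≥ 0`, the averages of
`b` against the Fourier transform of a compactly supported function tend to zero, by the
Riemann-Lebesgue lemma. -/
lemma tendsto_integral_mul_fourier_of_laplace {b : ℝ → ℂ} (hm : Measurable b)
    (h0 : ∀ u < 0, b u = 0) {C : ℝ} (hC : ∀ u, ‖b u‖ ≤ C) {L : ℂ → ℂ}
    (hL : ContinuousOn L {s | 0 ≤ s.re})
    (hLap : ∀ s : ℂ, 0 < s.re → ∫ u : ℝ, b u * Complex.exp (-s * u) = L s)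
    {χ : ℝ → ℂ} (hχ : Continuous χ) (hχc : HasCompactSupport χ) (hg : Integrable (𝓕 χ)) :
    Tendsto (fun v : ℝ => ∫ w, b (v + w) * 𝓕 χ w) atTop (𝓝 0) := by
  have hC0 : 0 ≤ C := (norm_nonneg _).trans (hC 0)
  have hχi : Integrable χ := hχ.integrable_of_hasCompactSupport hχc
  have hgc : Continuous (𝓕 χ) := VectorFourier.fourierIntegral_continuous
    Real.continuous_fourierChar (by exact continuous_inner) hχi
  -- the identity for a positive abscissa `ε`
  have key : ∀ ε : ℝ, 0 < ε → ∀ v : ℝ,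
      ∫ u : ℝ, b u * Complex.exp (-ε * u) * 𝓕 χ (u - v) =
      ∫ y : ℝ, χ y * L (ε + 2 * Real.pi * y * Complex.I) * Complex.exp (2 * Real.pi * y * v * Complex.I)
      := by
    intro ε hε v
    have hbi : Integrable (fun u : ℝ => b u * Complex.exp (-ε * u)) := by
      have h1 : IntegrableOn (fun u : ℝ => C * Real.exp (-ε * u)) (Set.Ici 0) :=
        ((integrableOn_Ici_iff_integrableOn_Ioi).mpr (exp_neg_integrableOn_Ioi 0 hε)).const_mul C
      refine Integrable.mono' (g := (Set.Ici (0:ℝ)).indicator (fun u : ℝ => C * Real.exp (-ε * u)))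
        ((integrable_indicator_iff measurableSet_Ici).mpr h1)
        (hm.mul (by fun_prop)).aestronglyMeasurable (Eventually.of_forall fun u => ?_)
      by_cases hu : u < 0
      · rw [h0 u hu]; simp [Set.indicator, not_le.mpr hu]
      · rw [Set.indicator_of_mem (by simpa using hu), norm_mul, Complex.norm_exp]
        have : (-(ε:ℂ) * u).re = -ε * u := by simp
        rw [this]; gcongr; exact hC u
    have hprod : Integrable (fun p : ℝ × ℝ => χ p.2 * Complex.exp (-(2 * Real.pi * p.2 * (p.1 - v) *
        Complex.I)) * (b p.1 * Complex.exp (-ε * p.1))) (volume.prod volume) := by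
      have h1 := hbi.mul_prod hχi
      refine h1.norm.mono' ?_ (Eventually.of_forall fun p => ?_)
      · refine Measurable.aestronglyMeasurable ?_
        have : Measurable fun p : ℝ × ℝ => b p.1 := hm.comp measurable_fst
        have h2 : Measurable fun p : ℝ × ℝ => χ p.2 := hχ.measurable.comp measurable_snd
        exact (h2.mul (by fun_prop)).mul (this.mul (by fun_prop))
      · have : ‖Complex.exp (-(2 * Real.pi * p.2 * (p.1 - v) * Complex.I))‖ = 1 := by
          rw [show -(2 * Real.pi * p.2 * (p.1 - v) * Complex.I : ℂ)
            = ((-(2 * Real.pi * p.2 * (p.1 - v)) : ℝ) : ℂ) * Complex.I by push_cast; ring]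
          exact Complex.norm_exp_ofReal_mul_I _
        simp only [norm_mul, this, mul_one]
        exact (mul_comm _ _).le
    calc ∫ u : ℝ, b u * Complex.exp (-ε * u) * 𝓕 χ (u - v)
        = ∫ u : ℝ, ∫ y : ℝ, χ y * Complex.exp (-(2 * Real.pi * y * (u - v) * Complex.I)) *
            (b u * Complex.exp (-ε * u)) := by
          refine integral_congr_ae (Eventually.of_forall fun u => ?_)
          simp only
          have e : 𝓕 χ (u - v) =
              ∫ y : ℝ, χ y * Complex.exp (-(2 * Real.pi * y * (u - v) * Complex.I)) := ?_
          · rw [integral_mul_const, ← e, mul_comm]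
          rw [Real.fourier_real_eq_integral_exp_smul]
          refine integral_congr_ae (Eventually.of_forall fun y => ?_)
          simp only [smul_eq_mul]
          rw [mul_comm]; congr 2; push_cast; ring
      _ = ∫ y : ℝ, ∫ u : ℝ, χ y * Complex.exp (-(2 * Real.pi * y * (u - v) * Complex.I)) *
            (b u * Complex.exp (-ε * u)) := integral_integral_swap hprod
      _ = _ := by
          refine integral_congr_ae (Eventually.of_forall fun y => ?_)
          simp only
          rw [← hLap (ε + 2 * Real.pi * y * Complex.I) (by simpa using hε),
            ← integral_const_mul, ← integral_mul_const]
          refine integral_congr_ae (Eventually.of_forall fun u => ?_)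
          simp only
          have e : Complex.exp (-(2 * Real.pi * y * (u - v) * Complex.I)) *
              Complex.exp (-ε * u) = Complex.exp (-(ε + 2 * Real.pi * y * Complex.I) * u) *
              Complex.exp (2 * Real.pi * y * v * Complex.I) := by
            rw [← Complex.exp_add, ← Complex.exp_add]; congr 1; ring
          linear_combination (χ y * b u) * e
  -- the limit `ε → 0`
  have lim : ∀ v : ℝ, ∫ u, b u * 𝓕 χ (u - v) =
      ∫ y : ℝ, χ y * L (2 * Real.pi * y * Complex.I) * Complex.exp (2 * Real.pi * y * v * Complex.I)
      := by
    intro v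
    have hε : Tendsto (fun n : ℕ => (1 : ℝ) / (n + 1)) atTop (𝓝 0) :=
      tendsto_one_div_add_atTop_nhds_zero_nat
    have t1 : Tendsto (fun n : ℕ => ∫ u : ℝ, b u * Complex.exp (-((1 / (n + 1) : ℝ) : ℂ) * u) *
        𝓕 χ (u - v)) atTop (𝓝 (∫ u, b u * 𝓕 χ (u - v))) := by
      refine tendsto_integral_of_dominated_convergence (fun u => C * ‖𝓕 χ (u - v)‖)
        (fun n => ?_) ((hg.comp_sub_right v).norm.const_mul C) (fun n => ?_) ?_
      · have h2 : Measurable fun u => 𝓕 χ (u - v) := (hgc.comp (by fun_prop)).measurable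
        exact ((hm.mul (by fun_prop)).mul h2).aestronglyMeasurable
      · refine Eventually.of_forall fun u => ?_
        rw [norm_mul, norm_mul]
        by_cases hu : u < 0
        · rw [h0 u hu, norm_zero, zero_mul, zero_mul]; positivity
        · gcongr
          refine (mul_le_of_le_one_right (norm_nonneg _) ?_).trans (hC u)
          rw [Complex.norm_exp, Real.exp_le_one_iff]
          have : (-((1 / (n + 1) : ℝ) : ℂ) * u).re = -((1 / (n + 1) : ℝ) * u) := by
            rw [← Complex.ofReal_neg, Complex.re_ofReal_mul, Complex.ofReal_re]; ring
          rw [this]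
          have : 0 ≤ (1 / ((n : ℝ) + 1)) * u := mul_nonneg (by positivity) (not_lt.mp hu)
          linarith
      · refine Eventually.of_forall fun u => ?_
        have : Tendsto (fun ε : ℝ => b u * Complex.exp (-(ε : ℂ) * u) * 𝓕 χ (u - v)) (𝓝 0)
            (𝓝 (b u * Complex.exp (-((0 : ℝ) : ℂ) * u) * 𝓕 χ (u - v))) :=
          (by fun_prop : Continuous fun ε : ℝ =>
            b u * Complex.exp (-(ε : ℂ) * u) * 𝓕 χ (u - v)).tendsto 0
        simpa [Function.comp_def] using this.comp hε
    have hLc : Continuous fun p : ℝ × ℝ => L ((|p.1| : ℝ) + 2 * Real.pi * p.2 * Complex.I) := by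
      refine hL.comp_continuous (by fun_prop) fun p => ?_
      simp
    obtain ⟨M, hM⟩ := ((isCompact_Icc (a := (0:ℝ)) (b := 1)).prod hχc).exists_bound_of_continuousOn
      hLc.continuousOn
    have t2 : Tendsto (fun n : ℕ => ∫ y : ℝ, χ y * L (((1 / (n + 1) : ℝ) : ℂ) +
        2 * Real.pi * y * Complex.I) * Complex.exp (2 * Real.pi * y * v * Complex.I)) atTop
        (𝓝 (∫ y : ℝ, χ y * L (2 * Real.pi * y * Complex.I) *
          Complex.exp (2 * Real.pi * y * v * Complex.I))) := by
      have habs : ∀ n : ℕ, |(1 : ℝ) / (n + 1)| = 1 / (n + 1) := fun n => abs_of_pos (by positivity)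
      have hc : ∀ n : ℕ, Continuous fun y : ℝ => L (((1 / (n + 1) : ℝ) : ℂ) +
          2 * Real.pi * y * Complex.I) := fun n => by
        have := hLc.comp (by fun_prop : Continuous fun y : ℝ => ((1 : ℝ) / (n + 1), y))
        simpa only [Function.comp_def, habs] using this
      refine tendsto_integral_of_dominated_convergence (fun y => ‖χ y‖ * M)
        (fun n => ?_) (hχi.norm.mul_const M) (fun n => ?_) ?_
      · exact ((hχ.mul (hc n)).mul (by fun_prop)).aestronglyMeasurable
      · refine Eventually.of_forall fun y => ?_
        have e : ‖Complex.exp (2 * Real.pi * y * v * Complex.I)‖ = 1 := by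
          rw [show (2 * Real.pi * y * v * Complex.I : ℂ)
            = ((2 * Real.pi * y * v : ℝ) : ℂ) * Complex.I by push_cast; ring]
          exact Complex.norm_exp_ofReal_mul_I _
        rw [norm_mul, norm_mul, e, mul_one]
        by_cases hy : y ∈ tsupport χ
        · gcongr
          have h1 : (1 : ℝ) / (n + 1) ≤ 1 := by
            rw [div_le_one (by positivity)]; linarith [n.cast_nonneg (α := ℝ)]
          have := hM ((1 : ℝ) / (n + 1), y) ⟨⟨by positivity, h1⟩, hy⟩
          simpa only [habs] using this
        · rw [image_eq_zero_of_notMem_tsupport hy]; simp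
      · refine Eventually.of_forall fun y => ?_
        have h1 := (hLc.comp (by fun_prop : Continuous fun ε : ℝ => (ε, y))).tendsto 0
        have h2 := h1.comp hε
        simp only [Function.comp_def, habs, abs_zero, Complex.ofReal_zero, zero_add] at h2
        exact (h2.const_mul _).mul_const _
    refine tendsto_nhds_unique t1 (t2.congr fun n => ?_)
    rw [key _ (by positivity) v]
  have hRL := (Real.zero_at_infty_fourier
    (fun y : ℝ => χ y * L (2 * Real.pi * y * Complex.I))).comp
    (tendsto_neg_atTop_atBot.mono_right (atBot_le_cocompact (α := ℝ)))
  refine hRL.congr fun v => ?_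
  have h1 : ∫ w, b (v + w) * 𝓕 χ w = ∫ u, b u * 𝓕 χ (u - v) := by
    rw [← integral_add_left_eq_self (fun u => b u * 𝓕 χ (u - v)) v]
    simp
  rw [h1, lim v, Function.comp_apply, Real.fourier_real_eq_integral_exp_smul]
  refine integral_congr_ae (Eventually.of_forall fun y => ?_)
  simp only [smul_eq_mul]
  rw [mul_comm]; congr 2; push_cast; ring

open scoped FourierTransform ContDiff in
/-- A compactly supported function with integrable Fourier transform of total mass one. -/
lemma exists_compactSupport_fourier_integral_eq_one : ∃ χ : ℝ → ℂ, Continuous χ ∧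
    HasCompactSupport χ ∧ Integrable (𝓕 χ) ∧ ∫ w, 𝓕 χ w = 1 := by
  let β : ContDiffBump (0 : ℝ) := ⟨1, 2, one_pos, one_lt_two⟩
  have hs : ContDiff ℝ ∞ fun y : ℝ => (β y : ℂ) := Complex.ofRealCLM.contDiff.comp β.contDiff
  have hc : HasCompactSupport fun y : ℝ => (β y : ℂ) :=
    β.hasCompactSupport.comp_left (g := fun r : ℝ => (r : ℂ)) (by simp)
  have hi : Integrable (𝓕 fun y : ℝ => (β y : ℂ)) := by
    have := (𝓕 (hc.toSchwartzMap hs)).integrable (μ := volume)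
    rwa [SchwartzMap.fourier_coe] at this
  refine ⟨fun y => (β y : ℂ), hs.continuous, hc, hi, ?_⟩
  have h := congrFun (hs.continuous.fourierInv_fourier_eq
    (hs.continuous.integrable_of_hasCompactSupport hc) hi) 0
  rw [Real.fourierInv_eq'] at h
  simp only [inner_zero_right, mul_zero, Complex.ofReal_zero, zero_mul, Complex.exp_zero,
    one_smul] at h
  rw [h, β.one_of_mem_closedBall (by simp [β])]
  simp

open scoped FourierTransform in
/-- A Tauberian theorem of Ingham's type: a bounded slowly oscillating function whose Laplace
transform extends continuously to the closed half plane tends to zero. -/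
theorem tendsto_zero_of_laplace_continuousOn {b : ℝ → ℂ} (hm : Measurable b)
    (h0 : ∀ u < 0, b u = 0) {C : ℝ} (hC : ∀ u, ‖b u‖ ≤ C) {L : ℂ → ℂ}
    (hL : ContinuousOn L {s | 0 ≤ s.re})
    (hLap : ∀ s : ℂ, 0 < s.re → ∫ u : ℝ, b u * Complex.exp (-s * u) = L s)
    (hslow : ∀ ε > 0, ∃ η > 0, ∃ V : ℝ, ∀ v ≥ V, ∀ u : ℝ, |u| ≤ η → ‖b v - b (v + u)‖ ≤ ε) :
    Tendsto b atTop (𝓝 0) := by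
  have hC0 : 0 ≤ C := (norm_nonneg _).trans (hC 0)
  obtain ⟨χ, hχ, hχc, hg, hg1⟩ := exists_compactSupport_fourier_integral_eq_one
  -- averages at scale `1 / l`
  have scaled : ∀ l : ℝ, 0 < l →
      Tendsto (fun v : ℝ => ∫ w, b (v + w / l) * 𝓕 χ w) atTop (𝓝 0) := by
    intro l hl
    have h := tendsto_integral_mul_fourier_of_laplace (b := fun u => b (u / l))
      (hm.comp (by fun_prop)) (fun u hu => h0 _ (div_neg_of_neg_of_pos hu hl)) (fun u => hC _)
      (L := fun s => l * L (l * s))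
      (continuousOn_const.mul (hL.comp (by fun_prop) fun s hs => by
        simpa using mul_nonneg hl.le hs))
      (fun s hs => by
        have h1 := hLap (l * s) (by simpa using mul_pos hl hs)
        rw [← h1]
        have h2 := Measure.integral_comp_div (fun u : ℝ => b u * Complex.exp (-(l * s) * u)) l
        rw [abs_of_pos hl, Complex.real_smul] at h2
        rw [← h2]
        refine integral_congr_ae (Eventually.of_forall fun u => ?_)
        have : (l : ℂ) ≠ 0 := by exact_mod_cast hl.ne'
        simp only; congr 2; push_cast; field_simp) hχ hχc hg
    have h3 := h.comp (tendsto_id.const_mul_atTop hl)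
    refine h3.congr fun v => ?_
    simp only [Function.comp_apply, id]
    refine integral_congr_ae (Eventually.of_forall fun w => ?_)
    simp only
    congr 2; field_simp
  have hgn : 0 ≤ ∫ w, ‖𝓕 χ w‖ := integral_nonneg fun _ => norm_nonneg _
  have hgc : Continuous (𝓕 χ) := VectorFourier.fourierIntegral_continuous
    Real.continuous_fourierChar (by exact continuous_inner)
    (hχ.integrable_of_hasCompactSupport hχc)
  rw [NormedAddGroup.tendsto_nhds_zero]
  intro ε hε
  set K := ∫ w, ‖𝓕 χ w‖ with hK
  obtain ⟨η, hη, V, hV⟩ := hslow (ε / (4 * (K + 1))) (by positivity)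
  -- choose the scale so that the tail beyond `l η` is small
  obtain ⟨l, hl0, hl⟩ : ∃ l : ℝ, 0 < l ∧
      2 * C * ∫ w in {w : ℝ | l * η < |w|}, ‖𝓕 χ w‖ < ε / 4 := by
    have ht : Tendsto (fun n : ℕ => ∫ w in {w : ℝ | (n : ℝ) * η < |w|}, ‖𝓕 χ w‖) atTop
        (𝓝 (∫ w in ⋂ n : ℕ, {w : ℝ | (n : ℝ) * η < |w|}, ‖𝓕 χ w‖)) := by
      refine tendsto_setIntegral_of_antitone
        (fun n => measurableSet_lt measurable_const (by fun_prop)) ?_ ⟨0, hg.norm.integrableOn⟩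
      intro n m hnm w hw
      refine lt_of_le_of_lt ?_ (show (m : ℝ) * η < |w| from hw)
      gcongr
    have he : (⋂ n : ℕ, {w : ℝ | (n : ℝ) * η < |w|}) = ∅ := by
      refine Set.eq_empty_iff_forall_notMem.mpr fun w hw => ?_
      obtain ⟨n, hn⟩ := exists_nat_gt (|w| / η)
      have := Set.mem_iInter.mp hw n
      rw [div_lt_iff₀ hη] at hn
      exact lt_asymm hn this
    rw [he, setIntegral_empty] at ht
    have ht2 := ht.const_mul (2 * C)
    rw [mul_zero] at ht2
    obtain ⟨n, hn, hn1⟩ := ((ht2.eventually (gt_mem_nhds (by positivity : 0 < ε / 4))).and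
      (eventually_ge_atTop 1)).exists
    exact ⟨n, by exact_mod_cast hn1, hn⟩
  have hsc := (NormedAddGroup.tendsto_nhds_zero.mp (scaled l hl0)) (ε / 4) (by positivity)
  filter_upwards [hsc, eventually_ge_atTop V] with v hv1 hv2
  have hbi : Integrable fun w => b (v + w / l) * 𝓕 χ w :=
    hg.bdd_mul (hm.comp (by fun_prop)).aestronglyMeasurable (Eventually.of_forall fun w => hC _)
  have e1 : b v = (∫ w, (b v - b (v + w / l)) * 𝓕 χ w) + ∫ w, b (v + w / l) * 𝓕 χ w := by
    rw [← integral_add ((hg.const_mul (b v)).sub hbi |>.congr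
      (Eventually.of_forall fun w => by simp [sub_mul])) hbi]
    simp only [sub_mul, sub_add_cancel]
    rw [integral_const_mul, hg1, mul_one]
  have hS : MeasurableSet {w : ℝ | l * η < |w|} := measurableSet_lt measurable_const (by fun_prop)
  have e2 : ‖∫ w, (b v - b (v + w / l)) * 𝓕 χ w‖ ≤ ε / (4 * (K + 1)) * K +
      2 * C * ∫ w in {w : ℝ | l * η < |w|}, ‖𝓕 χ w‖ := by
    have hi2 : Integrable ({w : ℝ | l * η < |w|}.indicator fun w => ‖𝓕 χ w‖) :=
      hg.norm.indicator hS
    rw [← integral_indicator hS, hK, ← integral_const_mul, ← integral_const_mul,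
      ← integral_add (hg.norm.const_mul _) (hi2.const_mul _)]
    refine norm_integral_le_of_norm_le ((hg.norm.const_mul _).add (hi2.const_mul _))
      (Eventually.of_forall fun w => ?_)
    rw [norm_mul]
    by_cases hw : l * η < |w|
    · rw [Set.indicator_of_mem (by exact hw)]
      have : ‖b v - b (v + w / l)‖ ≤ 2 * C :=
        (norm_sub_le _ _).trans (by linarith [hC v, hC (v + w / l)])
      have h3 : 0 ≤ ε / (4 * (K + 1)) * ‖𝓕 χ w‖ := by positivity
      have h4 := mul_le_mul_of_nonneg_right this (norm_nonneg (𝓕 χ w))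
      linarith
    · rw [Set.indicator_of_notMem (by exact hw), mul_zero, add_zero]
      gcongr
      refine hV v hv2 _ ?_
      rw [abs_div, abs_of_pos hl0, div_le_iff₀ hl0]
      linarith
  have e3 : ε / (4 * (K + 1)) * K ≤ ε / 4 := by
    rw [div_mul_eq_mul_div, div_le_div_iff₀ (by positivity) (by positivity)]
    nlinarith
  rw [e1]
  refine (norm_add_le _ _).trans_lt ?_
  linarith

/-! ### The sum of `μ(n) / n` -/

open ArithmeticFunction in
lemma abs_sum_moebius_div_le (N : ℕ) : |∑ n ∈ Finset.Icc 1 N, (moebius n : ℝ) / n| ≤ 2 := by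
  rcases Nat.eq_zero_or_pos N with rfl | hN
  · simp
  have hNR : (0 : ℝ) < N := by exact_mod_cast hN
  have h1 : ∑ n ∈ Finset.Ioc 0 N, (moebius n : ℝ) * ((N / n : ℕ) : ℝ) = 1 := by
    have h := sum_Ioc_mul_zeta_eq_sum (R := ℤ) moebius N
    rw [moebius_mul_coe_zeta] at h
    have h2 : ∑ n ∈ Finset.Ioc 0 N, (1 : ArithmeticFunction ℤ) n = 1 := by
      rw [Finset.sum_eq_single 1]
      · simp
      · intro n _ hn; exact one_apply_ne hn
      · intro h; exact absurd (Finset.mem_Ioc.mpr ⟨one_pos, hN⟩) h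
    rw [h2] at h
    have h3 := congrArg (Int.cast : ℤ → ℝ) h.symm
    rw [Int.cast_sum, Int.cast_one] at h3
    simpa only [Int.cast_mul, Int.cast_natCast] using h3
  have hI : Finset.Ioc 0 N = Finset.Icc 1 N := rfl
  rw [hI] at h1
  have h2 : N * ∑ n ∈ Finset.Icc 1 N, (moebius n : ℝ) / n
      = 1 + ∑ n ∈ Finset.Icc 1 N, (moebius n : ℝ) * ((N : ℝ) / n - ((N / n : ℕ) : ℝ)) := by
    rw [← h1, ← Finset.sum_add_distrib, Finset.mul_sum]
    refine Finset.sum_congr rfl fun n _ => ?_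
    ring
  have h3 : |∑ n ∈ Finset.Icc 1 N, (moebius n : ℝ) * ((N : ℝ) / n - ((N / n : ℕ) : ℝ))| ≤ N := by
    refine (Finset.abs_sum_le_sum_abs _ _).trans ?_
    refine (Finset.sum_le_card_nsmul _ _ 1 fun n hn => ?_).trans (by simp)
    rw [abs_mul]
    have a1 : |(moebius n : ℝ)| ≤ 1 := by exact_mod_cast abs_moebius_le_one (n := n)
    have a2 : |(N : ℝ) / n - ((N / n : ℕ) : ℝ)| ≤ 1 := by
      have b1 : ((N / n : ℕ) : ℝ) ≤ (N : ℝ) / n := Nat.cast_div_le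
      have b2 : (N : ℝ) / n < ((N / n : ℕ) : ℝ) + 1 := by
        rw [← Nat.floor_div_eq_div (K := ℝ)]
        exact Nat.lt_floor_add_one _
      rw [abs_le]; constructor <;> linarith
    exact mul_le_one₀ a1 (abs_nonneg _) a2
  have h4 : N * |∑ n ∈ Finset.Icc 1 N, (moebius n : ℝ) / n| ≤ N * 2 := by
    rw [← abs_of_pos hNR, ← abs_mul, abs_of_pos hNR, h2]
    refine (abs_add_le _ _).trans ?_
    rw [abs_one]
    have : (1 : ℝ) ≤ N := by exact_mod_cast hN
    linarith
  exact le_of_mul_le_mul_left h4 hNR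

/-- The step function `u ↦ ∑_{n ≤ e^u} μ(n) / n`. -/
noncomputable def moebiusStep (u : ℝ) : ℂ :=
  ∑ n ∈ Finset.Icc 1 ⌊Real.exp u⌋₊, ((ArithmeticFunction.moebius n : ℤ) : ℂ) / (n : ℂ)

lemma norm_moebiusStep_le (u : ℝ) : ‖moebiusStep u‖ ≤ 2 := by
  have h := abs_sum_moebius_div_le ⌊Real.exp u⌋₊
  have e : moebiusStep u = ((∑ n ∈ Finset.Icc 1 ⌊Real.exp u⌋₊,
      (ArithmeticFunction.moebius n : ℝ) / n : ℝ) : ℂ) := by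
    simp [moebiusStep]
  rw [e, Complex.norm_real]
  exact h

lemma moebiusStep_of_neg {u : ℝ} (hu : u < 0) : moebiusStep u = 0 := by
  have : ⌊Real.exp u⌋₊ = 0 := Nat.floor_eq_zero.mpr (by rwa [Real.exp_lt_one_iff])
  simp [moebiusStep, this]

lemma measurable_moebiusStep : Measurable moebiusStep := by
  have h : Measurable fun N : ℕ =>
    ∑ n ∈ Finset.Icc 1 N, ((ArithmeticFunction.moebius n : ℤ) : ℂ) / (n : ℂ) := measurable_of_countable _
  exact h.comp (Nat.measurable_floor.comp Real.measurable_exp)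

lemma norm_moebiusStep_sub_le {u v : ℝ} (h : u ≤ v) :
    ‖moebiusStep v - moebiusStep u‖ ≤ Real.exp (v - u) - 1 + Real.exp (-u) := by
  set M := ⌊Real.exp u⌋₊
  set N := ⌊Real.exp v⌋₊
  have hMN : M ≤ N := Nat.floor_mono (Real.exp_le_exp.mpr h)
  have e : moebiusStep v - moebiusStep u =
      ∑ n ∈ Finset.Ioc M N, ((ArithmeticFunction.moebius n : ℤ) : ℂ) / (n : ℂ) := by
    rw [moebiusStep, moebiusStep, sub_eq_iff_eq_add']
    exact (Finset.sum_Ioc_consecutive (fun n : ℕ =>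
      ((ArithmeticFunction.moebius n : ℤ) : ℂ) / (n : ℂ)) (Nat.zero_le M) hMN).symm
  rw [e]
  have hpos := Real.exp_pos u
  have h1 : ‖∑ n ∈ Finset.Ioc M N, ((ArithmeticFunction.moebius n : ℤ) : ℂ) / (n : ℂ)‖ ≤
      (Finset.Ioc M N).card • (Real.exp u)⁻¹ := by
    refine norm_sum_le_of_le _ (fun n hn => ?_) |>.trans (Finset.sum_const _).le
    rw [norm_div, div_eq_mul_inv]
    have a1 : ‖((ArithmeticFunction.moebius n : ℤ) : ℂ)‖ ≤ 1 := by
      rw [Complex.norm_intCast]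
      exact_mod_cast ArithmeticFunction.abs_moebius_le_one (n := n)
    have a2 : Real.exp u ≤ n := (Nat.lt_of_floor_lt (Finset.mem_Ioc.mp hn).1).le
    rw [Complex.norm_natCast]
    calc ‖((ArithmeticFunction.moebius n : ℤ) : ℂ)‖ * (n : ℝ)⁻¹ ≤ 1 * (Real.exp u)⁻¹ := by gcongr
      _ = _ := one_mul _
  refine h1.trans ?_
  rw [Nat.card_Ioc, nsmul_eq_mul, Nat.cast_sub hMN, Real.exp_sub, Real.exp_neg]
  have b1 : (N : ℝ) ≤ Real.exp v := Nat.floor_le (Real.exp_pos v).le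
  have b2 : Real.exp u - 1 ≤ M := (Nat.sub_one_lt_floor _).le
  calc ((N : ℝ) - M) * (Real.exp u)⁻¹ ≤ (Real.exp v - (Real.exp u - 1)) * (Real.exp u)⁻¹ := by
        gcongr
    _ = _ := by field_simp; ring

lemma LSeries_moebius_eq_inv {s : ℂ} (hs : 1 < s.re) :
    LSeries (fun n => ((ArithmeticFunction.moebius n : ℤ) : ℂ)) s = (riemannZeta s)⁻¹ := by
  have h := LSeries_one_mul_Lseries_moebius hs
  rw [LSeries_one_eq_riemannZeta hs] at h
  exact eq_inv_of_mul_eq_one_right h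

lemma integral_moebiusStep_mul_exp {s : ℂ} (hs : 0 < s.re) :
    ∫ u : ℝ, moebiusStep u * Complex.exp (-s * u) = (riemannZeta₁ (1 + s))⁻¹ := by
  have hs0 : s ≠ 0 := by rintro rfl; simp at hs
  set f : ℕ → ℂ := fun n => ((ArithmeticFunction.moebius n : ℤ) : ℂ) / (n : ℂ)
  have hterm : ∀ n, LSeries.term f s n =
      LSeries.term (fun n => ((ArithmeticFunction.moebius n : ℤ) : ℂ)) (1 + s) n := by
    intro n
    rcases Nat.eq_zero_or_pos n with rfl | hn
    · simp
    · have : (n : ℂ) ≠ 0 := by exact_mod_cast hn.ne'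
      rw [LSeries.term_of_ne_zero hn.ne', LSeries.term_of_ne_zero hn.ne',
        Complex.cpow_add _ _ this, Complex.cpow_one, div_div]
  have hsum : LSeriesSummable f s := by
    have := (ArithmeticFunction.LSeriesSummable_moebius_iff (s := 1 + s)).mpr (by simpa using hs)
    exact this.congr fun n => (hterm n).symm
  have hval : LSeries f s = s * (riemannZeta₁ (1 + s))⁻¹ := by
    have h1 : LSeries f s =
        LSeries (fun n => ((ArithmeticFunction.moebius n : ℤ) : ℂ)) (1 + s) := tsum_congr hterm
    rw [h1, LSeries_moebius_eq_inv (by simpa using hs),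
      riemannZeta_eq_inv_sub_mul (by simpa using hs0)]
    simp [mul_comm]
  have hO : (fun n : ℕ => ∑ k ∈ Finset.Icc 1 n, f k) =O[atTop] fun n : ℕ => (n : ℝ) ^ (0 : ℝ) := by
    refine Asymptotics.isBigO_of_le' (c := 2) _ fun n => ?_
    rcases Nat.eq_zero_or_pos n with rfl | hn
    · simp
    have := norm_moebiusStep_le (Real.log n)
    rw [moebiusStep, Real.exp_log (by exact_mod_cast hn), Nat.floor_natCast] at this
    simpa using this
  have hI := LSeries_eq_mul_integral f le_rfl hs hsum hO
  rw [hval] at hI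
  have hI' := mul_left_cancel₀ hs0 hI
  rw [hI']
  have himg : Real.exp '' Set.Ioi 0 = Set.Ioi 1 := by
    ext x
    constructor
    · rintro ⟨u, hu, rfl⟩; exact Real.one_lt_exp_iff.mpr hu
    · intro hx
      have hx0 : (0 : ℝ) < x := lt_trans one_pos hx
      exact ⟨Real.log x, Real.log_pos hx, Real.exp_log hx0⟩
  rw [← himg, integral_image_eq_integral_abs_deriv_smul measurableSet_Ioi
    (fun x _ => (Real.hasDerivAt_exp x).hasDerivWithinAt) Real.exp_injective.injOn,
    ← integral_indicator measurableSet_Ioi]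
  have hae : ∀ᵐ u : ℝ, u ≠ 0 := by simp [ae_iff]
  refine integral_congr_ae ?_
  filter_upwards [hae] with u hu
  rcases lt_or_gt_of_ne hu with h | h
  · rw [moebiusStep_of_neg h, Set.indicator_of_notMem (by simpa using h.le), zero_mul]
  · rw [Set.indicator_of_mem (by exact h), abs_of_pos (Real.exp_pos u), Complex.real_smul,
      moebiusStep]
    have : (Real.exp u : ℂ) ^ (-(s + 1)) = Complex.exp (-s * u) * Complex.exp (-u) := by
      rw [Complex.ofReal_exp, Complex.cpow_def_of_ne_zero (Complex.exp_ne_zero _),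
        ← Complex.ofReal_exp, ← Complex.ofReal_log (Real.exp_pos u).le, Real.log_exp,
        ← Complex.exp_add]
      congr 1; ring
    rw [this]
    have h2 : (Real.exp u : ℂ) * Complex.exp (-u) = 1 := by
      rw [Complex.ofReal_exp, ← Complex.exp_add]; simp
    linear_combination (norm := skip) (-(∑ n ∈ Finset.Icc 1 ⌊Real.exp u⌋₊, f n) *
      Complex.exp (-s * u)) * h2
    simp only [f]; ring

lemma riemannZeta₁_ne_zero_of_one_le_re {s : ℂ} (hs : 1 ≤ s.re) : riemannZeta₁ s ≠ 0 := by
  by_cases h : s = 1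
  · rw [h]; simp
  · have := riemannZeta_ne_zero_of_one_le_re hs
    rw [riemannZeta_eq_inv_sub_mul h] at this
    exact right_ne_zero_of_mul this

/-- The prime number theorem in the form `∑ μ(n) / n = 0`. -/
theorem tendsto_sum_moebius_div :
    Tendsto (fun N : ℕ => ∑ n ∈ Finset.Icc 1 N, ((ArithmeticFunction.moebius n : ℤ) : ℂ) / (n : ℂ))
      atTop (𝓝 0) := by
  have h : Tendsto moebiusStep atTop (𝓝 0) := by
    refine tendsto_zero_of_laplace_continuousOn measurable_moebiusStep
      (fun u hu => moebiusStep_of_neg hu) norm_moebiusStep_le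
      (L := fun s => (riemannZeta₁ (1 + s))⁻¹) ?_ (fun s hs => integral_moebiusStep_mul_exp hs) ?_
    · refine ContinuousOn.inv₀ (differentiable_riemannZeta₁.continuous.comp
        (by fun_prop)).continuousOn fun s hs => riemannZeta₁_ne_zero_of_one_le_re ?_
      simpa using hs
    · intro ε hε
      have t1 : Tendsto (fun η : ℝ => Real.exp η - 1) (𝓝[>] 0) (𝓝 0) := by
        have : Tendsto (fun η : ℝ => Real.exp η - 1) (𝓝 0) (𝓝 (Real.exp 0 - 1)) :=
          (by fun_prop : Continuous fun η : ℝ => Real.exp η - 1).tendsto 0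
        rw [Real.exp_zero, sub_self] at this
        exact this.mono_left nhdsWithin_le_nhds
      obtain ⟨η, hη, hη0⟩ := ((t1.eventually (gt_mem_nhds (half_pos hε))).and
        self_mem_nhdsWithin).exists
      have t2 : Tendsto (fun v : ℝ => Real.exp (-(v - η))) atTop (𝓝 0) :=
        Real.tendsto_exp_neg_atTop_nhds_zero.comp (tendsto_atTop_add_const_right _ _ tendsto_id)
      obtain ⟨V, hV⟩ := eventually_atTop.mp (t2.eventually (gt_mem_nhds (half_pos hε)))
      refine ⟨η, hη0, V, fun v hv u hu => ?_⟩
      have hV' := hV v hv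
      rw [abs_le] at hu
      rcases le_total 0 u with h0 | h0
      · rw [norm_sub_rev]
        refine (norm_moebiusStep_sub_le (by linarith)).trans ?_
        have a1 : Real.exp (v + u - v) ≤ Real.exp η := Real.exp_le_exp.mpr (by linarith)
        have a2 : Real.exp (-v) ≤ Real.exp (-(v - η)) :=
          Real.exp_le_exp.mpr (by linarith [show 0 < η from hη0])
        linarith
      · refine (norm_moebiusStep_sub_le (by linarith)).trans ?_
        have a1 : Real.exp (v - (v + u)) ≤ Real.exp η := Real.exp_le_exp.mpr (by linarith)
        have a2 : Real.exp (-(v + u)) ≤ Real.exp (-(v - η)) := Real.exp_le_exp.mpr (by linarith)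
        linarith
  have h2 := h.comp (Real.tendsto_log_atTop.comp tendsto_natCast_atTop_atTop)
  refine h2.congr' ?_
  filter_upwards [eventually_ge_atTop 1] with N hN
  simp only [Function.comp_apply]
  rw [moebiusStep, Real.exp_log (by exact_mod_cast hN), Nat.floor_natCast]

/-! ### The entire function `ξ` -/

/-- The entire function `ξ(s) = s (1 - s) Λ(s)`, where `Λ` is the completed zeta function. It is
written with the entire part of `Λ`, so that the values at the poles `0` and `1` are right. -/
noncomputable def riemannXi (s : ℂ) : ℂ := s * (1 - s) * completedRiemannZeta₀ s - 1

lemma differentiable_riemannXi : Differentiable ℂ riemannXi := by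
  have := differentiable_completedZeta₀
  unfold riemannXi; fun_prop

lemma riemannXi_one_sub (s : ℂ) : riemannXi (1 - s) = riemannXi s := by
  simp only [riemannXi, completedRiemannZeta₀_one_sub]; ring

lemma riemannXi_eq_completedRiemannZeta {s : ℂ} (h0 : s ≠ 0) (h1 : s ≠ 1) :
    riemannXi s = s * (1 - s) * completedRiemannZeta s := by
  have : 1 - s ≠ 0 := sub_ne_zero.mpr h1.symm
  rw [completedRiemannZeta_eq, riemannXi]; field_simp; ring

lemma riemannXi_eq {s : ℂ} (h0 : s ≠ 0) (h1 : s ≠ 1) (hG : s.Gammaℝ ≠ 0) :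
    riemannXi s = s * (1 - s) * s.Gammaℝ * riemannZeta s := by
  rw [riemannXi_eq_completedRiemannZeta h0 h1, riemannZeta_def_of_ne_zero h0]
  field_simp

lemma Gammaℝ_ne_zero_of_im_ne_zero {s : ℂ} (hs : s.im ≠ 0) : s.Gammaℝ ≠ 0 := by
  rw [Ne, Complex.Gammaℝ_eq_zero_iff]
  rintro ⟨n, rfl⟩
  simp at hs

lemma ne_zero_of_im_ne_zero {s : ℂ} (hs : s.im ≠ 0) : s ≠ 0 := by rintro rfl; simp at hs

lemma ne_one_of_im_ne_zero {s : ℂ} (hs : s.im ≠ 0) : s ≠ 1 := by rintro rfl; simp at hs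

lemma riemannXi_eq_of_im_ne_zero {s : ℂ} (hs : s.im ≠ 0) :
    riemannXi s = s * (1 - s) * s.Gammaℝ * riemannZeta s :=
  riemannXi_eq (ne_zero_of_im_ne_zero hs) (ne_one_of_im_ne_zero hs)
    (Gammaℝ_ne_zero_of_im_ne_zero hs)

lemma riemannXi_ne_zero_of_one_le_re {s : ℂ} (hs : 1 ≤ s.re) : riemannXi s ≠ 0 := by
  have h0 : s ≠ 0 := by rintro rfl; norm_num at hs
  by_cases h1 : s = 1
  · simp [h1, riemannXi]
  rw [riemannXi_eq h0 h1 (Complex.Gammaℝ_ne_zero_of_re_pos (by linarith))]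
  exact mul_ne_zero (mul_ne_zero (mul_ne_zero h0 (sub_ne_zero.mpr (Ne.symm h1)))
    (Complex.Gammaℝ_ne_zero_of_re_pos (by linarith))) (riemannZeta_ne_zero_of_one_le_re hs)

lemma isNontrivialZetaZero_of_riemannXi_eq_zero {s : ℂ} (hs : riemannXi s = 0) :
    IsNontrivialZetaZero s := by
  have h1 : s.re < 1 := by
    by_contra h
    exact riemannXi_ne_zero_of_one_le_re (not_lt.mp h) hs
  have h0 : 0 < s.re := by
    by_contra h
    refine riemannXi_ne_zero_of_one_le_re (s := 1 - s) ?_ (by rw [riemannXi_one_sub, hs])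
    simpa using h
  refine ⟨?_, h0, h1⟩
  have a0 : s ≠ 0 := by rintro rfl; simp at h0
  have a1 : s ≠ 1 := by rintro rfl; simp at h1
  have aG := Complex.Gammaℝ_ne_zero_of_re_pos h0
  rw [riemannXi_eq a0 a1 aG] at hs
  exact (mul_eq_zero.mp hs).resolve_left
    (mul_ne_zero (mul_ne_zero a0 (sub_ne_zero.mpr a1.symm)) aG)

lemma deriv_riemannXi_ne_zero {s : ℂ} (hs : IsNontrivialZetaZero s)
    (hd : deriv riemannZeta s ≠ 0) : deriv riemannXi s ≠ 0 := by
  obtain ⟨hz, h0, h1⟩ := hs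
  have a0 : s ≠ 0 := by rintro rfl; simp at h0
  have a1 : s ≠ 1 := by rintro rfl; simp at h1
  have aG := Complex.Gammaℝ_ne_zero_of_re_pos h0
  -- `ζ = ξ · (1 / (s (1 - s) Gammaℝ))` near the zero
  have he : riemannZeta =ᶠ[𝓝 s] fun z => riemannXi z * ((z * (1 - z))⁻¹ * z.Gammaℝ⁻¹) := by
    filter_upwards [Complex.continuous_re.continuousAt.eventually (lt_mem_nhds h0),
      Complex.continuous_re.continuousAt.eventually (gt_mem_nhds h1)] with z z0 z1
    have b0 : z ≠ 0 := by rintro rfl; simp at z0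
    have b1 : z ≠ 1 := by rintro rfl; simp at z1
    have b2 : 1 - z ≠ 0 := sub_ne_zero.mpr b1.symm
    have bG := Complex.Gammaℝ_ne_zero_of_re_pos z0
    rw [riemannXi_eq b0 b1 bG]; field_simp
  intro hx
  apply hd
  have hxz : riemannXi s = 0 := by rw [riemannXi_eq a0 a1 aG, hz, mul_zero]
  have hdg : DifferentiableAt ℂ (fun z : ℂ => (z * (1 - z))⁻¹ * z.Gammaℝ⁻¹) s := by
    refine DifferentiableAt.mul (DifferentiableAt.inv (by fun_prop) ?_)
      Complex.differentiable_Gammaℝ_inv.differentiableAt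
    exact mul_ne_zero a0 (sub_ne_zero.mpr a1.symm)
  have hd2 := (differentiable_riemannXi s).hasDerivAt.mul hdg.hasDerivAt
  rw [he.deriv_eq]
  have := hd2.deriv
  rw [hx, hxz, zero_mul, zero_mul, add_zero] at this
  exact this

lemma Gammaℝ_conj (s : ℂ) :
    Complex.Gammaℝ (starRingEnd ℂ s) = starRingEnd ℂ (Complex.Gammaℝ s) := by
  rw [Complex.Gammaℝ_def, Complex.Gammaℝ_def, map_mul, ← Complex.Gamma_conj]
  congr 1
  · have := Complex.cpow_conj (Real.pi : ℂ) (-s / 2) (by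
      rw [Complex.arg_ofReal_of_nonneg Real.pi_pos.le]; exact Real.pi_pos.ne)
    rw [Complex.conj_ofReal] at this
    rw [← this]; simp [Complex.conj_ofNat]
  · simp [Complex.conj_ofNat]

/-- `|ξ|` is invariant under reflection in the critical line. -/
lemma norm_riemannXi_one_sub_conj {s : ℂ} (hs : s.im ≠ 0) :
    ‖riemannXi (1 - starRingEnd ℂ s)‖ = ‖riemannXi s‖ := by
  rw [riemannXi_one_sub, riemannXi_eq_of_im_ne_zero hs,
    riemannXi_eq_of_im_ne_zero (by simpa using hs), Gammaℝ_conj, riemannZeta_conj]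
  simp only [norm_mul, Complex.norm_conj]
  congr 3
  rw [← Complex.norm_conj (1 - s)]; simp

lemma norm_riemannZeta_bounds {σ : ℝ} (hσ : 1 < σ) : ∃ K : ℝ, 0 < K ∧ ∀ s : ℂ, σ ≤ s.re →
    ‖riemannZeta s‖ ≤ K ∧ ‖(riemannZeta s)⁻¹‖ ≤ K := by
  have key : ∀ f : ℕ → ℂ, LSeriesSummable f σ → ∀ s : ℂ, σ ≤ s.re →
      ‖LSeries f s‖ ≤ ∑' n, ‖LSeries.term f σ n‖ := by
    intro f hf s hs
    have hle : ∀ n, ‖LSeries.term f s n‖ ≤ ‖LSeries.term f σ n‖ := fun n =>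
      LSeries.norm_term_le_of_re_le_re f (by simpa using hs) n
    exact tsum_of_norm_bounded hf.norm.hasSum hle
  refine ⟨max (∑' n, ‖LSeries.term 1 σ n‖) (∑' n, ‖LSeries.term
    (fun n => ((ArithmeticFunction.moebius n : ℤ) : ℂ)) σ n‖) + 1, ?_, fun s hs => ⟨?_, ?_⟩⟩
  · have : 0 ≤ ∑' n, ‖LSeries.term (1 : ℕ → ℂ) σ n‖ := tsum_nonneg fun _ => norm_nonneg _
    have := le_max_left (∑' n, ‖LSeries.term (1 : ℕ → ℂ) σ n‖) (∑' n, ‖LSeries.term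
      (fun n => ((ArithmeticFunction.moebius n : ℤ) : ℂ)) σ n‖)
    linarith
  · rw [← LSeries_one_eq_riemannZeta (by linarith)]
    have := (key 1 (LSeriesSummable_one_iff.mpr (by simpa using hσ)) s hs).trans
      (le_max_left _ (∑' n, ‖LSeries.term
        (fun n => ((ArithmeticFunction.moebius n : ℤ) : ℂ)) σ n‖))
    linarith
  · rw [← LSeries_moebius_eq_inv (by linarith)]
    have := (key _ (ArithmeticFunction.LSeriesSummable_moebius_iff.mpr (by simpa using hσ)) s
      hs).trans (le_max_right (∑' n, ‖LSeries.term (1 : ℕ → ℂ) σ n‖) _)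
    linarith

open HurwitzZeta in
/-- The entire completed zeta function has order one: a factorial bound for its growth. -/
lemma exists_norm_completedRiemannZeta₀_le : ∃ A : ℝ, 1 ≤ A ∧ ∀ n : ℕ, 1 ≤ n → ∀ s : ℂ,
    |s.re| ≤ n → ‖completedRiemannZeta₀ s‖ ≤ A ^ n * n.factorial := by
  set k : ℝ → ℂ := (hurwitzEvenFEPair 0).f_modif with hk
  have hΛ : ∀ s, completedRiemannZeta₀ s = mellin k (s / 2) / 2 := fun s => rfl
  have hconv : ∀ s : ℂ, MellinConvergent k s := fun s =>
    ((hurwitzEvenFEPair 0).isStrongFEPair_toStrongFEPair.hasMellin s).1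
  have hint : ∀ a : ℝ, IntegrableOn (fun x : ℝ => x ^ (a - 1) * ‖k x‖) (Set.Ioi 0) := by
    intro a
    have h := (hconv a).norm
    refine IntegrableOn.congr_fun h (fun x hx => ?_) measurableSet_Ioi
    simp only [norm_smul]
    rw [Complex.norm_cpow_eq_rpow_re_of_pos hx]
    simp
  -- exponential decay of the kernel
  obtain ⟨p, hp, C, hC0, X, hX, hdec⟩ : ∃ p : ℝ, 0 < p ∧ ∃ C : ℝ, 0 < C ∧ ∃ X : ℝ, 1 ≤ X ∧
      ∀ x, X ≤ x → ‖k x‖ ≤ C * Real.exp (-p * x) := by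
    obtain ⟨p, hp, hO⟩ := isBigO_atTop_evenKernel_sub 0
    obtain ⟨C, hC, hb⟩ := hO.exists_pos
    obtain ⟨X, hX⟩ := eventually_atTop.mp hb.bound
    refine ⟨p, hp, C, hC, max X 2, by simp, fun x hx => ?_⟩
    have h1 : X ≤ x := (le_max_left _ _).trans hx
    have h2 : 1 < x := by linarith [le_max_right X 2]
    have := hX x h1
    rw [if_pos rfl, Real.norm_of_nonneg (Real.exp_pos _).le] at this
    have e : k x = ((evenKernel 0 x - 1 : ℝ) : ℂ) := by
      simp [hk, WeakFEPair.f_modif, hurwitzEvenFEPair, h2, not_lt.mpr h2.le]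
    rw [e, Complex.norm_real]
    exact this
  set K := ∫ x in Set.Ioi (0:ℝ), x ^ ((0:ℝ) - 1) * ‖k x‖ with hKdef
  have hK0 : 0 ≤ K := setIntegral_nonneg measurableSet_Ioi fun x hx => by
    have : (0:ℝ) < x := hx
    positivity
  have main : ∀ n : ℕ, 1 ≤ n → ∀ s : ℂ, 0 ≤ s.re → s.re ≤ n → ‖completedRiemannZeta₀ s‖ ≤
      K + (X ^ n * K + C * ((1 / p) ^ n * n.factorial)) := by
    intro n hn s hs0 hsn
    have hn1 : (1 : ℝ) ≤ n := by exact_mod_cast hn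
    have hG : IntegrableOn (fun x : ℝ => x ^ ((n : ℝ) - 1) * Real.exp (-(p * x))) (Set.Ioi 0) := by
      have := Real.integral_rpow_mul_exp_neg_mul_Ioi (a := n) (by linarith) hp
      by_contra hcon
      rw [integral_undef hcon] at this
      have h2 : 0 < (1 / p) ^ (n : ℝ) * Real.Gamma n :=
        mul_pos (by positivity) (Real.Gamma_pos_of_pos (by linarith))
      linarith
    have hGv : ∫ x in Set.Ioi (0:ℝ), x ^ ((n : ℝ) - 1) * Real.exp (-(p * x)) ≤
        (1 / p) ^ n * n.factorial := by
      rw [Real.integral_rpow_mul_exp_neg_mul_Ioi (a := n) (by linarith) hp, Real.rpow_natCast]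
      gcongr
      obtain ⟨m, rfl⟩ : ∃ m, n = m + 1 := ⟨n - 1, by omega⟩
      push_cast
      rw [Real.Gamma_nat_eq_factorial]
      exact_mod_cast Nat.factorial_le (Nat.le_succ m)
    have hb : ∀ x ∈ Set.Ioi (0:ℝ), ‖(x : ℂ) ^ (s / 2 - 1) • k x‖ ≤
        x ^ ((0:ℝ) - 1) * ‖k x‖ + (X ^ n * (x ^ ((0:ℝ) - 1) * ‖k x‖) +
          C * (x ^ ((n:ℝ) - 1) * Real.exp (-(p * x)))) := by
      intro x hx
      have hx0 : (0:ℝ) < x := hx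
      rw [norm_smul, Complex.norm_cpow_eq_rpow_re_of_pos hx0]
      have e : (s / 2 - 1).re = s.re / 2 - 1 := by simp
      rw [e]
      have t2 : 0 ≤ X ^ n * (x ^ ((0:ℝ) - 1) * ‖k x‖) := by positivity
      have t3 : 0 ≤ C * (x ^ ((n:ℝ) - 1) * Real.exp (-(p * x))) := by positivity
      have t1 : 0 ≤ x ^ ((0:ℝ) - 1) * ‖k x‖ := by positivity
      rcases le_total x 1 with h | h
      · have : x ^ (s.re / 2 - 1) ≤ x ^ ((0:ℝ) - 1) :=
          Real.rpow_le_rpow_of_exponent_ge hx0 h (by linarith)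
        exact (mul_le_mul_of_nonneg_right this (norm_nonneg (k x))).trans
          (le_add_of_nonneg_right (add_nonneg t2 t3))
      · have hle : x ^ (s.re / 2 - 1) ≤ x ^ ((n:ℝ) - 1) :=
          Real.rpow_le_rpow_of_exponent_le h (by linarith)
        have hle2 := mul_le_mul_of_nonneg_right hle (norm_nonneg (k x))
        rcases le_total X x with h' | h'
        · have h4 := mul_le_mul_of_nonneg_left (hdec x h')
            (Real.rpow_nonneg hx0.le ((n:ℝ) - 1))
          have h5 : x ^ ((n:ℝ) - 1) * (C * Real.exp (-p * x)) =
            C * (x ^ ((n:ℝ) - 1) * Real.exp (-(p * x))) := by rw [neg_mul]; ring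
          exact hle2.trans ((h4.trans_eq h5).trans ((le_add_of_nonneg_left t2).trans
            (le_add_of_nonneg_left t1)))
        · have h6 : x ^ ((n:ℝ) - 1) ≤ X ^ n * x ^ ((0:ℝ) - 1) := by
            rw [show (n:ℝ) - 1 = n + (0 - 1) by ring, Real.rpow_add hx0, Real.rpow_natCast]
            gcongr
          exact hle2.trans ((mul_le_mul_of_nonneg_right h6 (norm_nonneg (k x))).trans
            ((mul_assoc _ _ _).le.trans ((le_add_of_nonneg_right t3).trans
            (le_add_of_nonneg_left t1))))
    have hi0 := hint 0
    have hsum := (hi0.add ((hi0.const_mul (X ^ n)).add (hG.const_mul C)))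
    rw [hΛ, norm_div]
    have h1 : ‖mellin k (s / 2)‖ ≤ K + (X ^ n * K + C * ((1 / p) ^ n * n.factorial)) := by
      calc ‖mellin k (s / 2)‖ ≤ ∫ x in Set.Ioi (0:ℝ), ‖(x : ℂ) ^ (s / 2 - 1) • k x‖ :=
            norm_integral_le_integral_norm _
        _ ≤ ∫ x in Set.Ioi (0:ℝ), (x ^ ((0:ℝ) - 1) * ‖k x‖ + (X ^ n * (x ^ ((0:ℝ) - 1) * ‖k x‖) +
          C * (x ^ ((n:ℝ) - 1) * Real.exp (-(p * x))))) :=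
            setIntegral_mono_on (hconv (s / 2)).norm hsum measurableSet_Ioi hb
        _ = K + (X ^ n * K + C * ∫ x in Set.Ioi (0:ℝ), x ^ ((n:ℝ) - 1) * Real.exp (-(p * x))) := by
            have e := integral_add hi0 ((hi0.const_mul (X ^ n)).add (hG.const_mul C))
            simp only [Pi.add_apply] at e
            rw [e, integral_add (hi0.const_mul (X ^ n)) (hG.const_mul C), integral_const_mul,
              integral_const_mul]
        _ ≤ _ := by gcongr
    have h2 : (‖(2:ℂ)‖ : ℝ) = 2 := by simp
    rw [h2]
    have := norm_nonneg (mellin k (s / 2))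
    linarith
  set D := max X (1 / p) with hD
  have hD1 : 1 ≤ D := hX.trans (le_max_left _ _)
  have main2 : ∀ n : ℕ, 1 ≤ n → ∀ s : ℂ, 0 ≤ s.re → s.re ≤ n → ‖completedRiemannZeta₀ s‖ ≤
      (2 * K + C + 1) * D ^ n * n.factorial := by
    intro n hn s hs0 hsn
    refine (main n hn s hs0 hsn).trans ?_
    have f1 : (1:ℝ) ≤ n.factorial := by exact_mod_cast Nat.one_le_iff_ne_zero.mpr n.factorial_ne_zero
    have d1 : 1 ≤ D ^ n := one_le_pow₀ hD1
    have d2 : X ^ n ≤ D ^ n := by gcongr; exact le_max_left _ _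
    have d3 : (1 / p) ^ n ≤ D ^ n := by gcongr; exact le_max_right _ _
    have d4 : 1 ≤ D ^ n * n.factorial := one_le_mul_of_one_le_of_one_le d1 f1
    have d5 : X ^ n ≤ D ^ n * n.factorial :=
      d2.trans (le_mul_of_one_le_right (by positivity) f1)
    have d6 : (1 / p) ^ n * n.factorial ≤ D ^ n * n.factorial := by gcongr
    have := mul_le_mul_of_nonneg_left d4 hK0
    have := mul_le_mul_of_nonneg_left d5 hK0
    have := mul_le_mul_of_nonneg_left d6 hC0.le
    nlinarith
  set B := 2 * K + C + 1 with hB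
  have hB1 : 1 ≤ B := by linarith
  refine ⟨B * (D * (2 * D)), ?_, fun n hn s hs => ?_⟩
  · exact one_le_mul_of_one_le_of_one_le hB1
      (one_le_mul_of_one_le_of_one_le hD1 (by linarith))
  have hs' := abs_le.mp hs
  -- reflect to the right half plane
  obtain ⟨z, hz0, hz1, hz⟩ : ∃ z : ℂ, 0 ≤ z.re ∧ z.re ≤ ((n + 1 : ℕ) : ℝ) ∧
      completedRiemannZeta₀ s = completedRiemannZeta₀ z := by
    rcases le_total 0 s.re with h | h
    · exact ⟨s, h, by push_cast; linarith, rfl⟩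
    · exact ⟨1 - s, by simp; linarith, by push_cast; simp; linarith,
        (completedRiemannZeta₀_one_sub s).symm⟩
  rw [hz]
  refine (main2 (n + 1) (by omega) z hz0 hz1).trans ?_
  have f1 : ((n + 1 : ℕ).factorial : ℝ) ≤ 2 ^ n * n.factorial := by
    rw [Nat.factorial_succ]
    push_cast
    gcongr
    exact_mod_cast Nat.lt_two_pow_self
  calc B * D ^ (n + 1) * (n + 1 : ℕ).factorial
      ≤ B * D ^ (n + 1) * (2 ^ n * n.factorial) := by gcongr
    _ = (B * D) ^ 1 * (2 * D) ^ n * n.factorial := by rw [mul_pow]; ring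
    _ ≤ (B * D) ^ n * (2 * D) ^ n * n.factorial := by
        gcongr
        exact one_le_mul_of_one_le_of_one_le hB1 hD1
    _ = (B * (D * (2 * D))) ^ n * n.factorial := by rw [← mul_pow]; ring

/-- `|ξ(s)| ≤ exp (O(T log T))` for `|s| ≤ 10 T`. -/
lemma exists_norm_riemannXi_le : ∃ C : ℝ, 0 < C ∧ ∀ T : ℝ, 2 ≤ T → ∀ s : ℂ, ‖s‖ ≤ 10 * T →
    ‖riemannXi s‖ ≤ Real.exp (C * (T * Real.log T)) := by
  obtain ⟨A, hA, hb⟩ := exists_norm_completedRiemannZeta₀_le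
  have hl2 : 0 < Real.log 2 := Real.log_pos one_lt_two
  have hA0 : 0 ≤ Real.log (A * 11) := Real.log_nonneg (by linarith)
  refine ⟨11 * (Real.log (A * 11) / Real.log 2 + 1) + 300 / Real.log 2, by positivity,
    fun T hT s hs => ?_⟩
  set n := ⌈10 * T⌉₊ with hn
  have hn1 : 10 * T ≤ n := Nat.le_ceil _
  have hn2 : (n : ℝ) ≤ 11 * T := by
    have := Nat.ceil_lt_add_one (show 0 ≤ 10 * T by linarith)
    linarith
  have hn3 : 1 ≤ n := by
    have : (1:ℝ) ≤ n := by linarith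
    exact_mod_cast this
  have hL : Real.log 2 ≤ Real.log T := Real.log_le_log two_pos hT
  have h1 : ‖completedRiemannZeta₀ s‖ ≤ (A * (11 * T)) ^ n := by
    refine (hb n hn3 s (((Complex.abs_re_le_norm s).trans hs).trans hn1)).trans ?_
    rw [mul_pow]
    gcongr
    have : (n.factorial : ℝ) ≤ (n : ℝ) ^ n := by exact_mod_cast Nat.factorial_le_pow n
    exact this.trans (by gcongr)
  have hAT : 1 ≤ A * (11 * T) := one_le_mul_of_one_le_of_one_le hA (by linarith)
  have h2 : (A * (11 * T)) ^ n ≤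
      Real.exp (11 * (Real.log (A * 11) / Real.log 2 + 1) * (T * Real.log T)) := by
    rw [← Real.rpow_natCast, Real.rpow_def_of_pos (by linarith)]
    apply Real.exp_le_exp.mpr
    have e1 : Real.log (A * (11 * T)) ≤ (Real.log (A * 11) / Real.log 2 + 1) * Real.log T := by
      rw [← mul_assoc, Real.log_mul (by linarith) (by linarith), add_mul, one_mul]
      have : Real.log (A * 11) ≤ Real.log (A * 11) / Real.log 2 * Real.log T := by
        rw [div_mul_eq_mul_div, le_div_iff₀ hl2]
        gcongr
      linarith
    calc Real.log (A * (11 * T)) * n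
        ≤ ((Real.log (A * 11) / Real.log 2 + 1) * Real.log T) * (11 * T) := by
          gcongr
          exact mul_nonneg (by positivity) (by linarith)
      _ = _ := by ring
  -- the polynomial factor is absorbed
  have h3 : ‖riemannXi s‖ ≤ 300 * T ^ 2 * (A * (11 * T)) ^ n := by
    have h4 : ‖1 - s‖ ≤ 11 * T := by
      refine (norm_sub_le _ _).trans ?_
      rw [norm_one]; linarith
    have h5 : 1 ≤ (A * (11 * T)) ^ n := one_le_pow₀ hAT
    calc ‖riemannXi s‖ ≤ ‖s‖ * ‖1 - s‖ * ‖completedRiemannZeta₀ s‖ + 1 := by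
          rw [riemannXi]
          refine (norm_sub_le _ _).trans ?_
          rw [norm_mul, norm_mul, norm_one]
      _ ≤ (10 * T) * (11 * T) * (A * (11 * T)) ^ n + T ^ 2 * (A * (11 * T)) ^ n := by
          gcongr
          exact one_le_mul_of_one_le_of_one_le (one_le_pow₀ (by linarith)) h5
      _ ≤ _ := by nlinarith [mul_nonneg (sq_nonneg T) (zero_le_one.trans h5)]
  have h6 : 300 * T ^ 2 ≤ Real.exp (300 / Real.log 2 * (T * Real.log T)) := by
    have e1 : 150 * T ≤ Real.exp (150 * T) := by linarith [Real.add_one_le_exp (150 * T)]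
    have e2 : 300 * T ^ 2 ≤ (150 * T) * (150 * T) := by nlinarith
    calc 300 * T ^ 2 ≤ Real.exp (150 * T) * Real.exp (150 * T) := by
          refine e2.trans (mul_le_mul e1 e1 (by linarith) (Real.exp_pos _).le)
      _ = Real.exp (300 * T) := by rw [← Real.exp_add]; ring_nf
      _ ≤ _ := by
          apply Real.exp_le_exp.mpr
          rw [div_mul_eq_mul_div, le_div_iff₀ hl2]
          have := mul_le_mul_of_nonneg_left hL (show 0 ≤ 300 * T by linarith)
          linarith
  calc ‖riemannXi s‖ ≤ 300 * T ^ 2 * (A * (11 * T)) ^ n := h3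
    _ ≤ Real.exp (300 / Real.log 2 * (T * Real.log T)) *
        Real.exp (11 * (Real.log (A * 11) / Real.log 2 + 1) * (T * Real.log T)) := by gcongr
    _ = _ := by rw [← Real.exp_add]; ring_nf

lemma exp_neg_le_norm_Gamma {y : ℝ} (hy : 1 ≤ y) :
    Real.exp (-(Real.pi * y)) ≤ ‖Complex.Gamma (1 + y * Complex.I)‖ := by
  have hyI : (y : ℂ) * Complex.I ≠ 0 := by simp; linarith
  -- `|Γ(1 + iy)|² = π y / sinh(π y)`
  have h1 : Complex.Gamma (1 + y * Complex.I) * Complex.Gamma (1 - y * Complex.I) =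
      y * Complex.I * (Real.pi / Complex.sin (Real.pi * (y * Complex.I))) := by
    rw [add_comm, Complex.Gamma_add_one _ hyI, mul_assoc, Complex.Gamma_mul_Gamma_one_sub]
  have h2 : Complex.Gamma (1 - y * Complex.I) =
      starRingEnd ℂ (Complex.Gamma (1 + y * Complex.I)) := by
    rw [← Complex.Gamma_conj]; simp [sub_eq_add_neg]
  have h3 : ‖Complex.Gamma (1 + y * Complex.I)‖ ^ 2 =
      y * Real.pi / ‖Complex.sin (Real.pi * (y * Complex.I))‖ := by
    have := congrArg norm h1
    rw [h2, norm_mul, Complex.norm_conj] at this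
    rw [sq, this]
    simp [abs_of_pos Real.pi_pos, abs_of_pos (by linarith : 0 < y)]
    ring
  have h4 : ‖Complex.sin (Real.pi * (y * Complex.I))‖ ≤ Real.exp (Real.pi * y) := by
    rw [Complex.sin, norm_div, norm_mul, Complex.norm_I, mul_one]
    have e1 : ‖Complex.exp (-(Real.pi * (y * Complex.I)) * Complex.I)‖ = Real.exp (Real.pi * y) := by
      rw [Complex.norm_exp]; congr 1; simp
    have e2 : ‖Complex.exp ((Real.pi * (y * Complex.I)) * Complex.I)‖ ≤ Real.exp (Real.pi * y) := by
      rw [Complex.norm_exp]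
      apply Real.exp_le_exp.mpr
      have : 0 ≤ Real.pi * y := by have := Real.pi_pos; positivity
      simp; linarith
    rw [Complex.norm_ofNat, div_le_iff₀ two_pos]
    refine (norm_sub_le _ _).trans ?_
    rw [e1]; linarith
  have h5 : 0 < ‖Complex.sin (Real.pi * (y * Complex.I))‖ := by
    rw [norm_pos_iff]
    intro h0
    rw [h0, norm_zero, div_zero, sq_eq_zero_iff, norm_eq_zero] at h3
    exact Complex.Gamma_ne_zero_of_re_pos (by simp) h3
  have hpi : 3 < Real.pi := Real.pi_gt_three
  have h6 : Real.exp (-(Real.pi * y)) ≤ ‖Complex.Gamma (1 + y * Complex.I)‖ ^ 2 := by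
    rw [h3, le_div_iff₀ h5]
    have := mul_le_mul_of_nonneg_left h4 (Real.exp_pos (-(Real.pi * y))).le
    rw [← Real.exp_add, neg_add_cancel, Real.exp_zero] at this
    nlinarith
  have h7 : Real.exp (-(Real.pi * y)) ^ 2 ≤ ‖Complex.Gamma (1 + y * Complex.I)‖ ^ 2 := by
    refine le_trans ?_ h6
    rw [sq]
    exact mul_le_of_le_one_left (Real.exp_pos _).le
      (Real.exp_le_one_iff.mpr (by have := Real.pi_pos; nlinarith))
  exact le_of_sq_le_sq h7 (norm_nonneg _)

/-- A lower bound for `|ξ|` on the line `Re s = 2`. -/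
lemma exists_exp_neg_le_norm_riemannXi : ∃ C : ℝ, 0 < C ∧ ∀ T : ℝ, 2 ≤ T →
    Real.exp (-(C * T)) ≤ ‖riemannXi (2 + T * Complex.I)‖ := by
  obtain ⟨K, hK, hz⟩ := norm_riemannZeta_bounds (σ := 3 / 2) (by norm_num)
  refine ⟨Real.pi + 2 + K, by have := Real.pi_pos; positivity, fun T hT => ?_⟩
  have him : (2 + T * Complex.I : ℂ).im ≠ 0 := by simp; linarith
  rw [riemannXi_eq_of_im_ne_zero him, norm_mul, norm_mul, norm_mul]
  have a1 : 1 ≤ ‖(2 + T * Complex.I : ℂ)‖ := by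
    have := Complex.abs_re_le_norm (2 + T * Complex.I : ℂ)
    simp at this; linarith
  have a2 : 1 ≤ ‖1 - (2 + T * Complex.I : ℂ)‖ := by
    have := Complex.abs_re_le_norm (1 - (2 + T * Complex.I : ℂ))
    norm_num at this; linarith
  have a3 : Real.exp (-K) ≤ ‖riemannZeta (2 + T * Complex.I)‖ := by
    have h := (hz (2 + T * Complex.I) (by norm_num)).2
    rw [norm_inv] at h
    have hpos : 0 < ‖riemannZeta (2 + T * Complex.I)‖ :=
      norm_pos_iff.mpr (riemannZeta_ne_zero_of_one_le_re (by norm_num))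
    rw [Real.exp_neg]
    have h2 := inv_anti₀ (inv_pos.mpr hpos) h
    rw [inv_inv] at h2
    exact (inv_anti₀ hK (by linarith [Real.add_one_le_exp K])).trans h2
  have a4 : Real.exp (-(Real.pi * T + 2)) ≤ ‖(2 + T * Complex.I : ℂ).Gammaℝ‖ := by
    rw [Complex.Gammaℝ_def, norm_mul, Complex.norm_cpow_eq_rpow_re_of_pos Real.pi_pos]
    have e1 : (-(2 + T * Complex.I : ℂ) / 2).re = -1 := by norm_num
    have e2 : (2 + T * Complex.I : ℂ) / 2 = 1 + ((T / 2 : ℝ) : ℂ) * Complex.I := by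
      push_cast; ring
    rw [e1, e2, Real.rpow_neg_one, neg_add_rev, Real.exp_add]
    refine mul_le_mul ?_ ?_ (Real.exp_pos _).le (by have := Real.pi_pos; positivity)
    · rw [Real.exp_neg]
      refine inv_anti₀ Real.pi_pos ?_
      have : Real.pi < 3.15 := Real.pi_lt_d2
      have := Real.quadratic_le_exp_of_nonneg (x := 2) (by norm_num)
      linarith
    · refine le_trans ?_ (exp_neg_le_norm_Gamma (by linarith))
      apply Real.exp_le_exp.mpr
      have := Real.pi_pos
      nlinarith
  have hprod : Real.exp (-(Real.pi * T + 2)) * Real.exp (-K) ≤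
      ‖(2 + T * Complex.I : ℂ)‖ * ‖1 - (2 + T * Complex.I : ℂ)‖ *
      ‖(2 + T * Complex.I : ℂ).Gammaℝ‖ * ‖riemannZeta (2 + T * Complex.I)‖ := by
    refine mul_le_mul ?_ a3 (Real.exp_pos _).le (by positivity)
    refine a4.trans (le_mul_of_one_le_left (norm_nonneg _)
      (one_le_mul_of_one_le_of_one_le a1 a2))
  refine le_trans ?_ hprod
  rw [← Real.exp_add]
  apply Real.exp_le_exp.mpr
  nlinarith

/-! ### Zeros and growth of `ξ` -/

/-- Simple zeros of an entire function can be divided out. -/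
lemma exists_eq_mul_prod_sub {X : ℂ → ℂ} (hX : Differentiable ℂ X) (Z : Finset ℂ)
    (h0 : ∀ p ∈ Z, X p = 0) (h1 : ∀ p ∈ Z, deriv X p ≠ 0) :
    ∃ f : ℂ → ℂ, Differentiable ℂ f ∧ (∀ s, X s = f s * ∏ p ∈ Z, (s - p)) ∧ ∀ p ∈ Z, f p ≠ 0 := by
  classical
  induction Z using Finset.induction_on with
  | empty => exact ⟨X, hX, by simp, by simp⟩
  | insert q Z hq ih =>
    obtain ⟨f, hf, hfX, hf0⟩ := ih (fun p hp => h0 p (Finset.mem_insert_of_mem hp))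
      (fun p hp => h1 p (Finset.mem_insert_of_mem hp))
    have hprod : ∏ p ∈ Z, (q - p) ≠ 0 :=
      Finset.prod_ne_zero_iff.mpr fun p hp => sub_ne_zero.mpr (by rintro rfl; exact hq hp)
    have hfq : f q = 0 := by
      have := h0 q (Finset.mem_insert_self _ _)
      rw [hfX] at this
      exact (mul_eq_zero.mp this).resolve_right hprod
    have hdf : deriv f q ≠ 0 := by
      intro hd
      apply h1 q (Finset.mem_insert_self _ _)
      have hP : DifferentiableAt ℂ (fun s => ∏ p ∈ Z, (s - p)) q := by fun_prop
      have := (hf q).hasDerivAt.mul hP.hasDerivAt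
      rw [hd, hfq, zero_mul, zero_mul, add_zero] at this
      rw [funext hfX]
      exact this.deriv
    have hdecomp : ∀ s, f s = (s - q) * dslope f q s := fun s => by
      have := sub_smul_dslope f q s
      rw [hfq, sub_zero, smul_eq_mul] at this
      exact this.symm
    refine ⟨dslope f q, ?_, fun s => ?_, fun p hp => ?_⟩
    · rw [← differentiableOn_univ]
      exact (Complex.differentiableOn_dslope univ_mem).mpr hf.differentiableOn
    · rw [Finset.prod_insert hq, hfX, hdecomp]; ring
    · rcases Finset.mem_insert.mp hp with rfl | hp
      · rwa [dslope_same]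
      · intro h
        apply hf0 p hp
        rw [hdecomp, h, mul_zero]

/-- A zero-free holomorphic function on a disc has a holomorphic logarithm. -/
lemma exists_exp_eq_on_ball {f : ℂ → ℂ} {c : ℂ} {R : ℝ} (hf : Differentiable ℂ f)
    (h0 : ∀ z ∈ ball c R, f z ≠ 0) :
    ∃ g : ℂ → ℂ, DifferentiableOn ℂ g (ball c R) ∧ ∀ z ∈ ball c R, Complex.exp (g z) = f z := by
  rcases (ball c R).eq_empty_or_nonempty with he | ⟨z₀, hz₀⟩
  · exact ⟨0, by simp [he], by simp [he]⟩
  have hdf : Differentiable ℂ (deriv f) := by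
    have := (hf.contDiff (n := 2)).differentiable_deriv_two
    exact this
  obtain ⟨G, hG⟩ := DifferentiableOn.isExactOn_ball (f := fun z => deriv f z / f z) (c := c) (r := R)
    (hdf.differentiableOn.div hf.differentiableOn h0)
  have hGd : DifferentiableOn ℂ G (ball c R) := fun z hz =>
    (hG z hz).differentiableAt.differentiableWithinAt
  -- `f e^{-G}` is constant
  have hconst : ∀ z ∈ ball c R, f z * Complex.exp (-G z) = f z₀ * Complex.exp (-G z₀) := by
    intro z hz
    refine isOpen_ball.is_const_of_deriv_eq_zero (f := fun z => f z * Complex.exp (-G z))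
      (convex_ball c R).isPreconnected (fun w hw => ?_) (fun w hw => ?_) hz hz₀
    · exact ((hf w).mul (((hG w hw).differentiableAt).neg.cexp)).differentiableWithinAt
    · have := (hf w).hasDerivAt.mul (hG w hw).neg.cexp
      simp only [Pi.zero_apply]
      refine Eq.trans this.deriv ?_
      have := h0 w hw
      field_simp; ring
  refine ⟨fun z => G z + (Complex.log (f z₀) - G z₀), hGd.add_const _, fun z hz => ?_⟩
  have h := hconst z hz
  rw [Complex.exp_add, Complex.exp_sub, Complex.exp_log (h0 z₀ hz₀)]
  rw [Complex.exp_neg, Complex.exp_neg] at h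
  have e1 := Complex.exp_ne_zero (G z)
  have e2 := Complex.exp_ne_zero (G z₀)
  field_simp at h ⊢
  linear_combination -h

/-- If `Re g` is bounded above by `M` relative to the centre of a disc of radius `R`, then `g''` is
`O(M / R²)` in a smaller concentric disc. -/
lemma norm_deriv_deriv_le_of_re_le {g : ℂ → ℂ} {z₀ : ℂ} {R M : ℝ} (hR : 0 < R) (hM : 0 < M)
    (hg : DifferentiableOn ℂ g (ball z₀ R)) (hre : ∀ z ∈ ball z₀ R, (g z).re ≤ (g z₀).re + M)
    {z : ℂ} (hz : dist z z₀ ≤ R / 4) : ‖deriv (deriv g) z‖ ≤ 128 * M / R ^ 2 := by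
  have hmaps : ∀ w ∈ ball (0 : ℂ) R, z₀ + w ∈ ball z₀ R := fun w hw => by
    rw [mem_ball, dist_eq_norm] at *; simpa using hw
  have hbound : ∀ w ∈ ball z₀ (R / 2 + R / 100), ‖g w - g z₀‖ ≤ 4 * M * (51 / 49) / 2 := by
    intro w hw
    have h := Complex.borelCaratheodory_zero (f := fun w => g (z₀ + w) - g z₀) (M := M) (R := R)
      (z := w - z₀) hM ?_ ?_ hR ?_ (by simp)
    · simp only [add_sub_cancel] at h
      refine h.trans ?_
      rw [mem_ball, dist_eq_norm] at hw
      rw [div_le_iff₀ (by linarith)]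
      nlinarith [norm_nonneg (w - z₀)]
    · refine (DifferentiableOn.comp (t := ball z₀ R) hg (by fun_prop) hmaps).sub_const _
    · intro w hw
      have := hre _ (hmaps w hw)
      simp only [Set.mem_ofPred_eq, Complex.sub_re]
      linarith
    · rw [mem_ball, dist_eq_norm] at hw
      rw [mem_ball, dist_zero_right]; linarith
  have hsub : closedBall z (R / 4) ⊆ ball z₀ (R / 2 + R / 100) := fun w hw => by
    rw [mem_closedBall] at hw; rw [mem_ball]
    linarith [dist_triangle w z z₀]
  have hball : ball z₀ (R / 2 + R / 100) ⊆ ball z₀ R := ball_subset_ball (by linarith)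
  have hcl : closure (ball z (R / 4)) ⊆ ball z₀ R :=
    (closure_ball_subset_closedBall).trans (hsub.trans hball)
  have h := Complex.norm_iteratedDeriv_le_of_forall_mem_sphere_norm_le 2 (by linarith : 0 < R / 4)
    (f := fun w => g w - g z₀) (c := z) (C := 4 * M * (51 / 49) / 2)
    (((hg.mono hcl).sub_const _).diffContOnCl)
    (fun w hw => hbound w (hsub (sphere_subset_closedBall hw)))
  rw [iteratedDeriv_succ, iteratedDeriv_one] at h
  have he : deriv (fun w => g w - g z₀) = deriv g := by
    funext w; rw [deriv_sub_const]
  rw [he] at h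
  refine h.trans ?_
  have : (2 : ℕ).factorial = 2 := rfl
  rw [this, div_le_div_iff₀ (by positivity) (by positivity)]
  push_cast
  have := mul_pos hM (pow_pos hR 2)
  nlinarith

/-- The zeros of `ξ` in a disc, as a finite set. -/
lemma finite_riemannXi_zeros_closedBall (c : ℂ) (R : ℝ) :
    {p : ℂ | riemannXi p = 0 ∧ p ∈ closedBall c R}.Finite := by
  refine (finite_nontrivialZetaZeros (|c.im| + R + 1)).subset ?_
  rintro p ⟨hp, hpc⟩
  refine ⟨isNontrivialZetaZero_of_riemannXi_eq_zero hp, ?_⟩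
  rw [mem_closedBall, dist_eq_norm] at hpc
  have := (Complex.abs_im_le_norm (p - c)).trans hpc
  rw [Complex.sub_im] at this
  have h2 : |p.im| ≤ |c.im| + |p.im - c.im| := by
    have := abs_add_le c.im (p.im - c.im)
    simpa using this
  linarith

/-- Near height `T`, the ratio `ξ(s + 2) / ξ(s)` has, up to a factor `2`, the modulus that the
zeros at distance `O(T)` dictate. The zero-free part of `ξ` is `exp g` with
`g'' = O(log T / T)`, and `Re g` is symmetric about the critical line. -/
theorem norm_riemannXi_shift_two
    (simple_zeros : ∀ ρ : ℂ, IsNontrivialZetaZero ρ → deriv riemannZeta ρ ≠ 0) :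
    ∃ T₁ : ℝ, 100 ≤ T₁ ∧ ∀ T ≥ T₁, ∃ Z : Finset ℂ, (∀ p ∈ Z, riemannXi p = 0) ∧
      (∀ p, riemannXi p = 0 → |p.im - T| ≤ T / 4 → p ∈ Z) ∧
      ∀ s : ℂ, -1 / 2 ≤ s.re → s.re ≤ 10 → |s.im - T| ≤ T / 40 →
        ‖riemannXi (s + 2)‖ * ∏ p ∈ Z, ‖s - p‖ ≤ 2 * (‖riemannXi s‖ * ∏ p ∈ Z, ‖s + 2 - p‖) ∧
        ‖riemannXi s‖ * ∏ p ∈ Z, ‖s + 2 - p‖ ≤ 2 * (‖riemannXi (s + 2)‖ * ∏ p ∈ Z, ‖s - p‖) := by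
  classical
  obtain ⟨C₁, hC₁, hup⟩ := exists_norm_riemannXi_le
  obtain ⟨C₂, hC₂, hlow⟩ := exists_exp_neg_le_norm_riemannXi
  -- `M(T) / T² → 0`
  have hlim : Tendsto (fun T : ℝ => (C₁ * (T * Real.log T) + C₂ * T) * (1 / T ^ 2)) atTop (𝓝 0) := by
    have h1 : Tendsto (fun T : ℝ => Real.log T / T) atTop (𝓝 0) :=
      Real.isLittleO_log_id_atTop.tendsto_div_nhds_zero
    have h2 : Tendsto (fun T : ℝ => C₁ * (Real.log T / T) + C₂ * T⁻¹) atTop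
        (𝓝 (C₁ * 0 + C₂ * 0)) := (h1.const_mul _).add (tendsto_inv_atTop_zero.const_mul _)
    rw [mul_zero, mul_zero, add_zero] at h2
    refine h2.congr' ?_
    filter_upwards [eventually_gt_atTop 0] with T hT
    field_simp
  obtain ⟨T₀, hT₀⟩ := eventually_atTop.mp (hlim.eventually (gt_mem_nhds
    (show (0:ℝ) < 1 / 10000000 by norm_num)))
  refine ⟨max T₀ 1000, le_max_of_le_right (by norm_num), fun T hT => ?_⟩
  have hTT₀ : T₀ ≤ T := (le_max_left _ _).trans hT
  have hT1000 : 1000 ≤ T := (le_max_right _ _).trans hT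
  set c : ℂ := 1 / 2 + T * Complex.I with hc
  have cre : c.re = 1 / 2 := by simp [hc]
  have cim : c.im = T := by simp [hc]
  set R := T / 2 with hR
  set Z := (finite_riemannXi_zeros_closedBall c R).toFinset with hZ
  have hmem : ∀ p, p ∈ Z ↔ riemannXi p = 0 ∧ p ∈ closedBall c R := fun p => by simp [hZ]
  have hZ0 : ∀ p ∈ Z, riemannXi p = 0 := fun p hp => ((hmem p).mp hp).1
  have hZzero : ∀ p ∈ Z, IsNontrivialZetaZero p := fun p hp =>
    isNontrivialZetaZero_of_riemannXi_eq_zero (hZ0 p hp)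
  refine ⟨Z, hZ0, fun p hp hpT => ?_, ?_⟩
  · rw [hmem, mem_closedBall, dist_eq_norm]
    refine ⟨hp, (Complex.norm_le_abs_re_add_abs_im _).trans ?_⟩
    obtain ⟨-, h0, h1⟩ := isNontrivialZetaZero_of_riemannXi_eq_zero hp
    rw [Complex.sub_re, Complex.sub_im, cre, cim]
    have : |p.re - 1 / 2| ≤ 1 := abs_le.mpr ⟨by linarith, by linarith⟩
    linarith
  obtain ⟨f, hf, hfX, hf0⟩ := exists_eq_mul_prod_sub differentiable_riemannXi Z hZ0
    (fun p hp => deriv_riemannXi_ne_zero (hZzero p hp) (simple_zeros p (hZzero p hp)))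
  have hfne : ∀ z ∈ ball c R, f z ≠ 0 := by
    intro z hz hfz
    have hx : riemannXi z = 0 := by rw [hfX, hfz, zero_mul]
    exact hf0 z ((hmem z).mpr ⟨hx, ball_subset_closedBall hz⟩) hfz
  obtain ⟨g, hg, hgf⟩ := exists_exp_eq_on_ball hf hfne
  have hnorm : ∀ z ∈ ball c R, ‖f z‖ = Real.exp (g z).re := fun z hz => by
    rw [← hgf z hz, Complex.norm_exp]
  have hXn : ∀ s, ‖riemannXi s‖ = ‖f s‖ * ∏ p ∈ Z, ‖s - p‖ := fun s => by
    rw [hfX, norm_mul, norm_prod]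
  set z₀ : ℂ := 2 + T * Complex.I with hz₀
  have hdz₀ : dist z₀ c = 3 / 2 := by
    rw [dist_eq_norm, hz₀, hc, show (2 + T * Complex.I - (1 / 2 + T * Complex.I) : ℂ)
      = ((3 / 2 : ℝ) : ℂ) by push_cast; ring, Complex.norm_real]
    norm_num
  set M := C₁ * (T * Real.log T) + C₂ * T with hM
  have hlogT : 0 < Real.log T := Real.log_pos (by linarith)
  have hMpos : 0 < M := by positivity
  have hprodpos : ∀ z : ℂ, (∀ p ∈ Z, z ≠ p) → 0 < ∏ p ∈ Z, ‖z - p‖ := fun z hz =>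
    Finset.prod_pos fun p hp => norm_pos_iff.mpr (sub_ne_zero.mpr (hz p hp))
  -- the maximum principle on the disc of radius `3 R`
  have hmax : ∀ z ∈ closedBall c (3 * R), ‖f z‖ ≤ Real.exp M * ‖f z₀‖ := by
    intro z hz
    have hfr : ∀ w ∈ frontier (ball c (3 * R)), ‖f w‖ ≤ Real.exp M * ‖f z₀‖ := by
      intro w hw
      rw [frontier_ball c (by linarith : 3 * R ≠ 0), mem_sphere] at hw
      have hnw : ‖w‖ ≤ 10 * T := by
        have h1 : ‖w‖ ≤ ‖c‖ + dist w c := by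
          rw [dist_eq_norm]; have := norm_add_le c (w - c); simpa using this
        have h2 : ‖c‖ ≤ 1 / 2 + T := by
          refine (Complex.norm_le_abs_re_add_abs_im c).trans ?_
          rw [cre, cim, abs_of_pos (by linarith : (0:ℝ) < T)]; norm_num
        rw [hw] at h1; linarith
      have h1 := hup T (by linarith) w hnw
      have h2 := hlow T (by linarith)
      have hge : ∀ p ∈ Z, ‖z₀ - p‖ ≤ ‖w - p‖ := by
        intro p hp
        have hpc := ((hmem p).mp hp).2
        rw [mem_closedBall, dist_comm] at hpc
        have a1 := dist_triangle z₀ c p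
        have a2 := dist_triangle w p c
        rw [dist_comm p c] at a2
        rw [← dist_eq_norm, ← dist_eq_norm]
        linarith
      have hPle : ∏ p ∈ Z, ‖z₀ - p‖ ≤ ∏ p ∈ Z, ‖w - p‖ :=
        Finset.prod_le_prod (fun _ _ => norm_nonneg _) hge
      have hP0 : 0 < ∏ p ∈ Z, ‖z₀ - p‖ := hprodpos z₀ (by
        rintro p hp rfl
        have := (hZzero _ hp).2.2
        simp [hz₀] at this)
      have h3 : ‖riemannXi w‖ ≤ Real.exp M * ‖riemannXi z₀‖ := by
        calc ‖riemannXi w‖ ≤ Real.exp M * Real.exp (-(C₂ * T)) := by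
              rw [← Real.exp_add, hM]; convert h1 using 2; ring
          _ ≤ _ := by gcongr
      rw [hXn, hXn] at h3
      have h4 : ‖f w‖ * ∏ p ∈ Z, ‖z₀ - p‖ ≤ (Real.exp M * ‖f z₀‖) * ∏ p ∈ Z, ‖z₀ - p‖ := by
        refine (mul_le_mul_of_nonneg_left hPle (norm_nonneg _)).trans (h3.trans_eq ?_)
        ring
      exact le_of_mul_le_mul_right h4 hP0
    refine Complex.norm_le_of_forall_mem_frontier_norm_le isBounded_ball
      hf.diffContOnCl hfr ?_
    rwa [closure_ball c (by linarith : 3 * R ≠ 0)]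
  have hz₀b : ball z₀ (R - 3 / 2) ⊆ ball c R := by
    refine ball_subset_ball' ?_
    rw [hdz₀]; linarith
  have hz₀c : z₀ ∈ ball c R := hz₀b (mem_ball_self (by linarith))
  have hre : ∀ z ∈ ball z₀ (R - 3 / 2), (g z).re ≤ (g z₀).re + M := by
    intro z hz
    have h1 := hmax z (ball_subset_closedBall (ball_subset_ball (by linarith) (hz₀b hz)))
    rw [hnorm z (hz₀b hz), hnorm z₀ hz₀c, ← Real.exp_add] at h1
    linarith [Real.exp_le_exp.mp h1]
  have hsec : ∀ z : ℂ, |z.re| ≤ 12 → |z.im - T| ≤ T / 40 →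
      ‖deriv (deriv g) z‖ ≤ 1 / 1000 ∧ z ∈ ball z₀ (R - 3 / 2) := by
    intro z hz1 hz2
    have hd : dist z z₀ ≤ 14 + T / 40 := by
      rw [dist_eq_norm]
      refine (Complex.norm_le_abs_re_add_abs_im _).trans (add_le_add ?_ ?_)
      · have := abs_le.mp hz1
        simp [hz₀]; exact abs_le.mpr ⟨by linarith, by linarith⟩
      · simpa [hz₀] using hz2
    refine ⟨?_, by rw [mem_ball]; linarith⟩
    refine (norm_deriv_deriv_le_of_re_le (by linarith : 0 < R - 3 / 2) hMpos (hg.mono hz₀b) hre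
      (by linarith)).trans ?_
    have h1 := (hT₀ T hTT₀).le
    have h2 : (T / 3) ^ 2 ≤ (R - 3 / 2) ^ 2 := by gcongr; linarith
    have hT2 : 0 < (T / 3) ^ 2 := by positivity
    calc 128 * M / (R - 3 / 2) ^ 2 ≤ 128 * M / (T / 3) ^ 2 := by gcongr
      _ = 1152 * (M * (1 / T ^ 2)) := by ring
      _ ≤ 1152 * (1 / 10000000) := by gcongr
      _ ≤ _ := by norm_num
  -- the horizontal behaviour of `Re g`
  have hhor : ∀ s : ℂ, -1 / 2 ≤ s.re → s.re ≤ 10 → |s.im - T| ≤ T / 40 →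
      |(g (s + 2)).re - (g s).re| ≤ 1 / 2 := by
    intro s hs1 hs2 hs3
    set t := s.im with ht
    have htpos : 0 < t := by have := abs_le.mp hs3; linarith
    set v : ℝ → ℝ := fun σ => (g (σ + t * Complex.I)).re with hv
    have hin : ∀ σ : ℝ, |σ| ≤ 12 → ‖deriv (deriv g) (σ + t * Complex.I)‖ ≤ 1 / 1000 ∧
        (σ + t * Complex.I : ℂ) ∈ ball c R := fun σ hσ => by
      have := hsec (σ + t * Complex.I) (by simpa using hσ) (by simpa using hs3)
      exact ⟨this.1, hz₀b this.2⟩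
    have hline : ∀ (k : ℂ → ℂ) (σ : ℝ), DifferentiableAt ℂ k (σ + t * Complex.I) →
        HasDerivAt (fun σ : ℝ => (k (σ + t * Complex.I)).re)
          (deriv k (σ + t * Complex.I)).re σ := by
      intro k σ hk
      have h1 : HasDerivAt (fun z : ℂ => k (z + t * Complex.I)) (deriv k (σ + t * Complex.I)) σ :=
        HasDerivAt.comp_add_const (σ : ℂ) (t * Complex.I) hk.hasDerivAt
      exact h1.real_of_complex
    have hgd : ∀ σ : ℝ, |σ| ≤ 12 → DifferentiableAt ℂ g (σ + t * Complex.I) := fun σ hσ =>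
      hg.differentiableAt (isOpen_ball.mem_nhds (hin σ hσ).2)
    have hgd2 : ∀ σ : ℝ, |σ| ≤ 12 → DifferentiableAt ℂ (deriv g) (σ + t * Complex.I) :=
      fun σ hσ => (hg.deriv isOpen_ball).differentiableAt (isOpen_ball.mem_nhds (hin σ hσ).2)
    have hv1 : ∀ σ : ℝ, |σ| ≤ 12 → HasDerivAt v (deriv g (σ + t * Complex.I)).re σ :=
      fun σ hσ => hline g σ (hgd σ hσ)
    set u : ℝ → ℝ := fun σ => (deriv g (σ + t * Complex.I)).re with hu
    have hv2 : ∀ σ : ℝ, |σ| ≤ 12 →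
        HasDerivAt u (deriv (deriv g) (σ + t * Complex.I)).re σ :=
      fun σ hσ => hline (deriv g) σ (hgd2 σ hσ)
    -- symmetry about the critical line, compared at `σ = 2` and `σ = -1`
    have hsym : v (-1) = v 2 := by
      have hne : ∀ σ : ℝ, (σ = -1 ∨ σ = 2) → ∀ p ∈ Z, (σ + t * Complex.I : ℂ) ≠ p := by
        rintro σ hσ p hp rfl
        have := (hZzero _ hp).2
        simp at this
        rcases hσ with rfl | rfl <;> linarith [this.1, this.2]
      have e : (1 - starRingEnd ℂ ((2 : ℝ) + t * Complex.I) : ℂ) = ((-1 : ℝ) : ℂ) + t * Complex.I := by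
        simp [Complex.conj_ofNat]; ring
      have h1 := norm_riemannXi_one_sub_conj (s := ((2 : ℝ) : ℂ) + t * Complex.I)
        (by simpa using htpos.ne')
      rw [e, hXn, hXn] at h1
      have h2 : ∏ p ∈ Z, ‖((-1 : ℝ) : ℂ) + t * Complex.I - p‖ =
          ∏ p ∈ Z, ‖((2 : ℝ) : ℂ) + t * Complex.I - p‖ := by
        have hZim : ∀ p ∈ Z, p.im ≠ 0 := fun p hp => by
          have := ((hmem p).mp hp).2
          rw [mem_closedBall, dist_eq_norm] at this
          have := (Complex.abs_im_le_norm _).trans this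
          rw [Complex.sub_im, cim] at this
          have := abs_le.mp this
          intro h; linarith
        have hinv : ∀ p ∈ Z, 1 - starRingEnd ℂ p ∈ Z := by
          intro p hp
          have hp' := (hmem p).mp hp
          rw [hmem]
          constructor
          · rw [← norm_eq_zero, norm_riemannXi_one_sub_conj (hZim p hp), hp'.1, norm_zero]
          · have := hp'.2
            rw [mem_closedBall, dist_eq_norm] at this ⊢
            refine le_trans (le_of_eq ?_) this
            rw [← Complex.norm_conj, ← norm_neg]
            congr 1
            simp [hc, Complex.conj_ofNat]; ring
        refine Finset.prod_bij' (fun p _ => 1 - starRingEnd ℂ p) (fun p _ => 1 - starRingEnd ℂ p)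
          hinv hinv (fun p _ => by simp) (fun p _ => by simp) (fun p _ => ?_)
        rw [← Complex.norm_conj, ← norm_neg]
        congr 1
        simp; ring
      rw [h2] at h1
      have h3 := mul_right_cancel₀ (hprodpos _ (hne 2 (.inr rfl))).ne' h1
      rw [hnorm _ (hin (-1) (by norm_num)).2, hnorm _ (hin 2 (by norm_num)).2] at h3
      exact Real.exp_injective h3
    obtain ⟨ξ, hξ, hξ0⟩ := exists_hasDerivAt_eq_zero (f := v) (f' := u) (by norm_num : (-1:ℝ) < 2)
      (fun σ hσ => (hv1 σ (abs_le.mpr ⟨by linarith [hσ.1], by linarith [hσ.2]⟩)).continuousAt.continuousWithinAt)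
      hsym (fun σ hσ => hv1 σ (abs_le.mpr ⟨by linarith [hσ.1], by linarith [hσ.2]⟩))
    have hubd : ∀ σ ∈ Set.Icc (-1:ℝ) 12, ‖u σ‖ ≤ 1 / 50 := by
      intro σ hσ
      have := (convex_Icc (-1:ℝ) 12).norm_image_sub_le_of_norm_hasDerivWithin_le (f := u)
        (f' := fun σ => (deriv (deriv g) (σ + t * Complex.I)).re) (C := 1 / 1000) (x := ξ) (y := σ)
        (fun x hx => (hv2 x (abs_le.mpr ⟨by linarith [hx.1], by linarith [hx.2]⟩)).hasDerivWithinAt)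
        (fun x hx => (Complex.abs_re_le_norm _).trans
          (hin x (abs_le.mpr ⟨by linarith [hx.1], by linarith [hx.2]⟩)).1)
        ⟨hξ.1.le, by linarith [hξ.2]⟩ hσ
      rw [hξ0, sub_zero] at this
      refine this.trans ?_
      have h2 : ‖σ - ξ‖ ≤ 14 := abs_le.mpr ⟨by linarith [hξ.2, hσ.1], by linarith [hξ.1, hσ.2]⟩
      linarith
    have hfin := (convex_Icc (-1:ℝ) 12).norm_image_sub_le_of_norm_hasDerivWithin_le (f := v)
        (f' := u) (C := 1 / 50) (x := s.re) (y := s.re + 2)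
        (fun x hx => (hv1 x (abs_le.mpr ⟨by linarith [hx.1], by linarith [hx.2]⟩)).hasDerivWithinAt)
        hubd ⟨by linarith, by linarith⟩ ⟨by linarith, by linarith⟩
    have e1 : v s.re = (g s).re := by simp only [hv, ht, Complex.re_add_im]
    have e2 : v (s.re + 2) = (g (s + 2)).re := by
      simp only [hv, ht]
      congr 2
      conv_rhs => rw [← Complex.re_add_im s]
      push_cast; ring
    rw [e1, e2] at hfin
    refine hfin.trans ?_
    norm_num
  intro s hs1 hs2 hs3
  have hh := abs_le.mp (hhor s hs1 hs2 hs3)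
  have m1 : s ∈ ball c R :=
    hz₀b (hsec s (abs_le.mpr ⟨by linarith, by linarith⟩) hs3).2
  have m2 : s + 2 ∈ ball c R :=
    hz₀b (hsec (s + 2) (by simp; exact abs_le.mpr ⟨by linarith, by linarith⟩) (by simpa using hs3)).2
  have hexp : Real.exp (1 / 2) ≤ 2 := by
    have := Real.exp_one_lt_d9
    have h2 : Real.exp (1 / 2) ^ 2 = Real.exp 1 := by rw [← Real.exp_nat_mul]; norm_num
    nlinarith [Real.exp_pos (1 / 2)]
  have q1 : ‖f (s + 2)‖ ≤ 2 * ‖f s‖ := by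
    rw [hnorm _ m1, hnorm _ m2]
    refine le_trans ?_ (mul_le_mul_of_nonneg_right hexp (Real.exp_pos _).le)
    rw [← Real.exp_add]
    exact Real.exp_le_exp.mpr (by linarith)
  have q2 : ‖f s‖ ≤ 2 * ‖f (s + 2)‖ := by
    rw [hnorm _ m1, hnorm _ m2]
    refine le_trans ?_ (mul_le_mul_of_nonneg_right hexp (Real.exp_pos _).le)
    rw [← Real.exp_add]
    exact Real.exp_le_exp.mpr (by linarith)
  rw [hXn, hXn]
  have P0 : 0 ≤ ∏ p ∈ Z, ‖s + 2 - p‖ := Finset.prod_nonneg fun _ _ => norm_nonneg _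
  have P1 : 0 ≤ ∏ p ∈ Z, ‖s - p‖ := Finset.prod_nonneg fun _ _ => norm_nonneg _
  constructor
  · have := mul_le_mul_of_nonneg_right q1 (mul_nonneg P0 P1)
    linarith
  · have := mul_le_mul_of_nonneg_right q2 (mul_nonneg P0 P1)
    linarith

/-! ### Heights at which `1 / ζ` is small -/

/-- Half the logarithm of `A + y²`: the logarithm of the distance between points with horizontal
distance `√A` and vertical distance `y`. -/
noncomputable def halfLog (A y : ℝ) : ℝ := Real.log (A + y ^ 2) / 2

lemma continuous_halfLog {A : ℝ} (hA : 0 < A) : Continuous (halfLog A) := by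
  unfold halfLog
  exact (Continuous.log (by fun_prop) fun y => by positivity).div_const 2

lemma halfLog_zero (y : ℝ) : halfLog 0 y = Real.log y := by
  rw [halfLog, zero_add, Real.log_pow]; simp

lemma intervalIntegrable_halfLog {A : ℝ} (hA : 0 ≤ A) (a b : ℝ) :
    IntervalIntegrable (halfLog A) volume a b := by
  rcases hA.eq_or_lt with rfl | hA
  · rw [funext halfLog_zero]; exact intervalIntegral.intervalIntegrable_log'
  · exact (continuous_halfLog hA).intervalIntegrable _ _

lemma integral_halfLog {A : ℝ} (hA : 0 < A) (h : ℝ) :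
    ∫ y in -h..h, halfLog A y =
      h * Real.log (A + h ^ 2) + 2 * √A * Real.arctan (h / √A) - 2 * h := by
  have hs : 0 < √A := Real.sqrt_pos.mpr hA
  have hsq : √A ^ 2 = A := Real.sq_sqrt hA.le
  have hd : ∀ y : ℝ, HasDerivAt (fun y => y * (Real.log (A + y ^ 2) / 2) +
      √A * Real.arctan (y / √A) - y) (halfLog A y) y := by
    intro y
    have hpos : 0 < A + y ^ 2 := by positivity
    have h1 : HasDerivAt (fun y : ℝ => A + y ^ 2) (2 * y) y := by
      simpa using (hasDerivAt_pow 2 y).const_add A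
    have h2 := (h1.log hpos.ne').div_const 2
    have h3 := (hasDerivAt_id y).mul h2
    have h4 := (((hasDerivAt_id y).div_const (√A)).arctan).const_mul (√A)
    have h5 := (h3.add h4).sub (hasDerivAt_id y)
    refine h5.congr_deriv ?_
    have e : 1 + (id y / √A) ^ 2 = (A + y ^ 2) / A := by
      rw [id, div_pow, hsq]; field_simp
    rw [e]
    simp only [id, halfLog]
    field_simp
    ring
  rw [intervalIntegral.integral_eq_sub_of_hasDerivAt (fun y _ => hd y)
    (intervalIntegrable_halfLog hA.le _ _), neg_div, Real.arctan_neg, neg_sq]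
  ring

/-- An upper bound for `log |(s + 2 - ρ) / (s - ρ)|` if `-1/2 ≤ Re s ≤ 3/2` and `0 < Re ρ < 1`, where
`y` is the vertical distance between `s` and `ρ`. -/
noncomputable def nearWeight (y : ℝ) : ℝ := halfLog 10 y - halfLog 0 y

/-- A lower bound for `log |(s + 2 - ρ) / (s - ρ)|` if `Re s = 10` and `0 < Re ρ < 1`, where `y` is
the vertical distance between `s` and `ρ`. -/
noncomputable def farWeight (y : ℝ) : ℝ := halfLog 140 y - halfLog 100 y

lemma nearWeight_nonneg (y : ℝ) : 0 ≤ nearWeight y := by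
  rw [nearWeight, halfLog, halfLog]
  rcases eq_or_ne y 0 with rfl | hy
  · have : 0 ≤ Real.log 10 := Real.log_nonneg (by norm_num)
    simp; linarith
  · have : 0 < 0 + y ^ 2 := by positivity
    have := Real.log_le_log this (by linarith : 0 + y ^ 2 ≤ 10 + y ^ 2)
    linarith

lemma farWeight_nonneg (y : ℝ) : 0 ≤ farWeight y := by
  rw [farWeight, halfLog, halfLog]
  have := Real.log_le_log (by positivity : 0 < 100 + y ^ 2) (by linarith : 100 + y ^ 2 ≤ 140 + y ^ 2)
  linarith

lemma intervalIntegrable_nearWeight (a b : ℝ) : IntervalIntegrable nearWeight volume a b :=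
  (intervalIntegrable_halfLog (by norm_num) _ _).sub (intervalIntegrable_halfLog le_rfl _ _)

lemma continuous_farWeight : Continuous farWeight :=
  (continuous_halfLog (by norm_num)).sub (continuous_halfLog (by norm_num))

lemma nearWeight_le_farWeight {y : ℝ} (hy : 100 ≤ |y|) : nearWeight y ≤ 7 / 4 * farWeight y := by
  have hy2 : 10000 ≤ y ^ 2 := by rw [← sq_abs]; nlinarith
  have hy0 : y ≠ 0 := by rintro rfl; norm_num at hy2
  have h1 : nearWeight y ≤ 5 / y ^ 2 := by
    rw [nearWeight, halfLog, halfLog, zero_add, ← sub_div, ← Real.log_div (by positivity)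
      (by positivity)]
    have := Real.log_le_sub_one_of_pos (by positivity : 0 < (10 + y ^ 2) / y ^ 2)
    have e : (10 + y ^ 2) / y ^ 2 - 1 = 2 * (5 / y ^ 2) := by field_simp; ring
    rw [e] at this; linarith
  have h2 : 20 / (140 + y ^ 2) ≤ farWeight y := by
    rw [farWeight, halfLog, halfLog, ← sub_div]
    have := Real.log_le_sub_one_of_pos (by positivity : 0 < (100 + y ^ 2) / (140 + y ^ 2))
    rw [Real.log_div (by positivity) (by positivity)] at this
    have e : (100 + y ^ 2) / (140 + y ^ 2) - 1 = -(2 * (20 / (140 + y ^ 2))) := by field_simp; ring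
    rw [e] at this; linarith
  have h3 : 5 / y ^ 2 ≤ 7 / 4 * (20 / (140 + y ^ 2)) := by
    rw [← mul_div_assoc, div_le_div_iff₀ (by positivity) (by positivity)]; nlinarith
  linarith

lemma integral_nearWeight_le {h : ℝ} (hh : 1 ≤ h) :
    ∫ y in -h..h, nearWeight y ≤ 10 / h + Real.pi * √10 := by
  have e : ∫ y in -h..h, nearWeight y = (∫ y in -h..h, halfLog 10 y) - ∫ y in -h..h, halfLog 0 y :=
    intervalIntegral.integral_sub (intervalIntegrable_halfLog (by norm_num) _ _)
      (intervalIntegrable_halfLog le_rfl _ _)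
  rw [e, integral_halfLog (by norm_num), funext halfLog_zero, integral_log, Real.log_neg_eq_log]
  have h1 : Real.log (10 + h ^ 2) ≤ 10 / h ^ 2 + 2 * Real.log h := by
    have := Real.log_le_sub_one_of_pos (by positivity : 0 < (10 + h ^ 2) / h ^ 2)
    rw [Real.log_div (by positivity) (by positivity), Real.log_pow] at this
    have e : (10 + h ^ 2) / h ^ 2 - 1 = 10 / h ^ 2 := by field_simp; ring
    rw [e] at this; push_cast at this; linarith
  have h2 : 2 * √10 * Real.arctan (h / √10) ≤ Real.pi * √10 := by
    have := Real.arctan_lt_pi_div_two (h / √10)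
    have h10 : 0 ≤ √10 := Real.sqrt_nonneg _
    nlinarith
  have h3 := mul_le_mul_of_nonneg_left h1 (by linarith : 0 ≤ h)
  have h4 : h * (10 / h ^ 2 + 2 * Real.log h) = 10 / h + 2 * (h * Real.log h) := by field_simp
  linarith

lemma arctan_le_self_of_nonneg {x : ℝ} (hx : 0 ≤ x) : Real.arctan x ≤ x := by
  have := Real.le_tan (Real.arctan_nonneg.mpr hx) (Real.arctan_lt_pi_div_two x)
  rwa [Real.tan_arctan] at this

lemma le_integral_farWeight {h : ℝ} (hh : 1 ≤ h) :
    Real.pi * (√140 - 10) - 280 / h ≤ ∫ y in -h..h, farWeight y := by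
  have e : ∫ y in -h..h, farWeight y =
      (∫ y in -h..h, halfLog 140 y) - ∫ y in -h..h, halfLog 100 y :=
    intervalIntegral.integral_sub (intervalIntegrable_halfLog (by norm_num) _ _)
      (intervalIntegrable_halfLog (by norm_num) _ _)
  have s100 : √(100 : ℝ) = 10 := by rw [show (100:ℝ) = 10 ^ 2 by norm_num]; simp
  rw [e, integral_halfLog (by norm_num), integral_halfLog (by norm_num), s100]
  have h1 := Real.log_le_log (by positivity : 0 < 100 + h ^ 2)
    (by linarith : 100 + h ^ 2 ≤ 140 + h ^ 2)
  have h1' := mul_le_mul_of_nonneg_left h1 (by linarith : 0 ≤ h)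
  have hs : 0 < √(140 : ℝ) := Real.sqrt_pos.mpr (by norm_num)
  have hss : √(140 : ℝ) * √140 = 140 := Real.mul_self_sqrt (by norm_num)
  have h2 : Real.pi / 2 - √140 / h ≤ Real.arctan (h / √140) := by
    have hp : 0 < h / √140 := by positivity
    have a1 := Real.arctan_inv_of_pos hp
    have a2 : Real.arctan (h / √140)⁻¹ ≤ (h / √140)⁻¹ := arctan_le_self_of_nonneg (by positivity)
    rw [inv_div] at a1 a2
    linarith
  have h3 := Real.arctan_lt_pi_div_two (h / 10)
  have h4 := mul_le_mul_of_nonneg_left h2 (by positivity : 0 ≤ 2 * √(140:ℝ))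
  have h5 : 2 * √140 * (Real.pi / 2 - √140 / h) = Real.pi * √140 - 280 / h := by
    have : 2 * √140 * (Real.pi / 2 - √140 / h) =
        Real.pi * √140 - 2 * (√140 * √140) / h := by ring
    rw [this, hss]; norm_num
  linarith

/-- A height at which the near weights of the zeros are small on average exists, if the far weights
are bounded throughout a slightly larger window. The integrals of the weights over `ℝ` are `π √10`
and `π (√140 - 10)`, with ratio below `7 / 4`, and the windows have ratio `11 / 10`; what matters is
that the product `77 / 40` is less than `2`. -/
lemma exists_sum_nearWeight_le {H : ℝ} (hH : 20000 ≤ H) {T B : ℝ} (Z : Finset ℂ)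
    (hB : ∀ t, |t - T| ≤ 11 * H → ∑ p ∈ Z, farWeight (t - p.im) ≤ B) :
    ∃ t, |t - T| ≤ 10 * H ∧ (∀ p ∈ Z, t ≠ p.im) ∧
      ∑ p ∈ Z, nearWeight (t - p.im) ≤ 77 / 40 * B := by
  have hfi : ∀ a b γ : ℝ, IntervalIntegrable (fun t => farWeight (t - γ)) volume a b :=
    fun a b γ => (continuous_farWeight.comp (by fun_prop)).intervalIntegrable _ _
  have hni : ∀ a b γ : ℝ, IntervalIntegrable (fun t => nearWeight (t - γ)) volume a b :=
    fun a b γ => by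
      have := (intervalIntegrable_nearWeight (a - γ) (b - γ)).comp_sub_right γ
      simpa using this
  have hsum_int : ∀ {w : ℝ → ℝ} (_ : ∀ a b γ : ℝ, IntervalIntegrable (fun t => w (t - γ)) volume a b)
      {a b : ℝ}, IntervalIntegrable (fun t => ∑ p ∈ Z, w (t - p.im)) volume a b := by
    intro w hw a b
    have := IntervalIntegrable.sum Z (fun p _ => hw a b p.im)
    rwa [Finset.sum_fn] at this
  have key : ∀ γ : ℝ, ∫ t in (T - 10 * H)..(T + 10 * H), nearWeight (t - γ) ≤
      7 / 4 * ∫ t in (T - 11 * H)..(T + 11 * H), farWeight (t - γ) := by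
    intro γ
    rcases le_or_gt |γ - T| (21 / 2 * H) with h | h
    · have h' := abs_le.mp h
      have e1 : ∫ t in (T - 10 * H)..(T + 10 * H), nearWeight (t - γ) ≤
          ∫ y in -(21 * H)..(21 * H), nearWeight y := by
        rw [intervalIntegral.integral_comp_sub_right (fun y => nearWeight y)]
        exact intervalIntegral.integral_mono_interval (by linarith) (by linarith) (by linarith)
          (Eventually.of_forall nearWeight_nonneg) (intervalIntegrable_nearWeight _ _)
      have e2 : ∫ y in -(H / 2)..(H / 2), farWeight y ≤
          ∫ t in (T - 11 * H)..(T + 11 * H), farWeight (t - γ) := by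
        rw [intervalIntegral.integral_comp_sub_right (fun y => farWeight y)]
        exact intervalIntegral.integral_mono_interval (by linarith) (by linarith) (by linarith)
          (Eventually.of_forall farWeight_nonneg) (continuous_farWeight.intervalIntegrable _ _)
      have e3 := integral_nearWeight_le (h := 21 * H) (by linarith)
      have e4 := le_integral_farWeight (h := H / 2) (by linarith)
      have n1 : √(10:ℝ) ≤ 3.1623 := by
        rw [Real.sqrt_le_left (by norm_num)]; norm_num
      have n2 : 11.832 ≤ √(140:ℝ) := Real.le_sqrt_of_sq_le (by norm_num)
      have n3 : 10 / (21 * H) ≤ 1 / 1000 := by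
        rw [div_le_div_iff₀ (by linarith) (by norm_num)]; linarith
      have n4 : 280 / (H / 2) ≤ 28 / 1000 := by
        rw [div_le_div_iff₀ (by linarith) (by norm_num)]; linarith
      have n5 := Real.pi_gt_three
      nlinarith
    · have hpt : ∀ t ∈ Set.Icc (T - 10 * H) (T + 10 * H),
          nearWeight (t - γ) ≤ 7 / 4 * farWeight (t - γ) := by
        intro t ht
        apply nearWeight_le_farWeight
        have h1 : |t - T| ≤ 10 * H := abs_le.mpr ⟨by linarith [ht.1], by linarith [ht.2]⟩
        have h2 := abs_sub_abs_le_abs_sub (γ - T) (t - T)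
        have h3 : |γ - T - (t - T)| = |t - γ| := by
          rw [← abs_neg]; congr 1; ring
        linarith
      calc ∫ t in (T - 10 * H)..(T + 10 * H), nearWeight (t - γ)
          ≤ ∫ t in (T - 10 * H)..(T + 10 * H), 7 / 4 * farWeight (t - γ) :=
            intervalIntegral.integral_mono_on (by linarith) (hni _ _ _)
              ((hfi _ _ _).const_mul _) hpt
        _ = 7 / 4 * ∫ t in (T - 10 * H)..(T + 10 * H), farWeight (t - γ) :=
            intervalIntegral.integral_const_mul _ _
        _ ≤ _ := by
            gcongr
            exact intervalIntegral.integral_mono_interval (by linarith) (by linarith) (by linarith)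
              (Eventually.of_forall fun t => farWeight_nonneg _) (hfi _ _ _)
  have hint : ∫ t in (T - 10 * H)..(T + 10 * H), ∑ p ∈ Z, nearWeight (t - p.im) ≤
      7 / 4 * (22 * H * B) := by
    rw [intervalIntegral.integral_finsetSum fun p _ => hni _ _ _]
    refine (Finset.sum_le_sum fun p _ => key p.im).trans ?_
    rw [← Finset.mul_sum, ← intervalIntegral.integral_finsetSum fun p _ => hfi _ _ _]
    gcongr
    calc ∫ t in (T - 11 * H)..(T + 11 * H), ∑ p ∈ Z, farWeight (t - p.im)
        ≤ ∫ t in (T - 11 * H)..(T + 11 * H), B := by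
          refine intervalIntegral.integral_mono_on (by linarith)
            (hsum_int hfi) (by simp) fun t ht => ?_
          exact hB t (abs_le.mpr ⟨by linarith [ht.1], by linarith [ht.2]⟩)
      _ = 22 * H * B := by
          rw [intervalIntegral.integral_const, smul_eq_mul]; ring
  by_contra! hcon
  have hfin : (Z.image Complex.im : Set ℝ).Finite := Finset.finite_toSet _
  have hae : ∀ᵐ t : ℝ, t ∉ (Z.image Complex.im : Set ℝ) :=
    compl_mem_ae_iff.mpr (hfin.measure_zero _)
  -- otherwise the mean over the window would be too large
  have hlt : ∫ t in (T - 10 * H)..(T + 10 * H), (77 / 40 * B) <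
      ∫ t in (T - 10 * H)..(T + 10 * H), ∑ p ∈ Z, nearWeight (t - p.im) := by
    have hae' : ∀ᵐ t ∂(volume.restrict (Set.Ioc (T - 10 * H) (T + 10 * H))),
        77 / 40 * B < ∑ p ∈ Z, nearWeight (t - p.im) := by
      filter_upwards [ae_restrict_of_ae hae, ae_restrict_mem measurableSet_Ioc] with t ht ht2
      refine hcon t (abs_le.mpr ⟨by linarith [ht2.1], by linarith [ht2.2]⟩) fun p hp h => ?_
      exact ht (Finset.mem_coe.mpr (Finset.mem_image.mpr ⟨p, hp, h.symm⟩))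
    refine intervalIntegral.integral_lt_integral_of_ae_le_of_measure_setOfPred_lt_ne_zero
      (by linarith) (by simp) (hsum_int hni)
      (hae'.mono fun t ht => ht.le) ?_
    intro h0
    have h1 : ∀ᵐ t ∂(volume.restrict (Set.Ioc (T - 10 * H) (T + 10 * H))), False := by
      have h2 : ∀ᵐ t ∂(volume.restrict (Set.Ioc (T - 10 * H) (T + 10 * H))),
        ¬ (77 / 40 * B < ∑ p ∈ Z, nearWeight (t - p.im)) := by
          rw [ae_iff]; simpa using h0
      filter_upwards [hae', h2] with t a b using b a
    rw [eventually_false_iff_eq_bot, ae_eq_bot, Measure.restrict_eq_zero, Real.volume_Ioc,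
      ENNReal.ofReal_eq_zero] at h1
    linarith
  rw [intervalIntegral.integral_const, smul_eq_mul] at hlt
  nlinarith

lemma norm_eq_exp_halfLog {z : ℂ} (hz : z ≠ 0) : ‖z‖ = Real.exp (halfLog (z.re ^ 2) z.im) := by
  have hp : 0 < ‖z‖ := norm_pos_iff.mpr hz
  have h : z.re ^ 2 + z.im ^ 2 = ‖z‖ ^ 2 := by
    rw [Complex.sq_norm, Complex.normSq_apply]; ring
  rw [halfLog, h, Real.log_pow]
  push_cast
  rw [mul_div_cancel_left₀ _ two_ne_zero, Real.exp_log hp]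

set_option maxHeartbeats 1600000 in
/-- If the zeros are simple, `1 / ζ` grows more slowly than `T` along a sequence of heights. By
`norm_riemannXi_shift_two`, `log |ξ(s + 2) / ξ(s)|` is a sum over zeros on both `Re s = 10`, where it
is at most `log T + O(1)`, and `-1/2 ≤ Re s ≤ 3/2`, where an upper bound for it is wanted; the two
sums are compared by `exists_sum_nearWeight_le`. The factor `Γ(s / 2 + 1) / Γ(s / 2)` in the ratio
then gains one power of `T`. -/
theorem exists_height_norm_inv_riemannZeta_le
    (simple_zeros : ∀ ρ : ℂ, IsNontrivialZetaZero ρ → deriv riemannZeta ρ ≠ 0) :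
    ∃ C : ℝ, 0 < C ∧ ∀ X : ℝ, ∃ T : ℝ, X ≤ T ∧ 1 ≤ T ∧ ∀ s : ℂ, -1 / 2 ≤ s.re → s.re ≤ 3 / 2 →
      |s.im| = T → riemannZeta s ≠ 0 ∧ ‖(riemannZeta s)⁻¹‖ ≤ C * T ^ (0.95 : ℝ) := by
  obtain ⟨T₁, hT₁, hshift⟩ := norm_riemannXi_shift_two simple_zeros
  obtain ⟨K, hK, hzeta⟩ := norm_riemannZeta_bounds (σ := 3 / 2) (by norm_num)
  -- the elementary factors of `ξ(s + 2) / ξ(s)`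
  have hratio : ∀ s : ℂ, s.im ≠ 0 →
      riemannXi (s + 2) = -((s + 2) * (s + 1)) * (s.Gammaℝ * s / 2 / Real.pi) *
        riemannZeta (s + 2) := by
    intro s hs
    rw [riemannXi_eq_of_im_ne_zero (by simpa using hs),
      Complex.Gammaℝ_add_two (ne_zero_of_im_ne_zero hs)]
    ring
  set H : ℝ := 20000 with hH
  set C₀ : ℝ := 1000 * K ^ 2 + 1 with hC₀
  have hC₀1 : 1 ≤ C₀ := by rw [hC₀]; nlinarith [sq_nonneg K]
  set C : ℝ := 2000 * K with hC
  refine ⟨C, by positivity, fun X => ?_⟩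
  obtain ⟨T, hT1, hT2, hT3, hT4⟩ : ∃ T : ℝ, T₁ ≤ T ∧ X + 10 * H ≤ T ∧ 1000 * H ≤ T ∧
      100 * Real.log C₀ ≤ Real.log T := by
    have h1 := Real.tendsto_log_atTop.eventually_ge_atTop (100 * Real.log C₀)
    obtain ⟨T, hT⟩ := (((eventually_ge_atTop T₁).and (eventually_ge_atTop (X + 10 * H))).and
      ((eventually_ge_atTop (1000 * H)).and h1)).exists
    exact ⟨T, hT.1.1, hT.1.2, hT.2.1, hT.2.2⟩
  have hT0 : 0 < T := by linarith
  obtain ⟨Z, hZ0, hZall, hZs⟩ := hshift T hT1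
  have hZzero : ∀ p ∈ Z, 0 < p.re ∧ p.re < 1 := fun p hp =>
    (isNontrivialZetaZero_of_riemannXi_eq_zero (hZ0 p hp)).2
  -- the far weights are controlled on `Re s = 10`
  have hfar : ∀ t, |t - T| ≤ 11 * H → ∑ p ∈ Z, farWeight (t - p.im) ≤ Real.log T + Real.log C₀ := by
    intro t ht
    have ht' := abs_le.mp ht
    set s : ℂ := 10 + t * Complex.I with hs
    have sre : s.re = 10 := by simp [hs]
    have sim : s.im = t := by simp [hs]
    have him : s.im ≠ 0 := by rw [sim]; linarith
    have h := (hZs s (by rw [sre]; norm_num) (by rw [sre]) (by rw [sim]; linarith)).2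
    have hne : ∀ p ∈ Z, s - p ≠ 0 ∧ s + 2 - p ≠ 0 := fun p hp => by
      have := (hZzero p hp).2
      constructor <;> intro h0 <;> have h1 := congrArg Complex.re h0 <;> simp [sre] at h1 <;>
        linarith
    have hterm : ∀ p ∈ Z, Real.exp (farWeight (t - p.im)) * ‖s - p‖ ≤ ‖s + 2 - p‖ := by
      intro p hp
      have hp1 := hZzero p hp
      rw [norm_eq_exp_halfLog (hne p hp).1, norm_eq_exp_halfLog (hne p hp).2, ← Real.exp_add]
      apply Real.exp_le_exp.mpr
      simp only [Complex.sub_re, Complex.add_re, Complex.sub_im, Complex.add_im, sre, sim]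
      norm_num
      rw [farWeight, halfLog, halfLog, halfLog, halfLog]
      set y := t - p.im
      have k1 : 0 < 140 + y ^ 2 := by positivity
      have k2 : 0 < (10 - p.re) ^ 2 + y ^ 2 := by
        have : 0 < 10 - p.re := by linarith
        positivity
      have k3 : 0 < 100 + y ^ 2 := by positivity
      have k4 : 0 < (12 - p.re) ^ 2 + y ^ 2 := by
        have : 0 < 12 - p.re := by linarith
        positivity
      have hmul : (140 + y ^ 2) * ((10 - p.re) ^ 2 + y ^ 2) ≤
          ((12 - p.re) ^ 2 + y ^ 2) * (100 + y ^ 2) := by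
        have q0 : 0 ≤ p.re * (1 - p.re) := mul_nonneg hp1.1.le (by linarith)
        nlinarith [mul_nonneg (sq_nonneg y) (by linarith : 0 ≤ 1 - p.re)]
      have := Real.log_le_log (by positivity) hmul
      rw [Real.log_mul k1.ne' k2.ne', Real.log_mul k4.ne' k3.ne'] at this
      linarith
    have hprod : Real.exp (∑ p ∈ Z, farWeight (t - p.im)) * ∏ p ∈ Z, ‖s - p‖ ≤
        ∏ p ∈ Z, ‖s + 2 - p‖ := by
      rw [Real.exp_sum, ← Finset.prod_mul_distrib]
      exact Finset.prod_le_prod (fun p _ => by positivity) hterm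
    have hP0 : 0 < ∏ p ∈ Z, ‖s - p‖ := Finset.prod_pos fun p hp => norm_pos_iff.mpr (hne p hp).1
    have hX0 : 0 < ‖riemannXi s‖ :=
      norm_pos_iff.mpr (riemannXi_ne_zero_of_one_le_re (by rw [sre]; norm_num))
    have h1 : Real.exp (∑ p ∈ Z, farWeight (t - p.im)) * ‖riemannXi s‖ ≤
        2 * ‖riemannXi (s + 2)‖ := by
      have := (mul_le_mul_of_nonneg_left hprod hX0.le).trans h
      refine le_of_mul_le_mul_right (a := ∏ p ∈ Z, ‖s - p‖) ?_ hP0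
      linarith
    have hst : t ≤ ‖s‖ := by
      have := Complex.abs_im_le_norm s; rw [sim] at this; exact (le_abs_self t).trans this
    have hs0 : 0 < ‖s‖ := by linarith
    have hs2 : ‖s‖ ≤ 2 * T := by
      refine (Complex.norm_le_abs_re_add_abs_im s).trans ?_
      rw [sre, sim, abs_of_pos (by linarith : (0:ℝ) < t)]; norm_num; linarith
    have h2 : ‖riemannXi (s + 2)‖ ≤ C₀ / 2 * T * ‖riemannXi s‖ := by
      have hz1 := (hzeta (s + 2) (by simp [sre]; norm_num)).1
      have hz2 := (hzeta s (by rw [sre]; norm_num)).2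
      rw [norm_inv] at hz2
      have hz0 : 0 < ‖riemannZeta s‖ :=
        norm_pos_iff.mpr (riemannZeta_ne_zero_of_one_le_re (by rw [sre]; norm_num))
      have hz3 : 1 ≤ K * ‖riemannZeta s‖ := by
        have := mul_le_mul_of_nonneg_right hz2 hz0.le
        rwa [inv_mul_cancel₀ hz0.ne'] at this
      rw [hratio s him, riemannXi_eq_of_im_ne_zero him]
      simp only [norm_mul, norm_neg, norm_div, Complex.norm_ofNat, Complex.norm_real,
        Real.norm_of_nonneg Real.pi_pos.le]
      have b1 : ‖s + 2‖ ≤ 2 * ‖s‖ := (norm_add_le _ _).trans (by rw [Complex.norm_ofNat]; linarith)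
      have b2 : ‖s + 1‖ ≤ 3 * ‖1 - s‖ := by
        have := norm_add_le (-(1 - s)) 2
        rw [norm_neg, Complex.norm_ofNat, show -(1 - s) + 2 = s + 1 by ring] at this
        have h3 : 9 ≤ ‖1 - s‖ := by
          have := Complex.abs_re_le_norm (1 - s)
          rw [Complex.sub_re, sre] at this; norm_num at this; exact this
        linarith
      have b3 : ‖s.Gammaℝ‖ * ‖s‖ / 2 / Real.pi ≤ ‖s.Gammaℝ‖ * T := by
        rw [div_div, div_le_iff₀ (by have := Real.pi_pos; positivity)]
        have := mul_le_mul_of_nonneg_left hs2 (norm_nonneg s.Gammaℝ)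
        have hp := Real.pi_gt_three
        have : 0 ≤ ‖s.Gammaℝ‖ * T := by positivity
        nlinarith
      have b4 : ‖riemannZeta (s + 2)‖ ≤ K ^ 2 * ‖riemannZeta s‖ := by
        have := mul_le_mul_of_nonneg_left hz3 hK.le
        nlinarith
      calc ‖s + 2‖ * ‖s + 1‖ * (‖s.Gammaℝ‖ * ‖s‖ / 2 / Real.pi) * ‖riemannZeta (s + 2)‖
          ≤ (2 * ‖s‖) * (3 * ‖1 - s‖) * (‖s.Gammaℝ‖ * T) * (K ^ 2 * ‖riemannZeta s‖) := by gcongr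
        _ = 6 * K ^ 2 * (T * (‖s‖ * ‖1 - s‖ * ‖s.Gammaℝ‖ * ‖riemannZeta s‖)) := by ring
        _ ≤ (C₀ / 2) * (T * (‖s‖ * ‖1 - s‖ * ‖s.Gammaℝ‖ * ‖riemannZeta s‖)) := by
            gcongr; rw [hC₀]; nlinarith [sq_nonneg K]
        _ = _ := by ring
    have h3 : Real.exp (∑ p ∈ Z, farWeight (t - p.im)) ≤ C₀ * T := by
      refine le_of_mul_le_mul_right (a := ‖riemannXi s‖) (h1.trans ?_) hX0
      linarith
    have h4 := Real.log_le_log (Real.exp_pos _) h3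
    rw [Real.log_exp, Real.log_mul (by linarith) hT0.ne'] at h4
    linarith
  obtain ⟨t, ht, htne, hsum⟩ := exists_sum_nearWeight_le (le_refl H) Z hfar
  have ht' := abs_le.mp ht
  have hsum' : ∑ p ∈ Z, nearWeight (t - p.im) ≤ 1.95 * Real.log T := by
    refine hsum.trans ?_
    have : 0 ≤ Real.log C₀ := Real.log_nonneg hC₀1
    norm_num
    linarith
  have main : ∀ s : ℂ, -1 / 2 ≤ s.re → s.re ≤ 3 / 2 → s.im = t →
      riemannZeta s ≠ 0 ∧ ‖(riemannZeta s)⁻¹‖ ≤ C * t ^ (0.95 : ℝ) := by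
    intro s hs1 hs2 sim
    have him : s.im ≠ 0 := by rw [sim]; linarith
    have hX : riemannXi s ≠ 0 := by
      intro h0
      refine htne s (hZall s h0 ?_) sim.symm
      rw [sim]; linarith
    have hz : riemannZeta s ≠ 0 := by
      intro h0; apply hX; rw [riemannXi_eq_of_im_ne_zero him, h0, mul_zero]
    refine ⟨hz, ?_⟩
    have h := (hZs s hs1 (by linarith) (by rw [sim]; linarith)).1
    have hy : ∀ p ∈ Z, t - p.im ≠ 0 := fun p hp => sub_ne_zero.mpr (htne p hp)
    have hne : ∀ p ∈ Z, s - p ≠ 0 ∧ s + 2 - p ≠ 0 := fun p hp => by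
      constructor <;> intro h0 <;> have h1 := congrArg Complex.im h0 <;> simp [sim] at h1 <;>
        exact hy p hp h1
    have hterm : ∀ p ∈ Z, ‖s + 2 - p‖ ≤ Real.exp (nearWeight (t - p.im)) * ‖s - p‖ := by
      intro p hp
      have hp1 := hZzero p hp
      rw [norm_eq_exp_halfLog (hne p hp).1, norm_eq_exp_halfLog (hne p hp).2, ← Real.exp_add]
      apply Real.exp_le_exp.mpr
      simp only [Complex.sub_re, Complex.add_re, Complex.sub_im, Complex.add_im, sim,
        Complex.re_ofNat, Complex.im_ofNat, add_zero]
      have hyp := hy p hp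
      rw [nearWeight, halfLog, halfLog, halfLog, halfLog]
      set y := t - p.im
      set r := s.re - p.re with hr
      have er : s.re + 2 - p.re = r + 2 := by rw [hr]; ring
      have hr1 : r ≤ 3 / 2 := by linarith
      rw [er]
      have y0 : 0 < y ^ 2 := by positivity
      have k1 : 0 < 10 + y ^ 2 := by positivity
      have k2 : 0 < r ^ 2 + y ^ 2 := by positivity
      have k3 : 0 < 0 + y ^ 2 := by positivity
      have k4 : 0 < (r + 2) ^ 2 + y ^ 2 := by positivity
      have hmul : ((r + 2) ^ 2 + y ^ 2) * (0 + y ^ 2) ≤ (10 + y ^ 2) * (r ^ 2 + y ^ 2) := by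
        nlinarith [mul_nonneg y0.le (by linarith : 0 ≤ 3 / 2 - r), sq_nonneg r]
      have := Real.log_le_log (by positivity) hmul
      rw [Real.log_mul k4.ne' k3.ne', Real.log_mul k1.ne' k2.ne'] at this
      linarith
    set S := ∑ p ∈ Z, nearWeight (t - p.im) with hS
    have hprod : ∏ p ∈ Z, ‖s + 2 - p‖ ≤ Real.exp S * ∏ p ∈ Z, ‖s - p‖ := by
      rw [hS, Real.exp_sum, ← Finset.prod_mul_distrib]
      exact Finset.prod_le_prod (fun p _ => norm_nonneg _) hterm
    have hP0 : 0 < ∏ p ∈ Z, ‖s - p‖ := Finset.prod_pos fun p hp => norm_pos_iff.mpr (hne p hp).1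
    have h1 : ‖riemannXi (s + 2)‖ ≤ 2 * Real.exp S * ‖riemannXi s‖ := by
      have := mul_le_mul_of_nonneg_left hprod (norm_nonneg (riemannXi s))
      refine le_of_mul_le_mul_right (a := ∏ p ∈ Z, ‖s - p‖) ?_ hP0
      linarith
    have hst : t ≤ ‖s‖ := by
      have := Complex.abs_im_le_norm s; rw [sim] at this; exact (le_abs_self t).trans this
    have hs0 : 0 < ‖s‖ := by linarith
    rw [hratio s him, riemannXi_eq_of_im_ne_zero him] at h1
    simp only [norm_mul, norm_neg, norm_div, Complex.norm_ofNat, Complex.norm_real,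
      Real.norm_of_nonneg Real.pi_pos.le] at h1
    have hG0 : 0 < ‖s.Gammaℝ‖ := norm_pos_iff.mpr (Gammaℝ_ne_zero_of_im_ne_zero him)
    have c1 : ‖s‖ ≤ 2 * ‖s + 2‖ := by
      have := norm_sub_le (s + 2) 2
      rw [Complex.norm_ofNat, add_sub_cancel_right] at this; linarith
    have c2 : ‖1 - s‖ ≤ 2 * ‖s + 1‖ := by
      have := norm_sub_le 2 (s + 1)
      rw [Complex.norm_ofNat, show (2:ℂ) - (s + 1) = 1 - s by ring] at this
      have h3 := Complex.abs_im_le_norm (s + 1)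
      rw [Complex.add_im, Complex.one_im, add_zero, sim] at h3
      have := le_abs_self t
      linarith
    have hz0 : 0 < ‖riemannZeta s‖ := norm_pos_iff.mpr hz
    have hz2 := (hzeta (s + 2) (by simp; linarith)).2
    rw [norm_inv] at hz2
    have hz20 : 0 < ‖riemannZeta (s + 2)‖ :=
      norm_pos_iff.mpr (riemannZeta_ne_zero_of_one_le_re (by simp; linarith))
    have hz3 : 1 ≤ K * ‖riemannZeta (s + 2)‖ := by
      have := mul_le_mul_of_nonneg_right hz2 hz20.le
      rwa [inv_mul_cancel₀ hz20.ne'] at this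
    -- divide by the elementary factors
    have h2 : ‖s‖ ≤ 100 * K * Real.exp S * ‖riemannZeta s‖ := by
      set N := ‖s + 2‖ * ‖s + 1‖ * ‖s.Gammaℝ‖ with hN
      have hN0 : 0 < N := by
        have : 0 < ‖s + 2‖ := by linarith
        have : 0 < ‖s + 1‖ := by
          have h3 := Complex.abs_im_le_norm (s + 1)
          rw [Complex.add_im, Complex.one_im, add_zero, sim] at h3
          have := le_abs_self t
          linarith
        positivity
      have hpi := Real.pi_pos
      have hpi4 := Real.pi_lt_d2
      have d1 : N * (‖s‖ * ‖riemannZeta (s + 2)‖) ≤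
          2 * Real.pi * (2 * Real.exp S * (4 * N * ‖riemannZeta s‖)) := by
        have e1 : ‖s‖ * ‖1 - s‖ * ‖s.Gammaℝ‖ * ‖riemannZeta s‖ ≤ 4 * N * ‖riemannZeta s‖ := by
          calc ‖s‖ * ‖1 - s‖ * ‖s.Gammaℝ‖ * ‖riemannZeta s‖
              ≤ (2 * ‖s + 2‖) * (2 * ‖s + 1‖) * ‖s.Gammaℝ‖ * ‖riemannZeta s‖ := by gcongr
            _ = _ := by rw [hN]; ring
        have e2 := h1.trans (mul_le_mul_of_nonneg_left e1 (by positivity : 0 ≤ 2 * Real.exp S))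
        have e3 : ‖s + 2‖ * ‖s + 1‖ * (‖s.Gammaℝ‖ * ‖s‖ / 2 / Real.pi) * ‖riemannZeta (s + 2)‖ =
            N * (‖s‖ * ‖riemannZeta (s + 2)‖) / (2 * Real.pi) := by
          rw [hN]; field_simp
        rw [e3, div_le_iff₀ (by positivity)] at e2
        linarith
      have d2 : ‖s‖ * ‖riemannZeta (s + 2)‖ ≤ 16 * Real.pi * Real.exp S * ‖riemannZeta s‖ := by
        refine le_of_mul_le_mul_left (d1.trans_eq ?_) hN0
        ring
      have d3 : 16 * Real.pi * Real.exp S * ‖riemannZeta s‖ ≤ 100 * Real.exp S * ‖riemannZeta s‖ := by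
        gcongr; linarith
      have d4 := mul_le_mul_of_nonneg_left (d2.trans d3) hK.le
      have d5 := mul_le_mul_of_nonneg_left hz3 hs0.le
      linarith
    have hexp : Real.exp S ≤ 4 * t ^ (1.95 : ℝ) := by
      have t0 : 0 < t := by linarith
      have t2 : T ≤ 2 * t := by linarith
      calc Real.exp S ≤ Real.exp (1.95 * Real.log T) := Real.exp_le_exp.mpr hsum'
        _ = T ^ (1.95 : ℝ) := by rw [Real.rpow_def_of_pos hT0]; ring_nf
        _ ≤ (2 * t) ^ (1.95 : ℝ) := by gcongr
        _ = 2 ^ (1.95 : ℝ) * t ^ (1.95 : ℝ) := Real.mul_rpow (by norm_num) t0.le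
        _ ≤ 4 * t ^ (1.95 : ℝ) := by
            gcongr
            calc (2:ℝ) ^ (1.95 : ℝ) ≤ 2 ^ (2 : ℝ) :=
                  Real.rpow_le_rpow_of_exponent_le (by norm_num) (by norm_num)
              _ = 4 := by norm_num
    have t0 : 0 < t := by linarith
    rw [norm_inv, inv_le_iff_one_le_mul₀ hz0]
    have e1 : t ^ (1.95 : ℝ) = t * t ^ (0.95 : ℝ) := by
      rw [show (1.95 : ℝ) = 1 + 0.95 by norm_num, Real.rpow_add t0, Real.rpow_one]
    rw [e1] at hexp
    have f1 : t ≤ 100 * K * (4 * (t * t ^ (0.95 : ℝ))) * ‖riemannZeta s‖ := by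
      refine hst.trans (h2.trans ?_)
      gcongr
    have f2 : t * 1 ≤ t * (400 * K * t ^ (0.95 : ℝ) * ‖riemannZeta s‖) := by linarith
    refine (le_of_mul_le_mul_left f2 t0).trans ?_
    rw [hC]
    gcongr
    norm_num
  refine ⟨t, by linarith, by linarith, fun s hs1 hs2 hs3 => ?_⟩
  rcases abs_eq (by linarith : 0 ≤ t) |>.mp hs3 with h | h
  · exact main s hs1 hs2 h
  · have := main (starRingEnd ℂ s) (by simpa using hs1) (by simpa using hs2) (by simp [h])
    rw [riemannZeta_conj] at this
    refine ⟨fun h0 => this.1 (by rw [h0, map_zero]), ?_⟩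
    have h2 := this.2
    rwa [norm_inv, Complex.norm_conj, ← norm_inv] at h2

/-! ### Contour integrals along vertical lines -/

lemma integrable_exp_neg_mul_abs {η : ℝ} (hη : 0 < η) :
    Integrable fun u : ℝ => Real.exp (-(η * |u|)) := by
  rw [← integrableOn_univ, ← Set.Iic_union_Ioi (a := (0 : ℝ))]
  refine IntegrableOn.union ?_ ?_
  · refine (integrableOn_exp_mul_Iic hη 0).congr_fun (fun u hu => ?_) measurableSet_Iic
    simp only
    rw [abs_of_nonpos hu]; ring_nf
  · refine (exp_neg_integrableOn_Ioi 0 hη).congr_fun (fun u hu => ?_) measurableSet_Ioi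
    simp only
    rw [abs_of_pos hu]; ring_nf

lemma eventually_pos_and_le :
    ∀ᶠ p : ℝ × ℝ in 𝓝[>] 0 ×ˢ atTop, 0 < p.1 ∧ p.1 ≤ p.2 := by
  filter_upwards [prod_mem_prod (Ioo_mem_nhdsGT (zero_lt_one' ℝ)) (Ici_mem_atTop (1 : ℝ))]
    with p hp
  exact ⟨hp.1.1, hp.1.2.le.trans hp.2⟩

/-- An absolutely convergent integral over `(0, ∞)` is also an improper integral. -/
lemma hasImproperIntegral_of_integrableOn {f : ℝ → ℂ} (hf : IntegrableOn f (Set.Ioi 0)) :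
    HasImproperIntegral f (∫ x in Set.Ioi 0, f x) := by
  refine ⟨hf.locallyIntegrableOn, ?_⟩
  have hpos := eventually_pos_and_le
  have hev : (fun p : ℝ × ℝ => ∫ x in Set.Ioi 0, (Set.Ioc p.1 p.2).indicator f x)
      =ᶠ[𝓝[>] 0 ×ˢ atTop] fun p => ∫ x in p.1..p.2, f x := by
    filter_upwards [hpos] with p hp
    rw [intervalIntegral.integral_of_le hp.2, setIntegral_indicator measurableSet_Ioc,
      Set.inter_eq_right.mpr fun x (hx : x ∈ Set.Ioc p.1 p.2) => Set.mem_Ioi.mpr (hp.1.trans hx.1)]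
  refine Tendsto.congr' hev ?_
  refine tendsto_integral_filter_of_dominated_convergence (fun x => ‖f x‖) ?_ ?_ hf.norm ?_
  · exact Eventually.of_forall fun p => hf.aestronglyMeasurable.indicator measurableSet_Ioc
  · exact Eventually.of_forall fun p => Eventually.of_forall fun x =>
      norm_indicator_le_norm_self _ _
  · filter_upwards [ae_restrict_mem measurableSet_Ioi] with x hx
    refine tendsto_const_nhds.congr' ?_
    filter_upwards [prod_mem_prod (Ioo_mem_nhdsGT (show (0 : ℝ) < x from hx)) (Ici_mem_atTop x)]
      with p hp
    rw [Set.indicator_of_mem]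
    exact ⟨hp.1.2, hp.2⟩

/-- If the integrals along the horizontal sides tend to `0`, the boundary integrals over growing
rectangles tend to the difference of the integrals along the two vertical lines. -/
lemma tendsto_rectIntegral {h : ℂ → ℂ} {a b : ℝ} (hab : a ≤ b) {T : ℕ → ℝ}
    (hT : Tendsto T atTop atTop)
    (ha : Integrable fun y : ℝ => h (a + y * Complex.I))
    (hb : Integrable fun y : ℝ => h (b + y * Complex.I)) {ε : ℕ → ℝ}
    (hε : Tendsto ε atTop (𝓝 0))
    (hbound : ∀ᶠ n in atTop, ∀ x : ℝ, a ≤ x → x ≤ b →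
      ‖h (x + (T n : ℝ) * Complex.I)‖ ≤ ε n ∧ ‖h (x + (-T n : ℝ) * Complex.I)‖ ≤ ε n) :
    Tendsto (fun n => rectIntegral h a b (-T n) (T n)) atTop
      (𝓝 (Complex.I * (∫ y : ℝ, h (b + y * Complex.I)) -
        Complex.I * ∫ y : ℝ, h (a + y * Complex.I))) := by
  have hT' : Tendsto (fun n => -T n) atTop atBot := tendsto_neg_atTop_atBot.comp hT
  have hv := fun c (hc : Integrable fun y : ℝ => h ((c : ℝ) + y * Complex.I)) =>
    (intervalIntegral_tendsto_integral hc hT' hT).const_mul Complex.I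
  have hlim : Tendsto (fun n => ε n * |b - a|) atTop (𝓝 0) := by
    simpa using hε.mul_const |b - a|
  have hh : Tendsto (fun n => ∫ x in a..b, h (x + (T n : ℝ) * Complex.I)) atTop (𝓝 0) := by
    refine squeeze_zero_norm' ?_ hlim
    filter_upwards [hbound] with n hn
    refine intervalIntegral.norm_integral_le_of_norm_le_const fun x hx => ?_
    rw [Set.uIoc_of_le hab] at hx
    exact (hn x hx.1.le hx.2).1
  have hh' : Tendsto (fun n => ∫ x in a..b, h (x + (-T n : ℝ) * Complex.I)) atTop (𝓝 0) := by
    refine squeeze_zero_norm' ?_ hlim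
    filter_upwards [hbound] with n hn
    refine intervalIntegral.norm_integral_le_of_norm_le_const fun x hx => ?_
    rw [Set.uIoc_of_le hab] at hx
    exact (hn x hx.1.le hx.2).2
  have := ((hh'.sub hh).add (hv b hb)).sub (hv a ha)
  simpa [rectIntegral] using this

/-- `F` is holomorphic in `-1 < Re w < 2` except for an at most simple pole at `0` with residue
`r`, and is `O(|Im w| ^ (-1 - δ))` in closed substrips. -/
structure StripSymbol (F : ℂ → ℂ) (r : ℂ) (δ : ℝ) : Prop where
  differentiableOn : DifferentiableOn ℂ F {w : ℂ | -1 < w.re ∧ w.re < 2 ∧ w ≠ 0}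
  residue : Tendsto (fun w : ℂ => w * F w) (𝓝[≠] 0) (𝓝 r)
  pos : 0 < δ
  decay : ∀ a b : ℝ, -1 < a → b < 2 → ∃ C : ℝ, ∀ σ t : ℝ, a ≤ σ → σ ≤ b → 1 ≤ |t| →
      ‖F ((σ : ℂ) + (t : ℂ) * Complex.I)‖ ≤ C * |t| ^ (-1 - δ)

lemma rpow_neg_one_sub_le {δ t : ℝ} (hδ : 0 < δ) (ht : 1 ≤ |t|) :
    |t| ^ (-1 - δ) ≤ 2 ^ (1 + δ) * (1 + |t|) ^ (-(1 + δ)) := by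
  have h0 : 0 < |t| := by linarith
  rw [show -1 - δ = -(1 + δ) by ring, Real.rpow_neg h0.le, Real.rpow_neg (by linarith),
    ← div_eq_mul_inv, ← one_div, div_le_div_iff₀ (by positivity) (by positivity), one_mul,
    ← Real.mul_rpow (by norm_num) h0.le]
  gcongr
  linarith

namespace StripSymbol

variable {F : ℂ → ℂ} {r : ℂ} {δ : ℝ}

lemma differentiableAt (hF : StripSymbol F r δ) {w : ℂ} (h1 : -1 < w.re) (h2 : w.re < 2)
    (h0 : w ≠ 0) : DifferentiableAt ℂ F w := by
  refine hF.differentiableOn.differentiableAt (IsOpen.mem_nhds ?_ ⟨h1, h2, h0⟩)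
  exact (isOpen_lt continuous_const Complex.continuous_re).inter
    ((isOpen_lt Complex.continuous_re continuous_const).inter isOpen_ne)

lemma continuous_line (hF : StripSymbol F r δ) {σ : ℝ} (h1 : -1 < σ) (h2 : σ < 2) (h0 : σ ≠ 0) :
    Continuous fun t : ℝ => F (σ + t * Complex.I) := by
  rw [continuous_iff_continuousAt]
  intro t
  have hd : DifferentiableAt ℂ F (σ + t * Complex.I) := by
    refine hF.differentiableAt (by simpa) (by simpa) fun h => h0 ?_
    simpa using congrArg Complex.re h
  exact ContinuousAt.comp (f := fun t : ℝ => (σ : ℂ) + t * Complex.I) hd.continuousAt (by fun_prop)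

lemma exists_norm_line_le (hF : StripSymbol F r δ) {σ : ℝ} (h1 : -1 < σ) (h2 : σ < 2)
    (h0 : σ ≠ 0) :
    ∃ M : ℝ, 0 < M ∧ ∀ t : ℝ, ‖F (σ + t * Complex.I)‖ ≤ M * (1 + |t|) ^ (-(1 + δ)) := by
  have hδ := hF.pos
  obtain ⟨C, hC⟩ := hF.decay σ σ h1 h2
  obtain ⟨B, hB⟩ := isCompact_Icc.exists_bound_of_continuousOn (s := Set.Icc (-1 : ℝ) 1)
    (hF.continuous_line h1 h2 h0).continuousOn
  refine ⟨(|C| + |B| + 1) * 2 ^ (1 + δ), by positivity, fun t => ?_⟩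
  rcases le_total 1 |t| with ht | ht
  · refine (hC σ t le_rfl le_rfl ht).trans ?_
    rw [mul_assoc]
    have h3 := rpow_neg_one_sub_le hδ ht
    have h4 : 0 ≤ |t| ^ (-1 - δ) := by positivity
    calc C * |t| ^ (-1 - δ) ≤ (|C| + |B| + 1) * |t| ^ (-1 - δ) := by
          gcongr; linarith [le_abs_self C, abs_nonneg B]
      _ ≤ _ := by gcongr
  · have h3 := hB t (abs_le.mp ht)
    have h4 : (1 : ℝ) ≤ 2 ^ (1 + δ) * (1 + |t|) ^ (-(1 + δ)) := by
      have : 0 ≤ |t| := abs_nonneg t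
      rw [Real.rpow_neg (by positivity), ← div_eq_mul_inv, le_div_iff₀ (by positivity), one_mul]
      gcongr
      linarith
    rw [mul_assoc]
    refine h3.trans ?_
    calc B ≤ (|C| + |B| + 1) * 1 := by linarith [le_abs_self B, abs_nonneg C]
      _ ≤ _ := by gcongr

lemma integrable_line (hF : StripSymbol F r δ) {σ : ℝ} (h1 : -1 < σ) (h2 : σ < 2) (h0 : σ ≠ 0) :
    Integrable fun t : ℝ => F (σ + t * Complex.I) := by
  obtain ⟨M, -, hM⟩ := hF.exists_norm_line_le h1 h2 h0
  have hI := (integrable_one_add_norm (E := ℝ) (μ := volume) (r := 1 + δ)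
    (by simpa using hF.pos)).const_mul M
  exact hI.mono' (hF.continuous_line h1 h2 h0).aestronglyMeasurable
    (Eventually.of_forall fun t => by simpa using hM t)

end StripSymbol

lemma continuous_cpow_line {x σ : ℝ} (hx : 0 < x) :
    Continuous fun t : ℝ => (x : ℂ) ^ (-((σ : ℂ) + t * Complex.I)) := by
  refine Continuous.const_cpow (by fun_prop) (Or.inl (by exact_mod_cast hx.ne'))

lemma norm_cpow_line {x : ℝ} (σ t : ℝ) (hx : 0 < x) :
    ‖(x : ℂ) ^ (-((σ : ℂ) + t * Complex.I))‖ = x ^ (-σ) := by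
  rw [Complex.norm_cpow_eq_rpow_re_of_pos hx]; simp

lemma integrable_cpow_mul_line {F : ℂ → ℂ} {σ x : ℝ} (hx : 0 < x)
    (hF : Integrable fun t : ℝ => F (σ + t * Complex.I)) :
    Integrable fun t : ℝ => (x : ℂ) ^ (-((σ : ℂ) + t * Complex.I)) * F (σ + t * Complex.I) :=
  hF.bdd_mul (continuous_cpow_line hx).aestronglyMeasurable
    (Eventually.of_forall fun t => (norm_cpow_line σ t hx).le)

lemma exists_norm_mellinInv_le {F : ℂ → ℂ} {σ : ℝ} :
    ∃ M : ℝ, 0 ≤ M ∧ ∀ x : ℝ, 0 < x → ‖mellinInv σ F x‖ ≤ M * x ^ (-σ) := by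
  refine ⟨1 / (2 * Real.pi) * ∫ t : ℝ, ‖F (σ + t * Complex.I)‖,
    mul_nonneg (by positivity) (integral_nonneg fun _ => norm_nonneg _), fun x hx => ?_⟩
  rw [mellinInv, norm_smul, Real.norm_of_nonneg (by positivity), mul_assoc, mul_comm (∫ _, _)]
  gcongr
  refine (norm_integral_le_integral_norm _).trans_eq ?_
  rw [← integral_const_mul]
  refine integral_congr_ae (Eventually.of_forall fun t => ?_)
  simp only [norm_smul, norm_cpow_line σ t hx]

lemma continuousOn_mellinInv {F : ℂ → ℂ} {σ : ℝ}
    (hF : Integrable fun t : ℝ => F (σ + t * Complex.I)) :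
    ContinuousOn (mellinInv σ F) (Set.Ioi 0) := by
  have h := VectorFourier.fourierIntegral_continuous (L := innerₗ ℝ) (μ := volume)
    Real.continuous_fourierChar (e := Real.fourierChar) (by exact (continuous_inner (𝕜 := ℝ) (E := ℝ)))
    (hF.comp_mul_left' (by positivity : 2 * Real.pi ≠ 0))
  have hg : ContinuousOn (fun x : ℝ => (x : ℂ) ^ (-σ : ℂ) •
      FourierTransformInv.fourierInv (fun y : ℝ => F (σ + 2 * Real.pi * y * Complex.I))
        (-Real.log x)) (Set.Ioi 0) := by
    have e : (fun x : ℝ => FourierTransformInv.fourierInv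
        (fun y : ℝ => F (σ + 2 * Real.pi * y * Complex.I)) (-Real.log x)) =
        fun x : ℝ => FourierTransform.fourier
          (fun y : ℝ => F (σ + ((2 * Real.pi * y : ℝ) : ℂ) * Complex.I)) (Real.log x) := by
      ext x
      rw [Real.fourierInv_eq_fourier_neg, neg_neg]
      push_cast; rfl
    have c1 : ContinuousOn (fun x : ℝ => (x : ℂ) ^ (-σ : ℂ)) (Set.Ioi 0) := fun x hx =>
      (Complex.continuousAt_ofReal_cpow_const _ _ (Or.inr (ne_of_gt hx))).continuousWithinAt
    have h2 : Continuous (FourierTransform.fourier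
        (fun y : ℝ => F (σ + ((2 * Real.pi * y : ℝ) : ℂ) * Complex.I))) := h
    have c2 := h2.comp_continuousOn (Real.continuousOn_log.mono
      fun x (hx : x ∈ Set.Ioi (0 : ℝ)) => ne_of_gt hx)
    refine (c1.mul c2).congr fun x _ => ?_
    rw [smul_eq_mul]
    exact congrArg _ (congrFun e x)
  exact hg.congr fun x hx => mellinInv_eq_fourierInv σ F hx

namespace StripSymbol

variable {F : ℂ → ℂ} {r : ℂ} {δ : ℝ}

lemma tendsto_rectIntegral_cpow_mul (hF : StripSymbol F r δ) {a b x : ℝ} (ha : -1 < a) (hb : b < 2)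
    (hab : a ≤ b) (ha0 : a ≠ 0) (hb0 : b ≠ 0) (hx : 0 < x) :
    Tendsto (fun n : ℕ => rectIntegral (fun w => (x : ℂ) ^ (-w) * F w) a b (-(n : ℝ)) n) atTop
      (𝓝 (2 * Real.pi * Complex.I * (mellinInv b F x - mellinInv a F x))) := by
  obtain ⟨C, hC⟩ := hF.decay a b ha hb
  have hδ := hF.pos
  have key := tendsto_rectIntegral (h := fun w => (x : ℂ) ^ (-w) * F w) hab
    tendsto_natCast_atTop_atTop
    (integrable_cpow_mul_line hx (hF.integrable_line ha (by linarith) ha0))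
    (integrable_cpow_mul_line hx (hF.integrable_line (by linarith) hb hb0))
    (ε := fun n : ℕ => (x ^ (-a) + x ^ (-b)) * (|C| * (n : ℝ) ^ (-(1 + δ)))) ?_ ?_
  · convert key using 2
    have hpi : (Real.pi : ℂ) ≠ 0 := by exact_mod_cast Real.pi_ne_zero
    rw [mellinInv, mellinInv, ← smul_sub, Complex.real_smul]
    simp only [smul_eq_mul]
    push_cast
    field_simp
  · have := (tendsto_rpow_neg_atTop (by linarith : 0 < 1 + δ)).comp tendsto_natCast_atTop_atTop
      (α := ℕ)
    simpa using (this.const_mul |C|).const_mul (x ^ (-a) + x ^ (-b))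
  · filter_upwards [eventually_ge_atTop 1] with n hn u hu1 hu2
    have hn' : (1 : ℝ) ≤ n := by exact_mod_cast hn
    have hxu : x ^ (-u) ≤ x ^ (-a) + x ^ (-b) := by
      rcases le_total x 1 with h | h
      · have := Real.rpow_le_rpow_of_exponent_ge hx h (by linarith : -b ≤ -u)
        linarith [Real.rpow_pos_of_pos hx (-a)]
      · have := Real.rpow_le_rpow_of_exponent_le h (by linarith : -u ≤ -a)
        linarith [Real.rpow_pos_of_pos hx (-b)]
    have hb : ∀ t : ℝ, |t| = n → ‖(x : ℂ) ^ (-((u : ℂ) + t * Complex.I)) *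
        F (u + t * Complex.I)‖ ≤ (x ^ (-a) + x ^ (-b)) * (|C| * (n : ℝ) ^ (-(1 + δ))) := by
      intro t ht
      rw [norm_mul, norm_cpow_line u t hx]
      have h3 := hC u t hu1 hu2 (by rw [ht]; exact hn')
      rw [ht, show -1 - δ = -(1 + δ) by ring] at h3
      have h4 : C * (n : ℝ) ^ (-(1 + δ)) ≤ |C| * (n : ℝ) ^ (-(1 + δ)) := by
        gcongr; exact le_abs_self C
      have := h3.trans h4
      gcongr
    exact ⟨hb n (by simp), hb (-n) (by simp)⟩

/-- The inverse Mellin transform does not depend on the line to the right of the pole. -/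
lemma mellinInv_eq_of_pos (hF : StripSymbol F r δ) {a b x : ℝ} (ha : 0 < a) (hb : b < 2)
    (hab : a ≤ b) (hx : 0 < x) : mellinInv a F x = mellinInv b F x := by
  have key := hF.tendsto_rectIntegral_cpow_mul (by linarith) hb hab ha.ne' (by linarith) hx
  have hz : ∀ n : ℕ, rectIntegral (fun w => (x : ℂ) ^ (-w) * F w) a b (-(n : ℝ)) n = 0 := by
    intro n
    have hn : (0 : ℝ) ≤ n := n.cast_nonneg
    rw [rectIntegral_eq_sum_residues hab (by linarith) (fun _ => 0) ∅]
    · simp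
    · intro s h1 h2 _ _ _
      refine DifferentiableAt.mul ?_ (hF.differentiableAt (by linarith) (by linarith) ?_)
      · exact (differentiableAt_id.neg).const_cpow (Or.inl (by exact_mod_cast hx.ne'))
      · rintro rfl; simp at h1; linarith
    · simp
  simp only [hz] at key
  have := tendsto_nhds_unique key tendsto_const_nhds
  have h2 : (2 * Real.pi * Complex.I : ℂ) ≠ 0 := by
    simp [Real.pi_ne_zero]
  have := (mul_eq_zero.mp this).resolve_left h2
  exact (sub_eq_zero.mp this).symm

/-- Moving the line of integration to the left of the pole splits off the residue. -/
lemma mellinInv_sub_residue (hF : StripSymbol F r δ) {a b x : ℝ} (ha : -1 < a) (ha0 : a < 0)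
    (hb0 : 0 < b) (hb : b < 2) (hx : 0 < x) : mellinInv b F x - r = mellinInv a F x := by
  have key := hF.tendsto_rectIntegral_cpow_mul ha hb (by linarith) ha0.ne hb0.ne' hx
  have hd : ∀ s, DifferentiableAt ℂ (fun w : ℂ => (x : ℂ) ^ (-w)) s := fun s =>
    (differentiableAt_id.neg).const_cpow (Or.inl (by exact_mod_cast hx.ne'))
  have hz : ∀ᶠ n : ℕ in atTop, rectIntegral (fun w => (x : ℂ) ^ (-w) * F w) a b (-(n : ℝ)) n =
      2 * Real.pi * Complex.I * r := by
    filter_upwards [eventually_ge_atTop 1] with n hn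
    have hn : (1 : ℝ) ≤ n := by exact_mod_cast hn
    rw [rectIntegral_eq_sum_residues (by linarith) (by linarith) (fun _ => r) {0}]
    · simp
    · intro s h1 h2 _ _ hs
      refine (hd s).mul (hF.differentiableAt (by linarith) (by linarith) ?_)
      simpa using hs
    · intro p hp
      rw [Finset.mem_singleton] at hp
      subst hp
      refine ⟨by simpa, by simpa, by simp; linarith, by simp; linarith, ?_⟩
      have h1 : Tendsto (fun w : ℂ => (x : ℂ) ^ (-w)) (𝓝[≠] 0) (𝓝 1) := by
        have := (hd 0).continuousAt.tendsto.mono_left (nhdsWithin_le_nhds (s := {0}ᶜ))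
        simpa using this
      have := h1.mul hF.residue
      rw [one_mul] at this
      refine this.congr fun w => ?_
      rw [sub_zero]; ring
  have h3 := tendsto_nhds_unique (key.congr' hz) tendsto_const_nhds
  have h2 : (2 * Real.pi * Complex.I : ℂ) ≠ 0 := by
    simp [Real.pi_ne_zero]
  have := mul_left_cancel₀ h2 h3
  rw [← this]; ring

end StripSymbol

/-! ### Mellin inversion for admissible functions -/

namespace StripSymbol

variable {F : ℂ → ℂ} {r : ℂ} {δ : ℝ}

lemma mellinInv_eq_mellinInv (hF : StripSymbol F r δ) {a b x : ℝ} (ha : 0 < a) (ha2 : a < 2)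
    (hb : 0 < b) (hb2 : b < 2) (hx : 0 < x) : mellinInv a F x = mellinInv b F x := by
  rcases le_total a b with h | h
  · exact hF.mellinInv_eq_of_pos ha hb2 h hx
  · exact (hF.mellinInv_eq_of_pos hb ha2 h hx).symm

/-- Mellin inversion: `F` is the Mellin transform of its inverse Mellin transform. -/
lemma mellin_mellinInv (hF : StripSymbol F r δ) {c : ℝ} (hc : 0 < c) (hc2 : c < 2) {f : ℝ → ℂ}
    (hf : ∀ x : ℝ, 0 < x → f x = mellinInv c F x) {s : ℂ} (hs : 0 < s.re) (hs2 : s.re < 2) :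
    mellin f s = F s := by
  set σ := s.re with hσ
  set g : ℝ → ℂ := fun y => F (σ + 2 * Real.pi * y * Complex.I) with hg
  have hline := hF.integrable_line (by linarith : -1 < σ) hs2 hs.ne'
  have hg_eq : g = fun y => F (σ + ((2 * Real.pi * y : ℝ) : ℂ) * Complex.I) := by
    ext y; rw [hg]; push_cast; rfl
  have hgi : Integrable g := by
    rw [hg_eq]; exact hline.comp_mul_left' (by positivity : 2 * Real.pi ≠ 0)
  have hgc : Continuous g := by
    rw [hg_eq]
    exact (hF.continuous_line (by linarith : -1 < σ) hs2 hs.ne').comp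
      (continuous_const.mul continuous_id : Continuous fun y : ℝ => 2 * Real.pi * y)
  have hinv : ∀ u : ℝ, Real.exp (-σ * u) • f (Real.exp (-u)) =
      FourierTransformInv.fourierInv g u := by
    intro u
    rw [hf _ (Real.exp_pos _), hF.mellinInv_eq_mellinInv hc hc2 hs hs2 (Real.exp_pos _),
      mellinInv_eq_fourierInv _ _ (Real.exp_pos _), Real.log_exp, neg_neg, ← hg,
      ← smul_assoc]
    convert one_smul ℂ _
    rw [Complex.real_smul, Complex.cpow_def_of_ne_zero (by simp), Complex.ofReal_exp,
      ← Complex.ofReal_log (Real.exp_pos _).le, Real.log_exp,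
      ← Complex.exp_add]
    rw [← Complex.exp_zero]
    congr 1; push_cast; ring
  -- integrability of the Fourier transform, from the bounds on two neighbouring lines
  obtain ⟨η, hη, hη1, hη2⟩ : ∃ η : ℝ, 0 < η ∧ 0 < σ - η ∧ σ + η < 2 := by
    refine ⟨min σ (2 - σ) / 2, by have := lt_min hs (by linarith : 0 < 2 - σ); positivity, ?_, ?_⟩
    · have := min_le_left σ (2 - σ); linarith
    · have := min_le_right σ (2 - σ); linarith
  obtain ⟨M₁, hM₁, h1⟩ := exists_norm_mellinInv_le (F := F) (σ := σ - η)
  obtain ⟨M₂, hM₂, h2⟩ := exists_norm_mellinInv_le (F := F) (σ := σ + η)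
  have hbd : ∀ u : ℝ, ‖FourierTransformInv.fourierInv g u‖ ≤
      (M₁ + M₂) * Real.exp (-(η * |u|)) := by
    intro u
    rw [← hinv u, norm_smul, Real.norm_of_nonneg (Real.exp_pos _).le, hf _ (Real.exp_pos _)]
    have e1 : ∀ κ : ℝ, Real.exp (-u) ^ (-κ) = Real.exp (κ * u) := by
      intro κ; rw [← Real.exp_mul]; ring_nf
    rcases le_total 0 u with hu | hu
    · rw [hF.mellinInv_eq_mellinInv hc hc2 hη1 (by linarith) (Real.exp_pos _)]
      have := h1 _ (Real.exp_pos (-u))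
      rw [e1] at this
      calc Real.exp (-σ * u) * ‖mellinInv (σ - η) F (Real.exp (-u))‖
          ≤ Real.exp (-σ * u) * (M₁ * Real.exp ((σ - η) * u)) := by gcongr
        _ = M₁ * Real.exp (-(η * |u|)) := by
            rw [mul_left_comm, ← Real.exp_add, abs_of_nonneg hu]; ring_nf
        _ ≤ _ := by gcongr; linarith
    · rw [hF.mellinInv_eq_mellinInv hc hc2 (by linarith) hη2 (Real.exp_pos _)]
      have := h2 _ (Real.exp_pos (-u))
      rw [e1] at this
      calc Real.exp (-σ * u) * ‖mellinInv (σ + η) F (Real.exp (-u))‖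
          ≤ Real.exp (-σ * u) * (M₂ * Real.exp ((σ + η) * u)) := by gcongr
        _ = M₂ * Real.exp (-(η * |u|)) := by
            rw [mul_left_comm, ← Real.exp_add, abs_of_nonpos hu]; ring_nf
        _ ≤ _ := by gcongr; linarith
  have hcont : Continuous (FourierTransform.fourier g) :=
    VectorFourier.fourierIntegral_continuous (L := innerₗ ℝ) (μ := volume)
      Real.continuous_fourierChar (e := Real.fourierChar)
      (by exact (continuous_inner (𝕜 := ℝ) (E := ℝ))) hgi
  have hFi : Integrable (FourierTransform.fourier g) := by
    refine ((integrable_exp_neg_mul_abs hη).const_mul (M₁ + M₂)).mono' hcont.aestronglyMeasurable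
      (Eventually.of_forall fun u => ?_)
    have := hbd (-u)
    rwa [Real.fourierInv_eq_fourier_neg, neg_neg, abs_neg] at this
  rw [mellin_eq_fourier, ← hσ]
  rw [show (fun u : ℝ => Real.exp (-σ * u) • f (Real.exp (-u))) = FourierTransformInv.fourierInv g
    from funext hinv, hgi.fourier_fourierInv_eq hFi hgc.continuousAt, hg]
  simp only
  congr 1
  have : (2 * Real.pi : ℂ) ≠ 0 := by simp [Real.pi_ne_zero]
  push_cast
  rw [mul_div_cancel₀ _ this, hσ, Complex.re_add_im]

end StripSymbol

/-- The properties of an inverse Mellin transform `f` of a symbol `F` that enter the argument. -/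
structure IsMellinPair (f : ℝ → ℂ) (F : ℂ → ℂ) (r : ℂ) (δ : ℝ) : Prop extends
    StripSymbol F r δ where
  continuousOn : ContinuousOn f (Set.Ioi 0)
  norm_le : ∀ c : ℝ, 0 < c → c < 2 → ∃ M : ℝ, 0 ≤ M ∧ ∀ x : ℝ, 0 < x → ‖f x‖ ≤ M * x ^ (-c)
  mellin_eq : ∀ s : ℂ, 0 < s.re → s.re < 2 → mellin f s = F s
  sub_residue : ∀ x : ℝ, 0 < x → f x - r = mellinInv (-1 / 2 : ℝ) F x

lemma MellinAdmissible.exists_isMellinPair {f : ℝ → ℂ} (hf : MellinAdmissible f) :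
    ∃ F r δ, IsMellinPair f F r δ := by
  obtain ⟨F, hd, ⟨r, hr⟩, ⟨δ, hδ, hdec⟩, c, hc, hc2, hfc⟩ := hf
  have hF : StripSymbol F r δ := ⟨hd, hr, hδ, hdec⟩
  refine ⟨F, r, δ, hF, ?_, fun b hb hb2 => ?_, fun s hs hs2 => ?_, fun x hx => ?_⟩
  · exact (continuousOn_mellinInv (hF.integrable_line (by linarith) hc2 hc.ne')).congr hfc
  · obtain ⟨M, hM, h⟩ := exists_norm_mellinInv_le (F := F) (σ := b)
    refine ⟨M, hM, fun x hx => ?_⟩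
    rw [hfc x hx, hF.mellinInv_eq_mellinInv hc hc2 hb hb2 hx]
    exact h x hx
  · exact hF.mellin_mellinInv hc hc2 hfc hs hs2
  · rw [hfc x hx]
    exact hF.mellinInv_sub_residue (by norm_num) (by norm_num) hc hc2 hx

namespace IsMellinPair

variable {f : ℝ → ℂ} {F : ℂ → ℂ} {r : ℂ} {δ : ℝ}

lemma mellinConvergent (hf : IsMellinPair f F r δ) {s : ℂ} (hs : 0 < s.re) (hs2 : s.re < 2) :
    MellinConvergent f s := by
  have hO : ∀ {l : Filter ℝ} (_ : ∀ᶠ x in l, (0:ℝ) < x) {c : ℝ} (_ : 0 < c) (_ : c < 2),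
      f =O[l] fun x => x ^ (-c) := by
    intro l hl c hc hc2
    obtain ⟨M, -, h⟩ := hf.norm_le c hc hc2
    refine Asymptotics.IsBigO.of_bound M ?_
    filter_upwards [hl] with x hx
    rw [Real.norm_of_nonneg (by positivity)]; exact h x hx
  exact mellinConvergent_of_isBigO_rpow
    (hf.continuousOn.locallyIntegrableOn measurableSet_Ioi)
    (hO (eventually_gt_atTop 0) (c := (s.re + 2) / 2) (by linarith) (by linarith)) (by linarith)
    (hO self_mem_nhdsWithin (c := s.re / 2) (by linarith) (by linarith)) (by linarith)

lemma hasImproperIntegral (hf : IsMellinPair f F r δ) {s : ℂ} (hs : 0 < s.re) (hs2 : s.re < 2) :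
    HasImproperIntegral (mellinIntegrand f s) (F s) := by
  rw [← hf.mellin_eq s hs hs2]
  exact hasImproperIntegral_of_integrableOn (hf.mellinConvergent hs hs2)

end IsMellinPair

/-! ### Mellin transforms of sine and cosine -/

lemma continuousOn_ofReal_cpow (a : ℂ) : ContinuousOn (fun x : ℝ => (x : ℂ) ^ a) (Set.Ioi 0) :=
  fun x hx => (Complex.continuousAt_ofReal_cpow_const x a (Or.inr (ne_of_gt hx))).continuousWithinAt

lemma integrableOn_rpow_mul_exp_neg {c b : ℝ} (hc : -1 < c) (hb : 0 < b) :
    IntegrableOn (fun x : ℝ => x ^ c * Real.exp (-(b * x))) (Set.Ioi 0) := by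
  have := integrableOn_rpow_mul_exp_neg_mul_rpow hc one_pos hb
  simpa using this

lemma norm_cpow_mul_exp_neg (a r : ℂ) {x : ℝ} (hx : 0 < x) :
    ‖(x : ℂ) ^ a * Complex.exp (-(r * x))‖ = x ^ a.re * Real.exp (-(r.re * x)) := by
  rw [norm_mul, Complex.norm_cpow_eq_rpow_re_of_pos hx, Complex.norm_exp]
  simp

lemma integrableOn_cpow_mul_exp_neg {a r : ℂ} (ha : -1 < a.re) (hr : 0 < r.re) :
    IntegrableOn (fun x : ℝ => (x : ℂ) ^ a * Complex.exp (-(r * x))) (Set.Ioi 0) := by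
  refine (integrableOn_rpow_mul_exp_neg ha hr).mono' ?_ ?_
  · exact ((continuousOn_ofReal_cpow a).mul (by fun_prop)).aestronglyMeasurable measurableSet_Ioi
  · filter_upwards [ae_restrict_mem measurableSet_Ioi] with x hx
    exact (norm_cpow_mul_exp_neg a r hx).le

/-- Euler's integral with a complex rate `r`, by analytic continuation in `r`. -/
lemma integral_cpow_mul_exp_neg_complex {a r : ℂ} (ha : 0 < a.re) (hr : 0 < r.re) :
    ∫ x in Set.Ioi (0 : ℝ), (x : ℂ) ^ (a - 1) * Complex.exp (-(r * x)) =
      r ^ (-a) * Complex.Gamma a := by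
  set U : Set ℂ := {z | 0 < z.re} with hU
  have hUo : IsOpen U := isOpen_lt continuous_const Complex.continuous_re
  set N : ℂ → ℂ := fun z => ∫ x in Set.Ioi (0 : ℝ), (x : ℂ) ^ (a - 1) * Complex.exp (-(z * x))
    with hN
  have ha1 : -1 < (a - 1).re := by simp; linarith
  have hNd : DifferentiableOn ℂ N U := by
    intro z hz
    have hz' : 0 < z.re := hz
    have := hasDerivAt_integral_of_dominated_loc_of_deriv_le (𝕜 := ℂ)
      (μ := volume.restrict (Set.Ioi (0 : ℝ)))
      (F := fun (z : ℂ) (x : ℝ) => (x : ℂ) ^ (a - 1) * Complex.exp (-(z * x)))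
      (F' := fun (z : ℂ) (x : ℝ) => (x : ℂ) ^ (a - 1) * (Complex.exp (-(z * x)) * (-(1 * x))))
      (x₀ := z) (s := ball z (z.re / 2))
      (bound := fun x => x ^ a.re * Real.exp (-(z.re / 2 * x)))
      (ball_mem_nhds z (by linarith)) ?_ (integrableOn_cpow_mul_exp_neg ha1 hz') ?_ ?_
      (integrableOn_rpow_mul_exp_neg (by linarith) (by linarith)) ?_
    · exact this.2.differentiableAt.differentiableWithinAt
    · refine Eventually.of_forall fun z => ?_
      exact ((continuousOn_ofReal_cpow _).mul (by fun_prop)).aestronglyMeasurable measurableSet_Ioi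
    · exact ((continuousOn_ofReal_cpow _).mul (by fun_prop)).aestronglyMeasurable measurableSet_Ioi
    · filter_upwards [ae_restrict_mem measurableSet_Ioi] with x hx y hy
      have hx0 : 0 < x := hx
      have hy2 : z.re / 2 ≤ y.re := by
        have h1 := (Complex.abs_re_le_norm (y - z)).trans (mem_ball_iff_norm.mp hy).le
        rw [Complex.sub_re] at h1
        have := (abs_le.mp h1).1
        linarith
      rw [← mul_assoc, norm_mul, norm_cpow_mul_exp_neg _ _ hx0, one_mul, norm_neg,
        Complex.norm_real, Real.norm_of_nonneg hx0.le, Complex.sub_re, Complex.one_re,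
        mul_right_comm, ← Real.rpow_add_one hx0.ne', sub_add_cancel]
      gcongr
    · refine Eventually.of_forall fun x y _ => ?_
      exact (((hasDerivAt_id y).mul_const (x : ℂ)).neg.cexp).const_mul _
  have hRd : DifferentiableOn ℂ (fun z : ℂ => z ^ (-a) * Complex.Gamma a) U := by
    intro z hz
    exact ((differentiableAt_id.cpow (differentiableAt_const _) (Or.inl hz)).mul_const
      _).differentiableWithinAt
  have hconn : IsPreconnected U := (convex_halfSpace_re_gt 0).isPreconnected
  refine (hNd.analyticOnNhd hUo).eqOn_of_preconnected_of_frequently_eq (hRd.analyticOnNhd hUo)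
    hconn (z₀ := 1) (by simp [hU]) ?_ hr
  -- the two sides agree on the positive reals, which accumulate at `1`
  have hseq : Tendsto (fun n : ℕ => ((1 + 1 / ((n : ℝ) + 1) : ℝ) : ℂ)) atTop (𝓝[≠] 1) := by
    refine tendsto_nhdsWithin_iff.mpr ⟨?_, Eventually.of_forall fun n => ?_⟩
    · have h1 := (tendsto_one_div_add_atTop_nhds_zero_nat (𝕜 := ℝ)).const_add 1
      rw [add_zero] at h1
      have := (Complex.continuous_ofReal.tendsto 1).comp h1
      rw [Complex.ofReal_one] at this
      exact this
    · have : (0 : ℝ) < 1 / ((n : ℝ) + 1) := by positivity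
      simp only [Set.mem_compl_iff, Set.mem_singleton_iff]
      rw [← Complex.ofReal_one, Complex.ofReal_inj]
      linarith
  refine hseq.frequently (Eventually.frequently (Eventually.of_forall fun n => ?_))
  have hp : 0 < 1 + 1 / ((n : ℝ) + 1) := by positivity
  set t : ℝ := 1 + 1 / ((n : ℝ) + 1)
  have := Complex.integral_cpow_mul_exp_neg_mul_Ioi ha hp
  simp only [hN]
  rw [this, one_div, Complex.inv_cpow _ _ (by
    rw [Complex.arg_ofReal_of_nonneg hp.le]; exact Real.pi_pos.ne), ← Complex.cpow_neg]

lemma norm_exp_sub_one_le_two_mul_min {z : ℂ} (hz : z.re ≤ 0) :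
    ‖Complex.exp z - 1‖ ≤ 2 * min 1 ‖z‖ := by
  have h2 : ‖Complex.exp z - 1‖ ≤ 2 := by
    refine (norm_sub_le _ _).trans ?_
    rw [Complex.norm_exp, norm_one]
    have := Real.exp_le_one_iff.mpr hz
    linarith
  rcases le_total ‖z‖ 1 with h | h
  · rw [min_eq_right h]; exact Complex.norm_exp_sub_one_le h
  · rw [min_eq_left h, mul_one]; exact h2

lemma integrableOn_rpow_mul_min {c : ℝ} (hc : -2 < c) (hc2 : c < -1) :
    IntegrableOn (fun x : ℝ => x ^ c * min 1 x) (Set.Ioi 0) := by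
  rw [← Set.Ioc_union_Ioi_eq_Ioi zero_le_one]
  refine IntegrableOn.union ?_ ?_
  · have : IntegrableOn (fun x : ℝ => x ^ (c + 1)) (Set.Ioc 0 1) :=
      (intervalIntegral.intervalIntegrable_rpow' (by linarith)).1
    refine this.congr_fun (fun x hx => ?_) measurableSet_Ioc
    simp only
    rw [min_eq_right hx.2, Real.rpow_add_one hx.1.ne']
  · refine (integrableOn_Ioi_rpow_of_lt hc2 one_pos).congr_fun (fun x hx => ?_) measurableSet_Ioi
    simp only
    rw [min_eq_left (le_of_lt hx), mul_one]

lemma norm_cpow_mul_exp_sub_one_le {w r : ℂ} (hr : 0 ≤ r.re) (hr2 : ‖r‖ ≤ 2) {x : ℝ} (hx : 0 < x) :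
    ‖(x : ℂ) ^ (w - 1) * (Complex.exp (-(r * x)) - 1)‖ ≤ 4 * (x ^ (w.re - 1) * min 1 x) := by
  have h := norm_exp_sub_one_le_two_mul_min (z := -(r * x)) (by simp; positivity)
  have h2 : min 1 ‖-(r * x)‖ ≤ 2 * min 1 x := by
    rw [norm_neg, norm_mul, Complex.norm_real, Real.norm_of_nonneg hx.le]
    rcases le_total x 1 with h1 | h1
    · rw [min_eq_right h1]
      exact (min_le_right _ _).trans (by gcongr)
    · rw [min_eq_left h1]; exact (min_le_left _ _).trans (by norm_num)
  rw [norm_mul, Complex.norm_cpow_eq_rpow_re_of_pos hx, Complex.sub_re, Complex.one_re]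
  calc x ^ (w.re - 1) * ‖Complex.exp (-(r * x)) - 1‖ ≤ x ^ (w.re - 1) * (2 * (2 * min 1 x)) := by
        gcongr; exact h.trans (by gcongr)
    _ = _ := by ring

lemma integrableOn_cpow_mul_exp_sub_one {w r : ℂ} (hw : -1 < w.re) (hw0 : w.re < 0)
    (hr : 0 ≤ r.re) (hr2 : ‖r‖ ≤ 2) :
    IntegrableOn (fun x : ℝ => (x : ℂ) ^ (w - 1) * (Complex.exp (-(r * x)) - 1)) (Set.Ioi 0) := by
  refine ((integrableOn_rpow_mul_min (c := w.re - 1) (by linarith) (by linarith)).const_mul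
    4).mono' ?_ ?_
  · exact ((continuousOn_ofReal_cpow _).mul (by fun_prop)).aestronglyMeasurable measurableSet_Ioi
  · filter_upwards [ae_restrict_mem measurableSet_Ioi] with x hx
    exact norm_cpow_mul_exp_sub_one_le hr hr2 hx

lemma integral_cpow_mul_exp_sub_one_of_re_pos {w r : ℂ} (hw : -1 < w.re) (hw0 : w.re < 0)
    (hr : 0 < r.re) (hr2 : ‖r‖ ≤ 2) :
    ∫ x in Set.Ioi (0 : ℝ), (x : ℂ) ^ (w - 1) * (Complex.exp (-(r * x)) - 1) =
      r ^ (-w) * Complex.Gamma w := by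
  have hwne : w ≠ 0 := by rintro rfl; simp at hw0
  have hrne : r ≠ 0 := by rintro rfl; simp at hr
  have hd1 : ∀ x ∈ Set.Ioi (0 : ℝ), HasDerivAt (fun x : ℝ => Complex.exp (-(r * x)) - 1)
      (-r * Complex.exp (-(r * x))) x := by
    intro x _
    have h := (((Complex.ofRealCLM.hasDerivAt (x := x)).const_mul r).neg.cexp).sub_const 1
    refine h.congr_deriv ?_
    simp; ring
  have hd2 : ∀ x ∈ Set.Ioi (0 : ℝ), HasDerivAt (fun x : ℝ => (x : ℂ) ^ w / w)
      ((x : ℂ) ^ (w - 1)) x := by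
    intro x hx
    refine ((hasDerivAt_ofReal_cpow_const (ne_of_gt hx) hwne).div_const w).congr_deriv ?_
    field_simp
  have hbd : ∀ x : ℝ, 0 < x → ‖(Complex.exp (-(r * x)) - 1) * ((x : ℂ) ^ w / w)‖ ≤
      4 / ‖w‖ * (x ^ w.re * min 1 x) := by
    intro x hx
    have := norm_cpow_mul_exp_sub_one_le (w := w + 1) hr.le hr2 hx
    rw [add_sub_cancel_right, Complex.add_re, Complex.one_re, add_sub_cancel_right] at this
    rw [← mul_div_assoc, norm_div, div_mul_eq_mul_div, mul_comm (Complex.exp _ - 1)]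
    gcongr
  have key := integral_Ioi_mul_deriv_eq_deriv_mul (a := 0) (a' := (0 : ℂ)) (b' := 0) hd1 hd2
    ?_ ?_ ?_ ?_
  · have e1 : ∫ x in Set.Ioi (0 : ℝ), (x : ℂ) ^ (w - 1) * (Complex.exp (-(r * x)) - 1) =
        ∫ x in Set.Ioi (0 : ℝ), (Complex.exp (-(r * x)) - 1) * (x : ℂ) ^ (w - 1) := by
      simp only [mul_comm]
    have e2 : ∀ x : ℝ, -r * Complex.exp (-(r * x)) * ((x : ℂ) ^ w / w) =
        -(r / w) * ((x : ℂ) ^ (w + 1 - 1) * Complex.exp (-(r * x))) := by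
      intro x; rw [add_sub_cancel_right]; ring
    rw [e1, key]
    simp only [e2]
    rw [integral_const_mul, integral_cpow_mul_exp_neg_complex (by simp; linarith) hr,
      Complex.Gamma_add_one w hwne, neg_add, Complex.cpow_add _ _ hrne, Complex.cpow_neg_one]
    field_simp
    ring
  · refine (integrableOn_cpow_mul_exp_sub_one hw hw0 hr.le hr2).congr_fun (fun x _ => ?_)
      measurableSet_Ioi
    exact mul_comm _ _
  · refine IntegrableOn.congr_fun ((integrableOn_cpow_mul_exp_neg hw hr).const_mul (-(r / w)))
      (fun x _ => ?_) measurableSet_Ioi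
    simp only [Pi.mul_apply]; ring
  · have hlim : Tendsto (fun x : ℝ => 4 / ‖w‖ * x ^ (w.re + 1)) (𝓝[>] 0) (𝓝 0) := by
      have h : ContinuousAt (fun x : ℝ => 4 / ‖w‖ * x ^ (w.re + 1)) 0 :=
        continuousAt_const.mul (Real.continuousAt_rpow_const _ _ (Or.inr (by linarith)))
      have := h.tendsto.mono_left (nhdsWithin_le_nhds (s := Set.Ioi 0))
      simpa [Real.zero_rpow (by linarith : w.re + 1 ≠ 0)] using this
    refine squeeze_zero_norm' ?_ hlim
    filter_upwards [self_mem_nhdsWithin] with x hx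
    have hx : 0 < x := hx
    refine (hbd x hx).trans ?_
    rw [Real.rpow_add_one hx.ne']
    gcongr; exact min_le_right _ _
  · have hlim : Tendsto (fun x : ℝ => 4 / ‖w‖ * x ^ w.re) atTop (𝓝 0) := by
      have := (tendsto_rpow_neg_atTop (by linarith : 0 < -w.re)).const_mul (4 / ‖w‖)
      simpa using this
    refine squeeze_zero_norm' ?_ hlim
    filter_upwards [eventually_gt_atTop 0] with x hx
    refine (hbd x hx).trans ?_
    have : min 1 x ≤ 1 := min_le_left _ _
    have h0 : 0 ≤ x ^ w.re := by positivity
    gcongr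
    nlinarith

/-- The formula extends to rates on the imaginary axis, by dominated convergence. -/
lemma integral_cpow_mul_exp_sub_one {w r : ℂ} (hw : -1 < w.re) (hw0 : w.re < 0)
    (hr : 0 ≤ r.re) (hr0 : r ∈ Complex.slitPlane) (hr2 : ‖r‖ ≤ 1) :
    ∫ x in Set.Ioi (0 : ℝ), (x : ℂ) ^ (w - 1) * (Complex.exp (-(r * x)) - 1) =
      r ^ (-w) * Complex.Gamma w := by
  set ε : ℕ → ℝ := fun n => 1 / ((n : ℝ) + 1) with hε
  have hε0 : ∀ n, 0 < ε n := fun n => by simp only [hε]; positivity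
  have hε1 : ∀ n, ε n ≤ 1 := fun n => by
    simp only [hε]
    rw [div_le_one (by positivity)]
    linarith [n.cast_nonneg (α := ℝ)]
  have hlim : Tendsto (fun n => r + (ε n : ℂ)) atTop (𝓝 r) := by
    have h1 := (Complex.continuous_ofReal.tendsto 0).comp
      (tendsto_one_div_add_atTop_nhds_zero_nat (𝕜 := ℝ))
    have h2 := h1.const_add r
    rw [Complex.ofReal_zero, add_zero] at h2
    exact h2
  have hre : ∀ n, 0 < (r + (ε n : ℂ)).re := fun n => by
    have := hε0 n
    simp; linarith
  have hnorm : ∀ n, ‖r + (ε n : ℂ)‖ ≤ 2 := fun n => by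
    refine (norm_add_le _ _).trans ?_
    rw [Complex.norm_real, Real.norm_of_nonneg (hε0 n).le]
    linarith [hε1 n]
  have h1 : Tendsto (fun n => ∫ x in Set.Ioi (0 : ℝ),
      (x : ℂ) ^ (w - 1) * (Complex.exp (-((r + (ε n : ℂ)) * x)) - 1)) atTop
      (𝓝 (∫ x in Set.Ioi (0 : ℝ), (x : ℂ) ^ (w - 1) * (Complex.exp (-(r * x)) - 1))) := by
    refine tendsto_integral_of_dominated_convergence (fun x => 4 * (x ^ (w.re - 1) * min 1 x))
      (fun n => ?_) ((integrableOn_rpow_mul_min (c := w.re - 1) (by linarith)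
        (by linarith)).const_mul 4) (fun n => ?_) (Eventually.of_forall fun x => ?_)
    · exact (integrableOn_cpow_mul_exp_sub_one hw hw0 (hre n).le (hnorm n)).aestronglyMeasurable
    · filter_upwards [ae_restrict_mem measurableSet_Ioi] with x hx
      exact norm_cpow_mul_exp_sub_one_le (hre n).le (hnorm n) hx
    · have hc : Continuous fun z : ℂ => (x : ℂ) ^ (w - 1) * (Complex.exp (-(z * x)) - 1) := by
        fun_prop
      exact (hc.tendsto r).comp hlim
  have h2 : Tendsto (fun n => (r + (ε n : ℂ)) ^ (-w) * Complex.Gamma w) atTop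
      (𝓝 (r ^ (-w) * Complex.Gamma w)) :=
    (((continuousAt_id.cpow continuousAt_const hr0).tendsto).comp hlim).mul_const _
  refine tendsto_nhds_unique h1 (h2.congr fun n => ?_)
  exact (integral_cpow_mul_exp_sub_one_of_re_pos hw hw0 (hre n) (hnorm n)).symm

lemma I_cpow (w : ℂ) : Complex.I ^ w = Complex.exp (Real.pi * w / 2 * Complex.I) := by
  rw [Complex.cpow_def_of_ne_zero Complex.I_ne_zero, Complex.log_I]; ring_nf

lemma neg_I_cpow (w : ℂ) : (-Complex.I) ^ w = Complex.exp (-(Real.pi * w / 2) * Complex.I) := by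
  rw [Complex.cpow_def_of_ne_zero (by simp), Complex.log_neg_I]; ring_nf

lemma cos_sub_one_eq (x : ℝ) : ((Real.cos x : ℝ) : ℂ) - 1 =
    1 / 2 * (Complex.exp (-(-Complex.I * x)) - 1) + 1 / 2 * (Complex.exp (-(Complex.I * x)) - 1) := by
  rw [Complex.ofReal_cos, Complex.cos]
  ring_nf

lemma sin_eq_exp_sub_one (x : ℝ) : ((Real.sin x : ℝ) : ℂ) =
    -Complex.I / 2 * (Complex.exp (-(-Complex.I * x)) - 1) +
      Complex.I / 2 * (Complex.exp (-(Complex.I * x)) - 1) := by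
  rw [Complex.ofReal_sin, Complex.sin]
  ring_nf

lemma integrableOn_cpow_mul_exp_I_sub_one {w : ℂ} (hw : -1 < w.re) (hw0 : w.re < 0) :
    IntegrableOn (fun x : ℝ => (x : ℂ) ^ (w - 1) * (Complex.exp (-(-Complex.I * x)) - 1))
      (Set.Ioi 0) ∧
    IntegrableOn (fun x : ℝ => (x : ℂ) ^ (w - 1) * (Complex.exp (-(Complex.I * x)) - 1))
      (Set.Ioi 0) :=
  ⟨integrableOn_cpow_mul_exp_sub_one hw hw0 (by simp) (by simp),
    integrableOn_cpow_mul_exp_sub_one hw hw0 (by simp) (by simp)⟩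

lemma integral_cpow_mul_exp_I_sub_one {w : ℂ} (hw : -1 < w.re) (hw0 : w.re < 0) :
    ∫ x in Set.Ioi (0 : ℝ), (x : ℂ) ^ (w - 1) * (Complex.exp (-(-Complex.I * x)) - 1) =
      Complex.exp (Real.pi * w / 2 * Complex.I) * Complex.Gamma w ∧
    ∫ x in Set.Ioi (0 : ℝ), (x : ℂ) ^ (w - 1) * (Complex.exp (-(Complex.I * x)) - 1) =
      Complex.exp (-(Real.pi * w / 2) * Complex.I) * Complex.Gamma w := by
  constructor
  · rw [integral_cpow_mul_exp_sub_one hw hw0 (by simp)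
      (by simp [Complex.mem_slitPlane_iff]) (by simp), neg_I_cpow]
    ring_nf
  · rw [integral_cpow_mul_exp_sub_one hw hw0 (by simp)
      (by simp [Complex.mem_slitPlane_iff]) (by simp), I_cpow]
    ring_nf

/-- The Mellin transform of `cos x - 1`. -/
lemma hasMellin_cos_sub_one {w : ℂ} (hw : -1 < w.re) (hw0 : w.re < 0) :
    HasMellin (fun x : ℝ => ((Real.cos x : ℝ) : ℂ) - 1) w
      (Complex.Gamma w * Complex.cos (Real.pi * w / 2)) := by
  obtain ⟨h1, h2⟩ := integrableOn_cpow_mul_exp_I_sub_one hw hw0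
  obtain ⟨e1, e2⟩ := integral_cpow_mul_exp_I_sub_one hw hw0
  have e : (fun x : ℝ => (x : ℂ) ^ (w - 1) • (((Real.cos x : ℝ) : ℂ) - 1)) = fun x : ℝ =>
      1 / 2 * ((x : ℂ) ^ (w - 1) * (Complex.exp (-(-Complex.I * x)) - 1)) +
      1 / 2 * ((x : ℂ) ^ (w - 1) * (Complex.exp (-(Complex.I * x)) - 1)) := by
    ext x; rw [cos_sub_one_eq, smul_eq_mul]; ring
  refine ⟨?_, ?_⟩
  · rw [MellinConvergent, e]; exact (h1.const_mul _).add (h2.const_mul _)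
  · rw [mellin, e, integral_add (h1.const_mul _) (h2.const_mul _), integral_const_mul,
      integral_const_mul, e1, e2, Complex.cos]
    ring

/-- The Mellin transform of `sin x`. -/
lemma hasMellin_sin {w : ℂ} (hw : -1 < w.re) (hw0 : w.re < 0) :
    HasMellin (fun x : ℝ => ((Real.sin x : ℝ) : ℂ)) w
      (Complex.Gamma w * Complex.sin (Real.pi * w / 2)) := by
  obtain ⟨h1, h2⟩ := integrableOn_cpow_mul_exp_I_sub_one hw hw0
  obtain ⟨e1, e2⟩ := integral_cpow_mul_exp_I_sub_one hw hw0
  have e : (fun x : ℝ => (x : ℂ) ^ (w - 1) • ((Real.sin x : ℝ) : ℂ)) = fun x : ℝ =>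
      -Complex.I / 2 * ((x : ℂ) ^ (w - 1) * (Complex.exp (-(-Complex.I * x)) - 1)) +
      Complex.I / 2 * ((x : ℂ) ^ (w - 1) * (Complex.exp (-(Complex.I * x)) - 1)) := by
    ext x; rw [sin_eq_exp_sub_one, smul_eq_mul]; ring
  refine ⟨?_, ?_⟩
  · rw [MellinConvergent, e]; exact (h1.const_mul _).add (h2.const_mul _)
  · rw [mellin, e, integral_add (h1.const_mul _) (h2.const_mul _), integral_const_mul,
      integral_const_mul, e1, e2, Complex.sin]
    ring

/-! ### The Mellin transform of a cosine transform -/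

lemma integral_cpow_mul_cos_eq (s : ℂ) (hs : s ≠ 1) {a b : ℝ} (ha : 0 < a) (hab : a ≤ b) :
    ∫ x in a..b, (x : ℂ) ^ (s - 1) * ((Real.cos x : ℝ) : ℂ) =
      (b : ℂ) ^ (s - 1) * ((Real.sin b : ℝ) : ℂ) - (a : ℂ) ^ (s - 1) * ((Real.sin a : ℝ) : ℂ) -
        (s - 1) * ∫ x in a..b, (x : ℂ) ^ (s - 1 - 1) * ((Real.sin x : ℝ) : ℂ) := by
  have hpos : ∀ x ∈ Set.uIcc a b, x ∈ Set.Ioi 0 := fun x hx => by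
    rw [Set.uIcc_of_le hab] at hx; exact ha.trans_le hx.1
  have h := intervalIntegral.integral_mul_deriv_eq_deriv_mul (a := a) (b := b)
    (u := fun x : ℝ => (x : ℂ) ^ (s - 1)) (v := fun x : ℝ => ((Real.sin x : ℝ) : ℂ))
    (u' := fun x : ℝ => (s - 1) * (x : ℂ) ^ (s - 1 - 1)) (v' := fun x : ℝ => ((Real.cos x : ℝ) : ℂ))
    (fun x hx => hasDerivAt_ofReal_cpow_const (ne_of_gt (hpos x hx)) (sub_ne_zero.mpr hs))
    (fun x _ => (Real.hasDerivAt_sin x).ofReal_comp)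
    ((continuousOn_const.mul ((continuousOn_ofReal_cpow _).mono hpos)).intervalIntegrable)
    (Continuous.intervalIntegrable (by fun_prop) _ _)
  rw [h]
  congr 1
  rw [← intervalIntegral.integral_const_mul]
  refine intervalIntegral.integral_congr fun x _ => ?_
  ring

lemma norm_cpow_mul_sin_le_one {s : ℂ} (hs : 0 < s.re) (hs1 : s.re < 1) {x : ℝ} (hx : 0 < x) :
    ‖(x : ℂ) ^ (s - 1) * ((Real.sin x : ℝ) : ℂ)‖ ≤ 1 := by
  rw [norm_mul, Complex.norm_cpow_eq_rpow_re_of_pos hx, Complex.norm_real, Complex.sub_re,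
    Complex.one_re]
  have h0 : 0 ≤ x ^ (s.re - 1) := by positivity
  rcases le_total x 1 with h | h
  · have h1 : ‖Real.sin x‖ ≤ x := by
      rw [Real.norm_eq_abs, abs_of_nonneg (Real.sin_nonneg_of_nonneg_of_le_pi hx.le
        (h.trans (by linarith [Real.pi_gt_three])))]
      exact Real.sin_le hx.le
    calc x ^ (s.re - 1) * ‖Real.sin x‖ ≤ x ^ (s.re - 1) * x := by gcongr
      _ = x ^ s.re := by rw [← Real.rpow_add_one hx.ne', sub_add_cancel]
      _ ≤ 1 := Real.rpow_le_one hx.le h hs.le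
  · calc x ^ (s.re - 1) * ‖Real.sin x‖ ≤ 1 * 1 := by
          gcongr
          · exact Real.rpow_le_one_of_one_le_of_nonpos h (by linarith)
          · exact Real.abs_sin_le_one x
      _ = 1 := one_mul 1

/-- The truncated integrals `∫ x ^ (s - 1) cos x` are uniformly bounded. -/
lemma exists_norm_integral_cpow_mul_cos_le {s : ℂ} (hs : 0 < s.re) (hs1 : s.re < 1) :
    ∃ B : ℝ, 0 ≤ B ∧ ∀ a b : ℝ, 0 < a → a ≤ b →
      ‖∫ x in a..b, (x : ℂ) ^ (s - 1) * ((Real.cos x : ℝ) : ℂ)‖ ≤ B := by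
  have hint : IntegrableOn (fun x : ℝ => (x : ℂ) ^ (s - 1 - 1) * ((Real.sin x : ℝ) : ℂ))
      (Set.Ioi 0) := (hasMellin_sin (w := s - 1) (by simpa using hs) (by simpa using hs1)).1
  have hne : s ≠ 1 := by rintro rfl; simp at hs1
  refine ⟨1 + 1 + ‖s - 1‖ * ∫ x in Set.Ioi (0 : ℝ), ‖(x : ℂ) ^ (s - 1 - 1) *
    ((Real.sin x : ℝ) : ℂ)‖, ?_, fun a b ha hab => ?_⟩
  · have : 0 ≤ ∫ x in Set.Ioi (0 : ℝ), ‖(x : ℂ) ^ (s - 1 - 1) * ((Real.sin x : ℝ) : ℂ)‖ :=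
      integral_nonneg fun _ => norm_nonneg _
    positivity
  · rw [integral_cpow_mul_cos_eq s hne ha hab]
    refine (norm_sub_le _ _).trans (add_le_add ((norm_sub_le _ _).trans (add_le_add
      (norm_cpow_mul_sin_le_one hs hs1 (ha.trans_le hab)) (norm_cpow_mul_sin_le_one hs hs1 ha))) ?_)
    rw [norm_mul]
    gcongr
    rw [intervalIntegral.integral_of_le hab]
    refine (norm_integral_le_integral_norm _).trans ?_
    exact setIntegral_mono_set hint.norm (Eventually.of_forall fun _ => norm_nonneg _)
      (Eventually.of_forall fun x hx => ha.trans hx.1)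

/-- The conditionally convergent Mellin transform of `cos x`. -/
lemma tendsto_integral_cpow_mul_cos {s : ℂ} (hs : 0 < s.re) (hs1 : s.re < 1) :
    Tendsto (fun p : ℝ × ℝ => ∫ x in p.1..p.2, (x : ℂ) ^ (s - 1) * ((Real.cos x : ℝ) : ℂ))
      (𝓝[>] 0 ×ˢ atTop) (𝓝 (Complex.Gamma s * Complex.cos (Real.pi * s / 2))) := by
  have hM := hasMellin_sin (w := s - 1) (by simpa using hs) (by simpa using hs1)
  have hint : IntegrableOn (fun x : ℝ => (x : ℂ) ^ (s - 1 - 1) * ((Real.sin x : ℝ) : ℂ))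
      (Set.Ioi 0) := hM.1
  have hval : ∫ x in Set.Ioi (0 : ℝ), (x : ℂ) ^ (s - 1 - 1) * ((Real.sin x : ℝ) : ℂ) =
      Complex.Gamma (s - 1) * Complex.sin (Real.pi * (s - 1) / 2) := hM.2
  have hne : s ≠ 1 := by rintro rfl; simp at hs1
  have h1 := (hasImproperIntegral_of_integrableOn hint).2
  have hb : Tendsto (fun b : ℝ => (b : ℂ) ^ (s - 1) * ((Real.sin b : ℝ) : ℂ)) atTop (𝓝 0) := by
    refine squeeze_zero_norm' ?_ (tendsto_rpow_neg_atTop (by linarith : 0 < 1 - s.re))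
    filter_upwards [eventually_gt_atTop 0] with x hx
    rw [norm_mul, Complex.norm_cpow_eq_rpow_re_of_pos hx, Complex.norm_real, Complex.sub_re,
      Complex.one_re, neg_sub]
    exact mul_le_of_le_one_right (by positivity) (Real.abs_sin_le_one x)
  have ha : Tendsto (fun b : ℝ => (b : ℂ) ^ (s - 1) * ((Real.sin b : ℝ) : ℂ)) (𝓝[>] 0) (𝓝 0) := by
    have hlim : Tendsto (fun x : ℝ => x ^ s.re) (𝓝[>] 0) (𝓝 0) := by
      have := (Real.continuousAt_rpow_const (0 : ℝ) s.re (Or.inr hs.le)).tendsto.mono_left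
        (nhdsWithin_le_nhds (s := Set.Ioi 0))
      rwa [Real.zero_rpow hs.ne'] at this
    refine squeeze_zero_norm' ?_ hlim
    filter_upwards [self_mem_nhdsWithin] with x hx
    have hx : 0 < x := hx
    rw [norm_mul, Complex.norm_cpow_eq_rpow_re_of_pos hx, Complex.norm_real, Complex.sub_re,
      Complex.one_re]
    calc x ^ (s.re - 1) * ‖Real.sin x‖ ≤ x ^ (s.re - 1) * x := by
          gcongr
          exact (Real.abs_sin_le_abs (x := x)).trans_eq (abs_of_pos hx)
      _ = x ^ s.re := by rw [← Real.rpow_add_one hx.ne', sub_add_cancel]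
  have h2 := ((hb.comp tendsto_snd).sub (ha.comp tendsto_fst)).sub (h1.const_mul (s - 1))
  have hev := eventually_pos_and_le
  have h3 := h2.congr' (f₂ := fun p : ℝ × ℝ =>
    ∫ x in p.1..p.2, (x : ℂ) ^ (s - 1) * ((Real.cos x : ℝ) : ℂ)) (by
      filter_upwards [hev] with p hp
      exact (integral_cpow_mul_cos_eq s hne hp.1 hp.2).symm)
  convert h3 using 2
  rw [hval, show (Real.pi : ℂ) * (s - 1) / 2 = Real.pi * s / 2 - Real.pi / 2 by ring,
    Complex.sin_sub_pi_div_two]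
  have := Complex.Gamma_add_one (s - 1) (sub_ne_zero.mpr hne)
  rw [sub_add_cancel] at this
  rw [this]; ring

lemma integral_cpow_mul_cos_comp_mul (s : ℂ) {c a b : ℝ} (hc : 0 < c) (ha : 0 < a) (hab : a ≤ b) :
    ∫ x in a..b, (x : ℂ) ^ (s - 1) * ((Real.cos (c * x) : ℝ) : ℂ) =
      (c : ℂ) ^ (-s) * ∫ x in (c * a)..(c * b), (x : ℂ) ^ (s - 1) * ((Real.cos x : ℝ) : ℂ) := by
  have h := intervalIntegral.integral_comp_mul_left (a := a) (b := b)
    (fun x : ℝ => (x : ℂ) ^ (s - 1) * ((Real.cos x : ℝ) : ℂ)) hc.ne'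
  have e : ∫ x in a..b, ((c * x : ℝ) : ℂ) ^ (s - 1) * ((Real.cos (c * x) : ℝ) : ℂ) =
      (c : ℂ) ^ (s - 1) * ∫ x in a..b, (x : ℂ) ^ (s - 1) * ((Real.cos (c * x) : ℝ) : ℂ) := by
    rw [← intervalIntegral.integral_const_mul]
    refine intervalIntegral.integral_congr fun x hx => ?_
    rw [Set.uIcc_of_le hab] at hx
    rw [Complex.ofReal_mul, Complex.mul_cpow_ofReal_nonneg hc.le (ha.trans_le hx.1).le, mul_assoc]
  rw [e, Complex.real_smul] at h
  have hc' : (c : ℂ) ≠ 0 := by exact_mod_cast hc.ne'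
  have h4 : (c : ℂ) ^ (s - 1) ≠ 0 := by simp [Complex.cpow_eq_zero_iff, hc']
  have h5 : (c : ℂ) ^ (-s) * (c : ℂ) ^ (s - 1) = ((c⁻¹ : ℝ) : ℂ) := by
    rw [← Complex.cpow_add _ _ hc', show -s + (s - 1) = -1 by ring, Complex.cpow_neg_one,
      Complex.ofReal_inv]
  apply mul_left_cancel₀ h4
  rw [h, ← mul_assoc, mul_comm ((c : ℂ) ^ (s - 1)), h5]

lemma HasImproperIntegral.unique {f : ℝ → ℂ} {I J : ℂ} (hI : HasImproperIntegral f I)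
    (hJ : HasImproperIntegral f J) : I = J :=
  tendsto_nhds_unique hI.2 hJ.2

/-- The symbol of the cosine transform of the inverse Mellin transform of `F`. -/
noncomputable def cosineSymbol (F : ℂ → ℂ) (s : ℂ) : ℂ :=
  ((2 / Real.sqrt Real.pi : ℝ) : ℂ) * ((2 : ℂ) ^ (-s) * (Complex.Gamma s *
    Complex.cos (Real.pi * s / 2)) * F (1 - s))

namespace IsMellinPair

variable {f g : ℝ → ℂ} {F : ℂ → ℂ} {r : ℂ} {δ : ℝ}

lemma integrableOn_cpow_mul (hf : IsMellinPair f F r δ) {w : ℂ} (h1 : -1 < w.re) (h2 : w.re < 1) :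
    IntegrableOn (fun u : ℝ => (u : ℂ) ^ (-w) * f u) (Set.Ioi 0) := by
  have := hf.mellinConvergent (s := 1 - w) (by simp; linarith) (by simp; linarith)
  rwa [MellinConvergent, show (1 : ℂ) - w - 1 = -w by ring] at this

lemma integral_cpow_mul (hf : IsMellinPair f F r δ) {w : ℂ} (h1 : -1 < w.re) (h2 : w.re < 1) :
    ∫ u in Set.Ioi (0 : ℝ), (u : ℂ) ^ (-w) * f u = F (1 - w) := by
  rw [← hf.mellin_eq (1 - w) (by simp; linarith) (by simp; linarith), mellin,
    show (1 : ℂ) - w - 1 = -w by ring]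
  rfl

lemma integrableOn (hf : IsMellinPair f F r δ) : IntegrableOn f (Set.Ioi 0) := by
  simpa using hf.integrableOn_cpow_mul (w := 0) (by simp) (by simp)

lemma integrableOn_mul_cos (hf : IsMellinPair f F r δ) (x : ℝ) :
    IntegrableOn (fun u : ℝ => f u * ((Real.cos (2 * u * x) : ℝ) : ℂ)) (Set.Ioi 0) :=
  hf.integrableOn.mul_bdd (c := 1) (Continuous.aestronglyMeasurable (by fun_prop))
    (Eventually.of_forall fun u => by
      rw [Complex.norm_real]; exact Real.abs_cos_le_one _)

lemma cosineTransform_eq (hf : IsMellinPair f F r δ) (hg : IsCosineTransform f g) {x : ℝ}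
    (hx : 0 < x) : g x = ((2 / Real.sqrt Real.pi : ℝ) : ℂ) *
      ∫ u in Set.Ioi (0 : ℝ), f u * ((Real.cos (2 * u * x) : ℝ) : ℂ) := by
  obtain ⟨I, hI, hgx⟩ := hg x hx
  rw [hgx, hI.unique (hasImproperIntegral_of_integrableOn (hf.integrableOn_mul_cos x))]

lemma continuousOn_cosineTransform (hf : IsMellinPair f F r δ) (hg : IsCosineTransform f g) :
    ContinuousOn g (Set.Ioi 0) := by
  have h : Continuous fun x : ℝ => ((2 / Real.sqrt Real.pi : ℝ) : ℂ) *
      ∫ u in Set.Ioi (0 : ℝ), f u * ((Real.cos (2 * u * x) : ℝ) : ℂ) := by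
    refine continuous_const.mul (continuous_of_dominated (bound := fun u => ‖f u‖)
      (fun x => (hf.integrableOn_mul_cos x).aestronglyMeasurable)
      (fun x => Eventually.of_forall fun u => ?_) hf.integrableOn.norm
      (Eventually.of_forall fun u => by fun_prop))
    rw [norm_mul, Complex.norm_real]
    exact mul_le_of_le_one_right (norm_nonneg _) (Real.abs_cos_le_one _)
  exact h.continuousOn.congr fun x hx => hf.cosineTransform_eq hg hx

/-- The truncated Mellin integral of the cosine transform, after exchanging the integrations. -/
lemma integral_mellinIntegrand_cosineTransform (hf : IsMellinPair f F r δ)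
    (hg : IsCosineTransform f g) (s : ℂ) {a b : ℝ} (ha : 0 < a) (hab : a ≤ b) :
    AEStronglyMeasurable (fun u : ℝ => f u * ∫ x in a..b, (x : ℂ) ^ (s - 1) *
      ((Real.cos (2 * u * x) : ℝ) : ℂ)) (volume.restrict (Set.Ioi 0)) ∧
    ∫ x in a..b, mellinIntegrand g s x = ((2 / Real.sqrt Real.pi : ℝ) : ℂ) *
      ∫ u in Set.Ioi (0 : ℝ), f u * ∫ x in a..b, (x : ℂ) ^ (s - 1) *
        ((Real.cos (2 * u * x) : ℝ) : ℂ) := by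
  have hsub : Set.Icc a b ⊆ Set.Ioi 0 := fun x hx => ha.trans_le hx.1
  have h1 : IntegrableOn (fun x : ℝ => (x : ℂ) ^ (s - 1)) (Set.Ioc a b) :=
    (((continuousOn_ofReal_cpow _).mono hsub).integrableOn_Icc).mono_set Set.Ioc_subset_Icc_self
  have h2 : Integrable (fun p : ℝ × ℝ => ((p.1 : ℂ) ^ (s - 1) * f p.2) *
      ((Real.cos (2 * p.2 * p.1) : ℝ) : ℂ))
      ((volume.restrict (Set.Ioc a b)).prod (volume.restrict (Set.Ioi 0))) :=
    (h1.mul_prod hf.integrableOn).mul_bdd (c := 1)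
      (Continuous.aestronglyMeasurable (by fun_prop)) (Eventually.of_forall fun p => by
        rw [Complex.norm_real]; exact Real.abs_cos_le_one _)
  have e : ∀ u : ℝ, f u * ∫ x in a..b, (x : ℂ) ^ (s - 1) * ((Real.cos (2 * u * x) : ℝ) : ℂ) =
      ∫ x in Set.Ioc a b, ((x : ℂ) ^ (s - 1) * f u) * ((Real.cos (2 * u * x) : ℝ) : ℂ) := by
    intro u
    rw [intervalIntegral.integral_of_le hab, ← integral_const_mul]
    congr 1; ext x; ring
  simp only [e]
  refine ⟨h2.integral_prod_right.aestronglyMeasurable, ?_⟩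
  rw [← integral_integral_swap (f := fun x u : ℝ => ((x : ℂ) ^ (s - 1) * f u) *
    ((Real.cos (2 * u * x) : ℝ) : ℂ)) h2, intervalIntegral.integral_of_le hab,
    ← integral_const_mul]
  refine setIntegral_congr_fun measurableSet_Ioc fun x hx => ?_
  simp only [mellinIntegrand]
  rw [hf.cosineTransform_eq hg (ha.trans hx.1), mul_left_comm, ← integral_const_mul]
  congr 2; ext u; ring

/-- The Mellin transform of the cosine transform, in `0 < Re s < 1`. -/
lemma hasImproperIntegral_cosineTransform (hf : IsMellinPair f F r δ) (hg : IsCosineTransform f g)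
    {s : ℂ} (hs : 0 < s.re) (hs1 : s.re < 1) :
    HasImproperIntegral (mellinIntegrand g s) (cosineSymbol F s) := by
  refine ⟨((continuousOn_ofReal_cpow _).mul (hf.continuousOn_cosineTransform hg)).locallyIntegrableOn
    measurableSet_Ioi, ?_⟩
  obtain ⟨B, hB, hbd⟩ := exists_norm_integral_cpow_mul_cos_le hs hs1
  have hev := eventually_pos_and_le
  have hK : ∀ {u : ℝ} (_ : 0 < u) {a b : ℝ} (_ : 0 < a) (_ : a ≤ b),
      ∫ x in a..b, (x : ℂ) ^ (s - 1) * ((Real.cos (2 * u * x) : ℝ) : ℂ) =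
      ((2 * u : ℝ) : ℂ) ^ (-s) * ∫ x in (2 * u * a)..(2 * u * b), (x : ℂ) ^ (s - 1) *
        ((Real.cos x : ℝ) : ℂ) :=
    fun hu _ _ ha hab => integral_cpow_mul_cos_comp_mul s (by positivity) ha hab
  have h2u : ∀ {u : ℝ} (_ : 0 < u), ((2 * u : ℝ) : ℂ) ^ (-s) = (2 : ℂ) ^ (-s) * (u : ℂ) ^ (-s) := by
    intro u hu
    rw [Complex.ofReal_mul, Complex.mul_cpow_ofReal_nonneg (by norm_num) hu.le]
    norm_num
  have hlim : Tendsto (fun p : ℝ × ℝ => ∫ u in Set.Ioi (0 : ℝ), f u * ∫ x in p.1..p.2,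
      (x : ℂ) ^ (s - 1) * ((Real.cos (2 * u * x) : ℝ) : ℂ)) (𝓝[>] 0 ×ˢ atTop)
      (𝓝 (∫ u in Set.Ioi (0 : ℝ), f u * (((2 * u : ℝ) : ℂ) ^ (-s) *
        (Complex.Gamma s * Complex.cos (Real.pi * s / 2))))) := by
    refine tendsto_integral_filter_of_dominated_convergence
      (fun u => ‖(2 : ℂ) ^ (-s)‖ * B * ‖(u : ℂ) ^ (-s) * f u‖) ?_ ?_
      ((hf.integrableOn_cpow_mul (w := s) (by linarith) hs1).norm.const_mul _) ?_
    · filter_upwards [hev] with p hp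
      exact (hf.integral_mellinIntegrand_cosineTransform hg s hp.1 hp.2).1
    · filter_upwards [hev] with p hp
      filter_upwards [ae_restrict_mem measurableSet_Ioi] with u hu
      have hu : 0 < u := hu
      rw [hK hu hp.1 hp.2, h2u hu]
      simp only [norm_mul]
      have := hbd (2 * u * p.1) (2 * u * p.2) (mul_pos (by positivity) hp.1)
        (mul_le_mul_of_nonneg_left hp.2 (by positivity))
      calc ‖f u‖ * (‖(2 : ℂ) ^ (-s)‖ * ‖(u : ℂ) ^ (-s)‖ * ‖∫ x in (2 * u * p.1)..(2 * u * p.2),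
            (x : ℂ) ^ (s - 1) * ((Real.cos x : ℝ) : ℂ)‖)
          ≤ ‖f u‖ * (‖(2 : ℂ) ^ (-s)‖ * ‖(u : ℂ) ^ (-s)‖ * B) := by gcongr
        _ = _ := by ring
    · filter_upwards [ae_restrict_mem measurableSet_Ioi] with u hu
      have hu : 0 < u := hu
      refine Tendsto.const_mul _ ?_
      have hmap : Tendsto (fun p : ℝ × ℝ => (2 * u * p.1, 2 * u * p.2)) (𝓝[>] 0 ×ˢ atTop)
          (𝓝[>] 0 ×ˢ atTop) := by
        refine Tendsto.prodMap (f := fun x : ℝ => 2 * u * x) (g := fun x : ℝ => 2 * u * x) ?_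
          (tendsto_id.const_mul_atTop (by positivity))
        refine tendsto_nhdsWithin_iff.mpr ⟨?_, ?_⟩
        · have h : Continuous fun x : ℝ => 2 * u * x := by fun_prop
          have := (h.tendsto 0).mono_left (nhdsWithin_le_nhds (s := Set.Ioi (0 : ℝ)))
          rwa [mul_zero] at this
        · filter_upwards [self_mem_nhdsWithin] with x hx
          exact mul_pos (by positivity : 0 < 2 * u) hx
      have := ((tendsto_integral_cpow_mul_cos hs hs1).comp hmap).const_mul
        (((2 * u : ℝ) : ℂ) ^ (-s))
      refine this.congr' ?_
      filter_upwards [hev] with p hp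
      exact (hK hu hp.1 hp.2).symm
  have hval : ((2 / Real.sqrt Real.pi : ℝ) : ℂ) * ∫ u in Set.Ioi (0 : ℝ), f u *
      (((2 * u : ℝ) : ℂ) ^ (-s) * (Complex.Gamma s * Complex.cos (Real.pi * s / 2))) =
      cosineSymbol F s := by
    rw [cosineSymbol, ← hf.integral_cpow_mul (w := s) (by linarith) hs1]
    congr 1
    rw [← integral_const_mul]
    refine setIntegral_congr_fun measurableSet_Ioi fun u hu => ?_
    rw [h2u hu]; ring
  rw [← hval]
  refine (hlim.const_mul _).congr' ?_
  filter_upwards [hev] with p hp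
  exact (hf.integral_mellinIntegrand_cosineTransform hg s hp.1 hp.2).2.symm

end IsMellinPair

/-! ### The cosine transform as an inverse Mellin transform -/

/-- The value at `0` of the cosine transform of `f`. -/
noncomputable def cosineTransformZero (f : ℝ → ℂ) : ℂ :=
  ((2 / Real.sqrt Real.pi : ℝ) : ℂ) * ∫ u in Set.Ioi (0 : ℝ), f u

/-- The exchange of integrations behind `IsMellinPair.hasMellin_cosineTransform_sub` is absolutely convergent. -/
lemma IsMellinPair.integrable_cpow_mul_cos_sub_one {f : ℝ → ℂ} {F : ℂ → ℂ} {r : ℂ} {δ : ℝ}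
    (hf : IsMellinPair f F r δ) {w : ℂ} (hw : -1 < w.re) (hw0 : w.re < 0) :
    Integrable (fun p : ℝ × ℝ => ((p.1 : ℂ) ^ (w - 1) * f p.2) *
      (((Real.cos (2 * p.2 * p.1) : ℝ) : ℂ) - 1))
      ((volume.restrict (Set.Ioi 0)).prod (volume.restrict (Set.Ioi 0))) := by
  have hM := (hasMellin_cos_sub_one hw hw0).1
  set h : ℝ → ℝ := fun y => ‖(y : ℂ) ^ (w - 1) • (((Real.cos y : ℝ) : ℂ) - 1)‖ with hh
  have hmeas : AEStronglyMeasurable (fun p : ℝ × ℝ => ((p.1 : ℂ) ^ (w - 1) * f p.2) *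
      (((Real.cos (2 * p.2 * p.1) : ℝ) : ℂ) - 1))
      ((volume.restrict (Set.Ioi 0)).prod (volume.restrict (Set.Ioi 0))) := by
    refine AEStronglyMeasurable.mul (AEStronglyMeasurable.mul ?_ ?_)
      (Continuous.aestronglyMeasurable (by fun_prop))
    · exact ((continuousOn_ofReal_cpow (w - 1)).aestronglyMeasurable
        measurableSet_Ioi (μ := volume)).comp_fst
    · exact hf.integrableOn.aestronglyMeasurable.comp_snd
  refine (integrable_prod_iff' hmeas).mpr ⟨?_, ?_⟩
  · filter_upwards [ae_restrict_mem measurableSet_Ioi] with u hu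
    have hu : 0 < u := hu
    have := (MellinConvergent.comp_mul_left (s := w) (by positivity : 0 < 2 * u)).mpr hM
    refine (this.const_mul (f u)).congr (Eventually.of_forall fun x => ?_)
    simp only [smul_eq_mul]; ring
  · have hI := (hf.integrableOn_cpow_mul (w := w) hw (by linarith)).norm.const_mul
      (‖(2 : ℂ) ^ (-w)‖ * ∫ y in Set.Ioi (0 : ℝ), h y)
    refine hI.congr ?_
    filter_upwards [ae_restrict_mem measurableSet_Ioi] with u hu
    have hu : 0 < u := hu
    have h2u : 0 < 2 * u := by positivity
    have e1 : ∀ x ∈ Set.Ioi (0 : ℝ), ‖((x : ℂ) ^ (w - 1) * f u) *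
        (((Real.cos (2 * u * x) : ℝ) : ℂ) - 1)‖ =
        ‖f u‖ * (2 * u) ^ (1 - w.re) * h (2 * u * x) := by
      intro x hx
      have hx : 0 < x := hx
      rw [hh]
      simp only [norm_smul, norm_mul]
      rw [Complex.norm_cpow_eq_rpow_re_of_pos hx, Complex.norm_cpow_eq_rpow_re_of_pos (by positivity),
        Real.mul_rpow h2u.le hx.le, Complex.sub_re, Complex.one_re]
      have : (2 * u) ^ (1 - w.re) * (2 * u) ^ (w.re - 1) = 1 := by
        rw [← Real.rpow_add h2u]; simp
      linear_combination (-‖f u‖ * x ^ (w.re - 1) * ‖((Real.cos (2 * u * x) : ℝ) : ℂ) - 1‖) * this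
    rw [setIntegral_congr_fun measurableSet_Ioi e1, integral_const_mul,
      integral_comp_mul_left_Ioi h 0 h2u, mul_zero, smul_eq_mul, norm_mul]
    rw [Complex.norm_cpow_eq_rpow_re_of_pos hu]
    have h2 : ‖(2 : ℂ) ^ (-w)‖ = 2 ^ (-w.re) := by
      have := Complex.norm_cpow_eq_rpow_re_of_pos (two_pos : (0 : ℝ) < 2) (-w)
      simpa using this
    have h3 : (2 * u) ^ (1 - w.re) * (2 * u)⁻¹ = 2 ^ (-w.re) * u ^ (-w.re) := by
      rw [← Real.mul_rpow (by norm_num) hu.le, ← Real.rpow_neg_one, ← Real.rpow_add h2u]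
      ring_nf
    rw [h2, Complex.neg_re]
    linear_combination (-‖f u‖ * ∫ y in Set.Ioi (0 : ℝ), h y) * h3

lemma exists_norm_Gamma_mul_cos_le {σ : ℝ} (hσ : -1 < σ) (hσ0 : σ < 0) : ∃ B : ℝ, 0 ≤ B ∧
    ∀ w : ℂ, w.re = σ → ‖Complex.Gamma w * Complex.cos (Real.pi * w / 2)‖ ≤ B := by
  refine ⟨∫ x in Set.Ioi (0 : ℝ), x ^ (σ - 1) * ‖((Real.cos x : ℝ) : ℂ) - 1‖,
    setIntegral_nonneg measurableSet_Ioi fun x hx =>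
      mul_nonneg (Real.rpow_nonneg (le_of_lt hx) _) (norm_nonneg _), fun w hw => ?_⟩
  rw [← (hasMellin_cos_sub_one (w := w) (by linarith) (by linarith)).2, mellin]
  refine (norm_integral_le_integral_norm _).trans_eq ?_
  refine setIntegral_congr_fun measurableSet_Ioi fun x hx => ?_
  rw [norm_smul, Complex.norm_cpow_eq_rpow_re_of_pos hx, Complex.sub_re, Complex.one_re, hw]

namespace IsMellinPair

variable {f g : ℝ → ℂ} {F : ℂ → ℂ} {r : ℂ} {δ : ℝ}

lemma cpow_mul_cosineTransform_sub (hf : IsMellinPair f F r δ) (hg : IsCosineTransform f g) (w : ℂ)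
    {x : ℝ} (hx : 0 < x) : (x : ℂ) ^ (w - 1) • (g x - cosineTransformZero f) =
      ((2 / Real.sqrt Real.pi : ℝ) : ℂ) * ∫ u in Set.Ioi (0 : ℝ), ((x : ℂ) ^ (w - 1) * f u) *
        (((Real.cos (2 * u * x) : ℝ) : ℂ) - 1) := by
  rw [hf.cosineTransform_eq hg hx, cosineTransformZero, ← mul_sub,
    ← integral_sub (hf.integrableOn_mul_cos x) hf.integrableOn, smul_eq_mul, mul_left_comm,
    ← integral_const_mul]
  congr 2; ext u; ring

/-- Below the line `Re w = 0`, the Mellin transform of the cosine transform converges once its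
value at `0` is subtracted, and is still given by `cosineSymbol F`. -/
lemma hasMellin_cosineTransform_sub (hf : IsMellinPair f F r δ) (hg : IsCosineTransform f g) {w : ℂ}
    (hw : -1 < w.re) (hw0 : w.re < 0) :
    HasMellin (fun x => g x - cosineTransformZero f) w (cosineSymbol F w) := by
  have hI := hf.integrable_cpow_mul_cos_sub_one hw hw0
  refine ⟨?_, ?_⟩
  · have := hI.integral_prod_left.const_mul ((2 / Real.sqrt Real.pi : ℝ) : ℂ)
    refine IntegrableOn.congr_fun this (fun x hx => ?_) measurableSet_Ioi
    exact (hf.cpow_mul_cosineTransform_sub hg w hx).symm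
  · rw [mellin, setIntegral_congr_fun measurableSet_Ioi
      fun x hx => hf.cpow_mul_cosineTransform_sub hg w hx, integral_const_mul,
      integral_integral_swap (f := fun x u : ℝ => ((x : ℂ) ^ (w - 1) * f u) *
        (((Real.cos (2 * u * x) : ℝ) : ℂ) - 1)) hI, cosineSymbol,
      ← hf.integral_cpow_mul (w := w) hw (by linarith)]
    congr 1
    rw [← integral_const_mul]
    refine setIntegral_congr_fun measurableSet_Ioi fun u hu => ?_
    have hu : 0 < u := hu
    have h := mellin_comp_mul_left (fun x : ℝ => ((Real.cos x : ℝ) : ℂ) - 1) w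
      (by positivity : 0 < 2 * u)
    rw [(hasMellin_cos_sub_one hw hw0).2, mellin, Complex.ofReal_mul,
      Complex.mul_cpow_ofReal_nonneg (by norm_num) hu.le] at h
    have e : ∫ x in Set.Ioi (0 : ℝ), ((x : ℂ) ^ (w - 1) * f u) *
        (((Real.cos (2 * u * x) : ℝ) : ℂ) - 1) = f u * ∫ x in Set.Ioi (0 : ℝ),
          (x : ℂ) ^ (w - 1) • (((Real.cos (2 * u * x) : ℝ) : ℂ) - 1) := by
      rw [← integral_const_mul]
      congr 1; ext x; rw [smul_eq_mul]; ring
    rw [e, h, smul_eq_mul]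
    push_cast
    ring

lemma integrable_cosineSymbol_line (hf : IsMellinPair f F r δ) :
    Integrable fun t : ℝ => cosineSymbol F ((-1 / 2 : ℝ) + t * Complex.I) := by
  obtain ⟨B, hB, hbd⟩ := exists_norm_Gamma_mul_cos_le (σ := -1 / 2) (by norm_num) (by norm_num)
  have hFl := (hf.integrable_line (σ := 3 / 2) (by norm_num) (by norm_num) (by norm_num)).comp_neg
  have e : ∀ t : ℝ, (1 : ℂ) - (((-1 / 2 : ℝ) : ℂ) + t * Complex.I) =
      ((3 / 2 : ℝ) : ℂ) + ((-t : ℝ) : ℂ) * Complex.I := by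
    intro t; push_cast; ring
  unfold cosineSymbol
  refine Integrable.const_mul ?_ _
  simp only [e]
  refine hFl.bdd_mul (c := 2 ^ (1 / 2 : ℝ) * B) ?_ (Eventually.of_forall fun t => ?_)
  · refine Continuous.aestronglyMeasurable ?_
    refine Continuous.mul ?_ (Continuous.mul ?_ (by fun_prop))
    · exact Continuous.const_cpow (by fun_prop) (Or.inl (by norm_num))
    · rw [continuous_iff_continuousAt]
      intro t
      refine ContinuousAt.comp (f := fun t : ℝ => ((-1 / 2 : ℝ) : ℂ) + t * Complex.I)
        (Complex.differentiableAt_Gamma _ fun m h => ?_).continuousAt (by fun_prop)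
      have h1 := congrArg Complex.re h
      simp at h1
      have h2 : ((2 * m : ℕ) : ℝ) = 1 := by push_cast; linarith
      have h3 : 2 * m = 1 := by exact_mod_cast h2
      omega
  · rw [norm_mul]
    have h2 := Complex.norm_cpow_eq_rpow_re_of_pos (two_pos : (0 : ℝ) < 2)
      (-(((-1 / 2 : ℝ) : ℂ) + t * Complex.I))
    have h3 : (-(((-1 / 2 : ℝ) : ℂ) + t * Complex.I)).re = 1 / 2 := by simp; norm_num
    rw [h3, Complex.ofReal_ofNat] at h2
    rw [h2]
    gcongr
    exact hbd _ (by simp)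

/-- The cosine transform is, up to its value at `0`, the inverse Mellin transform of
`cosineSymbol F`. -/
lemma cosineTransform_sub_eq_mellinInv (hf : IsMellinPair f F r δ) (hg : IsCosineTransform f g)
    {x : ℝ} (hx : 0 < x) :
    g x - cosineTransformZero f = mellinInv (-1 / 2 : ℝ) (cosineSymbol F) x := by
  have hM : ∀ t : ℝ, mellin (fun x => g x - cosineTransformZero f)
      (((-1 / 2 : ℝ) : ℂ) + t * Complex.I) =
      cosineSymbol F (((-1 / 2 : ℝ) : ℂ) + t * Complex.I) := fun t =>
    (hf.hasMellin_cosineTransform_sub hg (by simp; norm_num) (by simp; norm_num)).2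
  have h := mellinInv_mellin_eq (-1 / 2 : ℝ) (fun x => g x - cosineTransformZero f) hx
    (hf.hasMellin_cosineTransform_sub hg (by simp; norm_num) (by simp; norm_num)).1 ?_ ?_
  · rw [← h, mellinInv, mellinInv]
    simp only [hM]
  · unfold Complex.VerticalIntegrable
    simp only [hM]
    exact hf.integrable_cosineSymbol_line
  · exact ((hf.continuousOn_cosineTransform hg).continuousAt (Ioi_mem_nhds hx)).sub
      continuousAt_const

end IsMellinPair

/-! ### Möbius sums, zeros of `ζ` and the functional equation -/

lemma sum_Icc_eq_sum_range_succ {f : ℕ → ℂ} (h0 : f 0 = 0) (N : ℕ) :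
    ∑ n ∈ Finset.Icc 1 N, f n = ∑ n ∈ Finset.range (N + 1), f n := by
  refine Finset.sum_subset (fun n hn => ?_) fun n hn hn2 => ?_
  · simp only [Finset.mem_Icc, Finset.mem_range] at hn ⊢; omega
  · obtain rfl : n = 0 := by
      simp only [Finset.mem_Icc, Finset.mem_range] at hn hn2; omega
    exact h0

lemma norm_moebius_le_one (n : ℕ) : ‖((ArithmeticFunction.moebius n : ℤ) : ℂ)‖ ≤ 1 := by
  rw [Complex.norm_intCast]
  exact_mod_cast ArithmeticFunction.abs_moebius_le_one

/-- If `f - f₀` is the inverse Mellin transform of `G` along `Re w = -1/2`, the Möbius sum of `f`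
is an integral over that line. The constant `f₀` contributes nothing by the prime number
theorem. -/
lemma tendsto_moebiusPartialSum {f : ℝ → ℂ} {f₀ : ℂ} {G : ℂ → ℂ}
    (hG : Integrable fun t : ℝ => G ((-1 / 2 : ℝ) + t * Complex.I))
    (hf : ∀ x : ℝ, 0 < x → f x - f₀ = mellinInv (-1 / 2 : ℝ) G x) {a : ℝ} (ha : 0 < a) :
    Tendsto (moebiusPartialSum f a) atTop (𝓝 (((1 / (2 * Real.pi) : ℝ) : ℂ) *
      ∫ t : ℝ, (a : ℂ) ^ (-(((-1 / 2 : ℝ) : ℂ) + t * Complex.I)) *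
        G ((-1 / 2 : ℝ) + t * Complex.I) *
          (riemannZeta (1 - (((-1 / 2 : ℝ) : ℂ) + t * Complex.I)))⁻¹)) := by
  set w : ℝ → ℂ := fun t => ((-1 / 2 : ℝ) : ℂ) + t * Complex.I with hw
  set μ : ℕ → ℂ := fun n => ((ArithmeticFunction.moebius n : ℤ) : ℂ) with hμ
  have hre : ∀ t, (1 - w t).re = 3 / 2 := fun t => by simp [hw]; norm_num
  have hJ : Integrable fun t : ℝ => (a : ℂ) ^ (-(w t)) * G (w t) := integrable_cpow_mul_line ha hG
  have hterm : ∀ n : ℕ, 1 ≤ n → ∀ t, (((a / n : ℝ) : ℂ)) ^ (-(w t)) * (μ n / n) =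
      (a : ℂ) ^ (-(w t)) * LSeries.term μ (1 - w t) n := by
    intro n hn t
    have hn0 : (0 : ℝ) < n := by exact_mod_cast hn
    have hnc : (n : ℂ) ≠ 0 := by exact_mod_cast hn0.ne'
    rw [LSeries.term_of_ne_zero (by omega), Complex.ofReal_div,
      Complex.div_cpow_ofReal_nonneg ha.le hn0.le, Complex.ofReal_natCast, Complex.cpow_sub _ _ hnc, Complex.cpow_one,
      Complex.cpow_neg (n : ℂ)]
    field_simp
  have hsum : ∀ N : ℕ, moebiusPartialSum f a N = f₀ * ∑ n ∈ Finset.Icc 1 N, μ n / (n : ℂ) +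
      ((1 / (2 * Real.pi) : ℝ) : ℂ) * ∫ t : ℝ, (a : ℂ) ^ (-(w t)) * G (w t) *
        ∑ n ∈ Finset.range (N + 1), LSeries.term μ (1 - w t) n := by
    intro N
    have e1 : ∀ n ∈ Finset.Icc 1 N, μ n / (n : ℂ) * f (a / n) = f₀ * (μ n / (n : ℂ)) +
        ((1 / (2 * Real.pi) : ℝ) : ℂ) * ∫ t : ℝ, (a : ℂ) ^ (-(w t)) * G (w t) *
          LSeries.term μ (1 - w t) n := by
      intro n hn
      have hn1 := (Finset.mem_Icc.mp hn).1
      have hn0 : (0 : ℝ) < n := by exact_mod_cast hn1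
      have h := hf (a / n) (by positivity)
      rw [sub_eq_iff_eq_add] at h
      rw [h, mellinInv, Complex.real_smul, mul_add, mul_left_comm, ← integral_const_mul, add_comm,
        mul_comm f₀]
      congr 2
      refine integral_congr_ae (Eventually.of_forall fun t => ?_)
      have := hterm n hn1 t
      simp only [smul_eq_mul]
      linear_combination G (w t) * this
    have hint : ∀ n ∈ Finset.Icc 1 N, Integrable fun t : ℝ => (a : ℂ) ^ (-(w t)) * G (w t) *
        LSeries.term μ (1 - w t) n := by
      intro n hn
      have hn1 := (Finset.mem_Icc.mp hn).1
      have hn0 : (0 : ℝ) < ((a / n : ℝ)) := by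
        have : (0 : ℝ) < n := by exact_mod_cast hn1
        positivity
      refine ((integrable_cpow_mul_line hn0 hG).mul_const (μ n / n)).congr
        (Eventually.of_forall fun t => ?_)
      have := hterm n hn1 t
      simp only
      linear_combination G (w t) * this
    rw [moebiusPartialSum, Finset.sum_congr rfl e1, Finset.sum_add_distrib, ← Finset.mul_sum,
      ← Finset.mul_sum, ← integral_finsetSum _ hint]
    congr 3
    ext t
    rw [← Finset.mul_sum, sum_Icc_eq_sum_range_succ (LSeries.term_zero _ _)]
  have hS : Summable fun n : ℕ => 1 / (n : ℝ) ^ (3 / 2 : ℝ) :=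
    Real.summable_one_div_nat_rpow.mpr (by norm_num)
  have hnt : ∀ t n, ‖LSeries.term μ (1 - w t) n‖ ≤ 1 / (n : ℝ) ^ (3 / 2 : ℝ) := by
    intro t n
    rcases Nat.eq_zero_or_pos n with rfl | hn
    · simp
    · rw [LSeries.term_of_ne_zero (by omega), norm_div, Complex.norm_natCast_cpow_of_pos hn, hre]
      gcongr
      exact norm_moebius_le_one n
  have hlim : Tendsto (fun N : ℕ => ∫ t : ℝ, (a : ℂ) ^ (-(w t)) * G (w t) *
        ∑ n ∈ Finset.range (N + 1), LSeries.term μ (1 - w t) n) atTop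
      (𝓝 (∫ t : ℝ, (a : ℂ) ^ (-(w t)) * G (w t) * (riemannZeta (1 - w t))⁻¹)) := by
    refine tendsto_integral_of_dominated_convergence
      (fun t => ‖(a : ℂ) ^ (-(w t)) * G (w t)‖ * ∑' n : ℕ, 1 / (n : ℝ) ^ (3 / 2 : ℝ))
      (fun N => ?_) (hJ.norm.mul_const _) (fun N => Eventually.of_forall fun t => ?_)
      (Eventually.of_forall fun t => ?_)
    · refine hJ.aestronglyMeasurable.mul (Continuous.aestronglyMeasurable ?_)
      refine continuous_finsetSum _ fun n _ => ?_
      rcases Nat.eq_zero_or_pos n with rfl | hn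
      · simp only [LSeries.term_zero]; exact continuous_const
      · have hnc : (n : ℂ) ≠ 0 := by exact_mod_cast hn.ne'
        simp only [LSeries.term_of_ne_zero hn.ne']
        refine continuous_const.div (Continuous.const_cpow (by fun_prop) (Or.inl hnc)) fun t => ?_
        simp [Complex.cpow_eq_zero_iff, hnc]
    · rw [norm_mul]
      gcongr
      refine (norm_sum_le _ _).trans ((Finset.sum_le_sum fun n _ => hnt t n).trans ?_)
      exact hS.sum_le_tsum _ fun n _ => by positivity
    · refine Tendsto.const_mul _ ?_
      have h1 : LSeriesSummable μ (1 - w t) :=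
        ArithmeticFunction.LSeriesSummable_moebius_iff.mpr (by rw [hre]; norm_num)
      have h2 := h1.hasSum.tendsto_sum_nat.comp (tendsto_add_atTop_nat 1)
      have h3 : ∑' n, LSeries.term μ (1 - w t) n = (riemannZeta (1 - w t))⁻¹ :=
        LSeries_moebius_eq_inv (by rw [hre]; norm_num)
      rwa [h3] at h2
  have h := (tendsto_sum_moebius_div.const_mul f₀).add
    (hlim.const_mul ((1 / (2 * Real.pi) : ℝ) : ℂ))
  rw [mul_zero, zero_add] at h
  exact h.congr fun N => (hsum N).symm

/-- The factor `X` of the functional equation `ζ(1 - s) = X(s) ζ(s)`. -/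
noncomputable def zetaFactor (s : ℂ) : ℂ :=
  2 * (2 * Real.pi) ^ (-s) * Complex.Gamma s * Complex.cos (Real.pi * s / 2)

lemma riemannZeta_one_sub_eq {s : ℂ} (hs : ∀ n : ℕ, s ≠ -n) (h1 : s ≠ 1) :
    riemannZeta (1 - s) = zetaFactor s * riemannZeta s := riemannZeta_one_sub hs h1

lemma cosineSymbol_eq (F : ℂ → ℂ) (s : ℂ) : cosineSymbol F s =
    1 / (Real.sqrt Real.pi : ℂ) * (Real.pi : ℂ) ^ s * zetaFactor s * F (1 - s) := by
  have h : ((2 : ℂ) * Real.pi) ^ (-s) = (2 : ℂ) ^ (-s) * (Real.pi : ℂ) ^ (-s) := by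
    have := Complex.mul_cpow_ofReal_nonneg (by norm_num : (0 : ℝ) ≤ 2) Real.pi_pos.le (-s)
    simpa using this
  have hpi : (Real.pi : ℂ) ≠ 0 := by exact_mod_cast Real.pi_ne_zero
  have h2 : (Real.pi : ℂ) ^ s * (Real.pi : ℂ) ^ (-s) = 1 := by
    rw [← Complex.cpow_add _ _ hpi, add_neg_cancel, Complex.cpow_zero]
  rw [cosineSymbol, zetaFactor, h]
  push_cast
  linear_combination (-(2 / (Real.sqrt Real.pi : ℂ)) * (2 : ℂ) ^ (-s) * Complex.Gamma s *
    Complex.cos (Real.pi * s / 2) * F (1 - s)) * h2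

lemma ne_neg_natCast_of_re_pos {s : ℂ} (hs : 0 < s.re) (n : ℕ) : s ≠ -n := by
  rintro rfl
  simp at hs
  linarith [n.cast_nonneg (α := ℝ)]

lemma IsNontrivialZetaZero.one_sub {ρ : ℂ} (h : IsNontrivialZetaZero ρ) :
    IsNontrivialZetaZero (1 - ρ) := by
  obtain ⟨h0, h1, h2⟩ := h
  refine ⟨?_, by simp; linarith, by simp; linarith⟩
  rw [riemannZeta_one_sub_eq (ne_neg_natCast_of_re_pos h1) (by rintro rfl; simp at h2), h0,
    mul_zero]

lemma deriv_riemannZeta_one_sub {ρ : ℂ} (h : IsNontrivialZetaZero ρ) :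
    -deriv riemannZeta (1 - ρ) = zetaFactor ρ * deriv riemannZeta ρ := by
  obtain ⟨h0, h1, h2⟩ := h
  have hne : ρ ≠ 1 := by rintro rfl; simp at h2
  have hne0 : 1 - ρ ≠ 1 := fun h => by
    have : ρ = 0 := by linear_combination -h
    rw [this] at h1; simp at h1
  have hpi : (2 : ℂ) * Real.pi ≠ 0 := by simp [Real.pi_ne_zero]
  have hX : DifferentiableAt ℂ zetaFactor ρ := by
    unfold zetaFactor
    refine DifferentiableAt.mul (DifferentiableAt.mul (DifferentiableAt.mul (by fun_prop) ?_) ?_)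
      (by fun_prop)
    · exact differentiableAt_id.neg.const_cpow (Or.inl hpi)
    · exact Complex.differentiableAt_Gamma _ (ne_neg_natCast_of_re_pos h1)
  have hl : HasDerivAt (fun s => riemannZeta (1 - s)) (-deriv riemannZeta (1 - ρ)) ρ := by
    have := (differentiableAt_riemannZeta hne0).hasDerivAt.comp ρ ((hasDerivAt_id ρ).const_sub 1)
    simpa [Function.comp_def] using this
  have hr := hX.hasDerivAt.mul (differentiableAt_riemannZeta hne).hasDerivAt
  rw [h0, mul_zero, zero_add] at hr
  have hU : {s : ℂ | 0 < s.re ∧ s ≠ 1} ∈ 𝓝 ρ :=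
    ((isOpen_lt continuous_const Complex.continuous_re).inter isOpen_ne).mem_nhds ⟨h1, hne⟩
  have hev : (fun s => riemannZeta (1 - s)) =ᶠ[𝓝 ρ] zetaFactor * riemannZeta := by
    filter_upwards [hU] with s hs
    exact riemannZeta_one_sub_eq (ne_neg_natCast_of_re_pos hs.1) hs.2
  exact (hl.congr_of_eventuallyEq hev.symm).unique hr

/-- In the strip `-1 < Re s < 2`, the zeros of the zeta function are the nontrivial ones. -/
lemma isNontrivialZetaZero_of_riemannZeta_eq_zero {s : ℂ} (hs : -1 < s.re)
    (h0 : riemannZeta s = 0) : IsNontrivialZetaZero s := by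
  have h1 : s.re < 1 := by
    by_contra! h
    exact riemannZeta_ne_zero_of_one_le_re h h0
  refine ⟨h0, ?_, h1⟩
  by_contra! h
  have hn : ∀ n : ℕ, s ≠ -n := by
    rintro n rfl
    simp only [Complex.neg_re, Complex.natCast_re] at hs
    have : n < 1 := by exact_mod_cast (by linarith : (n : ℝ) < 1)
    obtain rfl : n = 0 := by omega
    simp [riemannZeta_zero] at h0
  have := riemannZeta_one_sub_eq hn (by rintro rfl; simp at h1)
  rw [h0, mul_zero] at this
  exact riemannZeta_ne_zero_of_one_le_re (by simp; linarith) this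

lemma mem_zetaZerosBelow {T : ℝ} {ρ : ℂ} :
    ρ ∈ zetaZerosBelow T ↔ IsNontrivialZetaZero ρ ∧ |ρ.im| < T := by
  simp [zetaZerosBelow]

/-- The integrand of the contour integral. -/
noncomputable def contourIntegrand (F : ℂ → ℂ) (α : ℝ) (s : ℂ) : ℂ :=
  (α : ℂ) ^ (s - 1) * F (1 - s) * (riemannZeta s)⁻¹

section Contour

variable {F : ℂ → ℂ} {r : ℂ} {δ α : ℝ}

lemma differentiableAt_cpow_sub_one (hα : 0 < α) (s : ℂ) :
    DifferentiableAt ℂ (fun s : ℂ => (α : ℂ) ^ (s - 1)) s :=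
  (differentiableAt_id.sub_const 1).const_cpow (Or.inl (by exact_mod_cast hα.ne'))

lemma StripSymbol.differentiableAt_one_sub (hF : StripSymbol F r δ) {s : ℂ} (h1 : -1 < s.re)
    (h2 : s.re < 2) (h3 : s ≠ 1) : DifferentiableAt ℂ (fun s => F (1 - s)) s := by
  refine DifferentiableAt.comp s (hF.differentiableAt (by simp; linarith) (by simp; linarith) ?_)
    (by fun_prop)
  exact sub_ne_zero.mpr h3.symm

/-- The contour integral over a rectangle whose horizontal sides avoid the zeros. At `s = 1` the
pole of `F (1 - s)` is cancelled by that of `ζ`. -/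
lemma rectIntegral_contourIntegrand (hF : StripSymbol F r δ) (hα : 0 < α)
    (simple_zeros : ∀ ρ : ℂ, IsNontrivialZetaZero ρ → deriv riemannZeta ρ ≠ 0) {T : ℝ} (hT : 0 < T)
    (hz : ∀ s : ℂ, -1 / 2 ≤ s.re → s.re ≤ 3 / 2 → |s.im| = T → riemannZeta s ≠ 0) :
    rectIntegral (contourIntegrand F α) (-1 / 2 : ℝ) (3 / 2 : ℝ) (-T) T =
      2 * Real.pi * Complex.I *
        ∑ ρ ∈ zetaZerosBelow T, (α : ℂ) ^ (ρ - 1) * F (1 - ρ) * (deriv riemannZeta ρ)⁻¹ := by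
  set R : ℂ → ℂ := fun p => if p = 1 then 0 else
    (α : ℂ) ^ (p - 1) * F (1 - p) * (deriv riemannZeta p)⁻¹ with hR
  have h1not : (1 : ℂ) ∉ zetaZerosBelow T := by
    rw [mem_zetaZerosBelow]; rintro ⟨⟨-, -, h⟩, -⟩; simp at h
  have hsum : ∑ p ∈ insert 1 (zetaZerosBelow T), R p =
      ∑ ρ ∈ zetaZerosBelow T, (α : ℂ) ^ (ρ - 1) * F (1 - ρ) * (deriv riemannZeta ρ)⁻¹ := by
    rw [Finset.sum_insert h1not, hR]
    simp only [if_true, zero_add]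
    refine Finset.sum_congr rfl fun ρ hρ => if_neg ?_
    rintro rfl; exact h1not hρ
  rw [← hsum]
  refine rectIntegral_eq_sum_residues (by norm_num) (by linarith) R _ _ ?_ ?_
  · intro s h1 h2 h3 h4 hs
    rw [Finset.mem_insert, not_or] at hs
    have hzs : riemannZeta s ≠ 0 := by
      intro h0
      have hn := isNontrivialZetaZero_of_riemannZeta_eq_zero (by linarith) h0
      rcases (abs_le.mpr ⟨h3, h4⟩).lt_or_eq with h | h
      · exact hs.2 (mem_zetaZerosBelow.mpr ⟨hn, h⟩)
      · exact hz s h1 h2 h h0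
    exact ((differentiableAt_cpow_sub_one hα s).mul
      (hF.differentiableAt_one_sub (by linarith) (by linarith) hs.1)).mul
      ((differentiableAt_riemannZeta hs.1).inv hzs)
  · intro p hp
    rcases Finset.mem_insert.mp hp with rfl | hp
    · refine ⟨by norm_num, by norm_num, by simpa, by simpa, ?_⟩
      have e1 : Tendsto (fun s : ℂ => (α : ℂ) ^ (s - 1)) (𝓝[≠] 1) (𝓝 1) := by
        have := (differentiableAt_cpow_sub_one hα 1).continuousAt.tendsto.mono_left
          (nhdsWithin_le_nhds (s := {1}ᶜ))
        simpa using this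
      have e2 : Tendsto (fun s : ℂ => 1 - s) (𝓝[≠] 1) (𝓝[≠] 0) := by
        refine tendsto_nhdsWithin_iff.mpr ⟨?_, ?_⟩
        · have h : Continuous fun s : ℂ => 1 - s := by fun_prop
          have := (h.tendsto 1).mono_left (nhdsWithin_le_nhds (s := {1}ᶜ))
          simpa using this
        · filter_upwards [self_mem_nhdsWithin] with s hs
          exact sub_ne_zero.mpr (Ne.symm hs)
      have e3 := hF.residue.comp e2
      have e4 : Tendsto (fun s : ℂ => s - 1) (𝓝[≠] 1) (𝓝 0) := by
        have h : Continuous fun s : ℂ => s - 1 := by fun_prop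
        have := (h.tendsto 1).mono_left (nhdsWithin_le_nhds (s := {1}ᶜ))
        simpa using this
      have e5 : Tendsto (fun s : ℂ => (riemannZeta s)⁻¹) (𝓝[≠] 1) (𝓝 0) := by
        have := e4.mul (riemannZeta_residue_one.inv₀ one_ne_zero)
        rw [zero_mul] at this
        refine this.congr' ?_
        filter_upwards [self_mem_nhdsWithin] with s hs
        have : s - 1 ≠ 0 := sub_ne_zero.mpr hs
        rw [mul_inv, mul_inv_cancel_left₀ this]
      have := (e1.mul (e3.mul e5)).neg
      simp only [mul_zero, neg_zero] at this
      rw [hR]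
      simp only [if_true]
      refine this.congr fun s => ?_
      simp only [contourIntegrand, Function.comp]
      ring
    · have hp' := mem_zetaZerosBelow.mp hp
      obtain ⟨⟨h0, h1, h2⟩, h3⟩ := hp'
      have h4 := abs_lt.mp h3
      have hne : p ≠ 1 := by rintro rfl; simp at h2
      refine ⟨by linarith, by linarith, h4.1, h4.2, ?_⟩
      have e1 : Tendsto (fun s : ℂ => (α : ℂ) ^ (s - 1) * F (1 - s)) (𝓝[≠] p)
          (𝓝 ((α : ℂ) ^ (p - 1) * F (1 - p))) :=
        ((differentiableAt_cpow_sub_one hα p).mul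
          (hF.differentiableAt_one_sub (by linarith) (by linarith) hne)).continuousAt.tendsto.mono_left
          nhdsWithin_le_nhds
      have e2 := ((differentiableAt_riemannZeta hne).hasDerivAt.tendsto_slope).inv₀
        (simple_zeros p ⟨h0, h1, h2⟩)
      have := e1.mul e2
      rw [hR]
      simp only [if_neg hne]
      refine this.congr fun s => ?_
      rw [slope_def_field, h0, sub_zero, contourIntegrand, inv_div]
      ring

end Contour

section Assembly

variable {φ ψ : ℝ → ℂ} {F : ℂ → ℂ} {r : ℂ} {δ α β : ℝ}

lemma contourIntegrand_right_eq (F : ℂ → ℂ) (α t : ℝ) :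
    contourIntegrand F α (((3 / 2 : ℝ) : ℂ) + t * Complex.I) =
      (α : ℂ) ^ (-(((-1 / 2 : ℝ) : ℂ) + ((-t : ℝ) : ℂ) * Complex.I)) *
        F (((-1 / 2 : ℝ) : ℂ) + ((-t : ℝ) : ℂ) * Complex.I) *
          (riemannZeta (1 - (((-1 / 2 : ℝ) : ℂ) + ((-t : ℝ) : ℂ) * Complex.I)))⁻¹ := by
  rw [contourIntegrand]
  congr 3
  · push_cast; ring
  · push_cast; ring
  · push_cast; ring

/-- On the left line, the functional equation turns the integrand for `φ` into the one for `ψ`. -/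
lemma contourIntegrand_left_eq (F : ℂ → ℂ) (hα : 0 < α) (hβ : 0 < β) (hαβ : α * β = Real.pi)
    {s : ℂ} (hs : s.re = -1 / 2) :
    contourIntegrand F α s = (Real.sqrt β : ℂ) / (Real.sqrt α : ℂ) *
      ((β : ℂ) ^ (-s) * cosineSymbol F s * (riemannZeta (1 - s))⁻¹) := by
  have hn : ∀ n : ℕ, s ≠ -n := by
    rintro n rfl
    simp only [Complex.neg_re, Complex.natCast_re] at hs
    have h2 : ((2 * n : ℕ) : ℝ) = 1 := by push_cast; linarith
    have h3 : 2 * n = 1 := by exact_mod_cast h2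
    omega
  have h1 : s ≠ 1 := by rintro rfl; norm_num at hs
  have hfe := riemannZeta_one_sub_eq hn h1
  have hz1 : riemannZeta (1 - s) ≠ 0 :=
    riemannZeta_ne_zero_of_one_le_re (by simp [hs]; norm_num)
  have hX : zetaFactor s ≠ 0 := fun h => hz1 (by rw [hfe, h, zero_mul])
  have hz : riemannZeta s ≠ 0 := fun h => hz1 (by rw [hfe, h, mul_zero])
  have hαc : (α : ℂ) ≠ 0 := by exact_mod_cast hα.ne'
  have hβc : (β : ℂ) ≠ 0 := by exact_mod_cast hβ.ne'
  have hsα : (Real.sqrt α : ℂ) ≠ 0 := by exact_mod_cast (Real.sqrt_pos.mpr hα).ne'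
  have hsβ : (Real.sqrt β : ℂ) ≠ 0 := by exact_mod_cast (Real.sqrt_pos.mpr hβ).ne'
  have hpi : (Real.pi : ℂ) ^ s = (α : ℂ) ^ s * (β : ℂ) ^ s := by
    rw [← Complex.mul_cpow_ofReal_nonneg hα.le hβ.le, ← hαβ, Complex.ofReal_mul]
  have hsq : (Real.sqrt Real.pi : ℂ) = (Real.sqrt α : ℂ) * (Real.sqrt β : ℂ) := by
    rw [← hαβ, Real.sqrt_mul hα.le, Complex.ofReal_mul]
  have hα2 : (α : ℂ) = (Real.sqrt α : ℂ) * (Real.sqrt α : ℂ) := by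
    rw [← Complex.ofReal_mul, Real.mul_self_sqrt hα.le]
  have hb : (β : ℂ) ^ s ≠ 0 := by simp [Complex.cpow_eq_zero_iff, hβc]
  rw [contourIntegrand, cosineSymbol_eq, hfe, hpi, hsq, Complex.cpow_sub _ _ hαc, Complex.cpow_one,
    Complex.cpow_neg]
  rw [show (α : ℂ) ^ s / (α : ℂ) = (α : ℂ) ^ s / ((Real.sqrt α : ℂ) * (Real.sqrt α : ℂ)) by
    rw [← hα2]]
  field_simp

lemma zetaZeroSum_eq {f : ℝ → ℂ} {G : ℂ → ℂ} (hf : ∀ s : ℂ, 0 < s.re → s.re < 1 →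
    HasImproperIntegral (mellinIntegrand f s) (G s)) (a T : ℝ) :
    zetaZeroSum f a T = ∑ ρ ∈ zetaZerosBelow T, G (1 - ρ) * (a : ℂ) ^ ρ / deriv riemannZeta ρ := by
  refine Finset.sum_congr rfl fun ρ hρ => ?_
  obtain ⟨⟨-, h1, h2⟩, -⟩ := mem_zetaZerosBelow.mp hρ
  have hre : 0 < (1 - ρ).re := by simp; linarith
  rw [normalizedMellin, (hf (1 - ρ) hre (by simp; linarith)).improperIntegral_eq, ← mul_assoc,
    mul_one_div_cancel (Complex.Gamma_ne_zero_of_re_pos hre), one_mul]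

/-- The two sums over zeros agree term by term under `ρ ↦ 1 - ρ`. -/
lemma zetaZeroSum_reciprocal (hα : 0 < α) (hβ : 0 < β) (hαβ : α * β = Real.pi)
    (simple_zeros : ∀ ρ : ℂ, IsNontrivialZetaZero ρ → deriv riemannZeta ρ ≠ 0)
    (hφ : ∀ s : ℂ, 0 < s.re → s.re < 1 → HasImproperIntegral (mellinIntegrand φ s) (F s))
    (hψ : ∀ s : ℂ, 0 < s.re → s.re < 1 →
      HasImproperIntegral (mellinIntegrand ψ s) (cosineSymbol F s)) (T : ℝ) :
    -(1 / (Real.sqrt β : ℂ)) * zetaZeroSum ψ β T = 1 / (Real.sqrt α : ℂ) * zetaZeroSum φ α T := by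
  rw [zetaZeroSum_eq hφ, zetaZeroSum_eq hψ, Finset.mul_sum, Finset.mul_sum]
  have hmem : ∀ ρ ∈ zetaZerosBelow T, 1 - ρ ∈ zetaZerosBelow T := by
    intro ρ hρ
    obtain ⟨h1, h2⟩ := mem_zetaZerosBelow.mp hρ
    exact mem_zetaZerosBelow.mpr ⟨h1.one_sub, by simpa using h2⟩
  refine Finset.sum_nbij' (fun ρ => 1 - ρ) (fun ρ => 1 - ρ) hmem hmem (by simp) (by simp) ?_
  intro ρ hρ
  obtain ⟨h1, -⟩ := mem_zetaZerosBelow.mp (hmem ρ hρ)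
  obtain ⟨σ, rfl⟩ : ∃ σ, ρ = 1 - σ := ⟨1 - ρ, by ring⟩
  rw [sub_sub_cancel] at h1 ⊢
  have hd := deriv_riemannZeta_one_sub h1
  have hd1 := simple_zeros σ h1
  have hd2 := simple_zeros _ h1.one_sub
  have hX : zetaFactor σ ≠ 0 := fun h => hd2 (by
    rw [h, zero_mul] at hd; exact neg_eq_zero.mp hd)
  have hd' : deriv riemannZeta (1 - σ) = -(zetaFactor σ * deriv riemannZeta σ) := by
    rw [← hd, neg_neg]
  have hβc : (β : ℂ) ≠ 0 := by exact_mod_cast hβ.ne'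
  have hsα : (Real.sqrt α : ℂ) ≠ 0 := by exact_mod_cast (Real.sqrt_pos.mpr hα).ne'
  have hsβ : (Real.sqrt β : ℂ) ≠ 0 := by exact_mod_cast (Real.sqrt_pos.mpr hβ).ne'
  have hpi : (Real.pi : ℂ) ^ σ = (α : ℂ) ^ σ * (β : ℂ) ^ σ := by
    rw [← Complex.mul_cpow_ofReal_nonneg hα.le hβ.le, ← hαβ, Complex.ofReal_mul]
  have hsq : (Real.sqrt Real.pi : ℂ) = (Real.sqrt α : ℂ) * (Real.sqrt β : ℂ) := by
    rw [← hαβ, Real.sqrt_mul hα.le, Complex.ofReal_mul]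
  have hβ2 : (β : ℂ) = (Real.sqrt β : ℂ) * (Real.sqrt β : ℂ) := by
    rw [← Complex.ofReal_mul, Real.mul_self_sqrt hβ.le]
  have hb : (β : ℂ) ^ σ ≠ 0 := by simp [Complex.cpow_eq_zero_iff, hβc]
  rw [cosineSymbol_eq, hd', hpi, hsq, Complex.cpow_sub _ _ hβc, Complex.cpow_one]
  rw [show (β : ℂ) / (β : ℂ) ^ σ = ((Real.sqrt β : ℂ) * (Real.sqrt β : ℂ)) / (β : ℂ) ^ σ by
    rw [← hβ2]]
  field_simp

lemma tendsto_const_mul_rpow_mul_rpow {δ : ℝ} (hδ : 0 < δ) (C : ℝ) {T : ℕ → ℝ}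
    (hT : Tendsto T atTop atTop) :
    Tendsto (fun n => C * (T n ^ (-1 - δ) * T n ^ (0.95 : ℝ))) atTop (𝓝 0) := by
  have h := ((tendsto_rpow_neg_atTop (by linarith : 0 < 0.05 + δ)).comp hT).const_mul C
  rw [mul_zero] at h
  refine h.congr' ?_
  filter_upwards [hT.eventually_gt_atTop 0] with n hn
  rw [Function.comp, ← Real.rpow_add hn]
  congr 2; norm_num; ring

end Assembly

theorem corollary2p10
    (simple_zeros : ∀ ρ : ℂ, IsNontrivialZetaZero ρ → deriv riemannZeta ρ ≠ 0)
    (φ ψ : ℝ → ℂ) (hφ : MellinAdmissible φ) (hφψ : CosineReciprocal φ ψ)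
    (α β : ℝ) (hα : 0 < α) (hβ : 0 < β) (hαβ : α * β = Real.pi) :
    (∀ s : ℂ, 0 < s.re → s.re < 1 →
      (∃ I : ℂ, HasImproperIntegral (mellinIntegrand φ s) I) ∧
      (∃ I : ℂ, HasImproperIntegral (mellinIntegrand ψ s) I)) ∧
    ∃ A B : ℂ,
      Tendsto (moebiusPartialSum φ α) atTop (𝓝 A) ∧
      Tendsto (moebiusPartialSum ψ β) atTop (𝓝 B) ∧
      ∃ T : ℕ → ℝ, Tendsto T atTop atTop ∧
        Tendsto (fun n : ℕ => 1 / (Real.sqrt α : ℂ) * zetaZeroSum φ α (T n)) atTop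
          (𝓝 ((Real.sqrt α : ℂ) * A - (Real.sqrt β : ℂ) * B)) ∧
        Tendsto (fun n : ℕ => -(1 / (Real.sqrt β : ℂ)) * zetaZeroSum ψ β (T n)) atTop
          (𝓝 ((Real.sqrt α : ℂ) * A - (Real.sqrt β : ℂ) * B)) := by
  obtain ⟨F, r, δ, hF⟩ := hφ.exists_isMellinPair
  have hg := hφψ.1
  have hφI : ∀ s : ℂ, 0 < s.re → s.re < 1 → HasImproperIntegral (mellinIntegrand φ s) (F s) :=
    fun s h1 h2 => hF.hasImproperIntegral h1 (by linarith)
  have hψI : ∀ s : ℂ, 0 < s.re → s.re < 1 →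
      HasImproperIntegral (mellinIntegrand ψ s) (cosineSymbol F s) :=
    fun s h1 h2 => hF.hasImproperIntegral_cosineTransform hg h1 h2
  refine ⟨fun s h1 h2 => ⟨⟨_, hφI s h1 h2⟩, ⟨_, hψI s h1 h2⟩⟩, ?_⟩
  have hFl := hF.integrable_line (σ := -1 / 2) (by norm_num) (by norm_num) (by norm_num)
  have hGl := hF.integrable_cosineSymbol_line
  have hA := tendsto_moebiusPartialSum hFl hF.sub_residue hα
  have hB := tendsto_moebiusPartialSum hGl
    (fun x hx => hF.cosineTransform_sub_eq_mellinInv hg hx) hβ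
  set A₁ : ℝ → ℂ := fun t => (α : ℂ) ^ (-(((-1 / 2 : ℝ) : ℂ) + t * Complex.I)) *
    F ((-1 / 2 : ℝ) + t * Complex.I) *
      (riemannZeta (1 - (((-1 / 2 : ℝ) : ℂ) + t * Complex.I)))⁻¹ with hA₁
  set B₁ : ℝ → ℂ := fun t => (β : ℂ) ^ (-(((-1 / 2 : ℝ) : ℂ) + t * Complex.I)) *
    cosineSymbol F ((-1 / 2 : ℝ) + t * Complex.I) *
      (riemannZeta (1 - (((-1 / 2 : ℝ) : ℂ) + t * Complex.I)))⁻¹ with hB₁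
  refine ⟨_, _, hA, hB, ?_⟩
  -- the reciprocal of the zeta function is bounded and continuous on the line
  obtain ⟨K, -, hK⟩ := norm_riemannZeta_bounds (σ := 3 / 2) (by norm_num)
  have hre : ∀ t : ℝ, (1 - (((-1 / 2 : ℝ) : ℂ) + t * Complex.I)).re = 3 / 2 := fun t => by
    simp; norm_num
  have hzc : Continuous fun t : ℝ =>
      (riemannZeta (1 - (((-1 / 2 : ℝ) : ℂ) + t * Complex.I)))⁻¹ := by
    refine Continuous.inv₀ ?_ fun t => riemannZeta_ne_zero_of_one_le_re (by rw [hre]; norm_num)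
    rw [continuous_iff_continuousAt]
    intro t
    refine ContinuousAt.comp (f := fun t : ℝ => 1 - (((-1 / 2 : ℝ) : ℂ) + t * Complex.I))
      (differentiableAt_riemannZeta fun h => ?_).continuousAt (by fun_prop)
    have := hre t
    rw [h] at this; norm_num at this
  have hA₁i : Integrable A₁ := (integrable_cpow_mul_line hα hFl).mul_bdd (c := K)
    hzc.aestronglyMeasurable (Eventually.of_forall fun t => (hK _ (hre t).ge).2)
  have hB₁i : Integrable B₁ := (integrable_cpow_mul_line hβ hGl).mul_bdd (c := K)
    hzc.aestronglyMeasurable (Eventually.of_forall fun t => (hK _ (hre t).ge).2)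
  have hright : ∀ t : ℝ, contourIntegrand F α (((3 / 2 : ℝ) : ℂ) + t * Complex.I) = A₁ (-t) :=
    fun t => contourIntegrand_right_eq F α t
  have hleft : ∀ t : ℝ, contourIntegrand F α (((-1 / 2 : ℝ) : ℂ) + t * Complex.I) =
      (Real.sqrt β : ℂ) / (Real.sqrt α : ℂ) * B₁ t :=
    fun t => contourIntegrand_left_eq F hα hβ hαβ (by simp)
  -- heights at which `1 / ζ` is small
  obtain ⟨C, hC, hheight⟩ := exists_height_norm_inv_riemannZeta_le simple_zeros
  choose T hT1 hT2 hT3 using fun n : ℕ => hheight n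
  have hTtop : Tendsto T atTop atTop := tendsto_atTop_mono hT1 tendsto_natCast_atTop_atTop
  obtain ⟨D, hD⟩ := hF.decay (-1 / 2) (3 / 2) (by norm_num) (by norm_num)
  obtain ⟨M, hM⟩ := isCompact_Icc.exists_bound_of_continuousOn (s := Set.Icc (-1 / 2 : ℝ) (3 / 2))
    (f := fun x : ℝ => α ^ (x - 1))
    (Continuous.continuousOn (Continuous.rpow continuous_const (by fun_prop)
      fun x => Or.inl hα.ne'))
  have hlim := tendsto_rectIntegral (h := contourIntegrand F α) (a := -1 / 2) (b := 3 / 2)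
    (by norm_num) hTtop (by simp only [hleft]; exact hB₁i.const_mul _)
    (by simp only [hright]; exact hA₁i.comp_neg)
    (tendsto_const_mul_rpow_mul_rpow hF.pos (M * |D| * C) hTtop) (by
      refine Eventually.of_forall fun n x hx1 hx2 => ?_
      have hT0 : 0 < T n := by linarith [hT2 n]
      have key : ∀ t : ℝ, |t| = T n → ‖contourIntegrand F α (x + t * Complex.I)‖ ≤
          M * |D| * C * (T n ^ (-1 - δ) * T n ^ (0.95 : ℝ)) := by
        intro t ht
        have b1 := hM x ⟨hx1, hx2⟩
        have hM0 : 0 ≤ M := (norm_nonneg _).trans b1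
        rw [Real.norm_of_nonneg (by positivity)] at b1
        have b2 := hD (1 - x) (-t) (by linarith) (by linarith) (by rw [abs_neg, ht]; exact hT2 n)
        rw [abs_neg, ht] at b2
        have b3 := (hT3 n (x + t * Complex.I) (by simpa using hx1) (by simpa using hx2)
          (by simpa using ht)).2
        have e : (1 : ℂ) - (x + t * Complex.I) =
            ((1 - x : ℝ) : ℂ) + ((-t : ℝ) : ℂ) * Complex.I := by push_cast; ring
        rw [contourIntegrand, norm_mul, norm_mul, Complex.norm_cpow_eq_rpow_re_of_pos hα, e]
        have e2 : ((x : ℂ) + t * Complex.I - 1).re = x - 1 := by simp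
        rw [e2]
        have b4 : D * T n ^ (-1 - δ) ≤ |D| * T n ^ (-1 - δ) := by
          gcongr; exact le_abs_self D
        calc α ^ (x - 1) * ‖F (((1 - x : ℝ) : ℂ) + ((-t : ℝ) : ℂ) * Complex.I)‖ *
              ‖(riemannZeta (x + t * Complex.I))⁻¹‖
            ≤ M * (|D| * T n ^ (-1 - δ)) * (C * T n ^ (0.95 : ℝ)) := by
              gcongr
              exact b2.trans b4
          _ = _ := by ring
      exact ⟨key (T n) (abs_of_pos hT0), key (-T n) (by rw [abs_neg, abs_of_pos hT0])⟩)
  have hI1 : ∫ t : ℝ, contourIntegrand F α (((3 / 2 : ℝ) : ℂ) + t * Complex.I) = ∫ t, A₁ t := by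
    simp only [hright]
    exact integral_neg_eq_self A₁ volume
  have hI2 : ∫ t : ℝ, contourIntegrand F α (((-1 / 2 : ℝ) : ℂ) + t * Complex.I) =
      (Real.sqrt β : ℂ) / (Real.sqrt α : ℂ) * ∫ t, B₁ t := by
    simp only [hleft]
    exact integral_const_mul _ _
  rw [hI1, hI2] at hlim
  have hαc : (α : ℂ) ≠ 0 := by exact_mod_cast hα.ne'
  have hsα : (Real.sqrt α : ℂ) ≠ 0 := by exact_mod_cast (Real.sqrt_pos.mpr hα).ne'
  have hα2 : (α : ℂ) = (Real.sqrt α : ℂ) * (Real.sqrt α : ℂ) := by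
    rw [← Complex.ofReal_mul, Real.mul_self_sqrt hα.le]
  have hpi : (Real.pi : ℂ) ≠ 0 := by exact_mod_cast Real.pi_ne_zero
  have hmain : Tendsto (fun n : ℕ => 1 / (Real.sqrt α : ℂ) * zetaZeroSum φ α (T n)) atTop
      (𝓝 ((Real.sqrt α : ℂ) * (((1 / (2 * Real.pi) : ℝ) : ℂ) * ∫ t, A₁ t) -
        (Real.sqrt β : ℂ) * (((1 / (2 * Real.pi) : ℝ) : ℂ) * ∫ t, B₁ t))) := by
    have h := hlim.const_mul ((Real.sqrt α : ℂ) / (2 * Real.pi * Complex.I))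
    refine (h.congr fun n => ?_).trans_eq ?_
    · rw [rectIntegral_contourIntegrand hF.toStripSymbol hα simple_zeros
        (by linarith [hT2 n]) (fun s h1 h2 h3 => (hT3 n s h1 h2 h3).1), zetaZeroSum_eq hφI,
        ← mul_assoc, div_mul_cancel₀ _ (by simp [Real.pi_ne_zero]), Finset.mul_sum, Finset.mul_sum]
      refine Finset.sum_congr rfl fun ρ _ => ?_
      rw [Complex.cpow_sub _ _ hαc, Complex.cpow_one, hα2]
      field_simp
    · congr 1
      push_cast
      field_simp
  exact ⟨T, hTtop, hmain, hmain.congr fun n =>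
    (zetaZeroSum_reciprocal hα hβ hαβ simple_zeros hφI hψI (T n)).symm⟩
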